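/- Let $1\le N\le 4$, let $\mathrm{NonNullPID}$ be a set of $N$ process identifiers (the users) and $\mathrm{PID}=\mathrm{NonNullPID}\cup\{NULL\}$. All processes are CSP processes with their usual operational semantics; unwinding a recursive definition is not a transition. **Specification.** With $\alpha=\{|begin\_claim, lin\_claim, end\_claim, begin\_release, lin\_release, end\_release|\}$, $$SPEC=\Bigl(\bigl(|||_{u}\,USER(u)\bigr)\,\underset{\alpha}{\|}\,MUTEX(NULL)\Bigr)\setminus\{|lin\_claim, lin\_release|\},$$ where $USER(p)=begin\_claim.p\to lin\_claim.p\to end\_claim.p\to begin\_release.p\to lin\_release.p\to end\_release.p\to USER(p)$, and $MUTEX(o)$ is the external choice of: $begin\_claim?\_\to MUTEX(o)$; $end\_release?\_\to MUTEX(o)$; if $o=NULL$, $lin\_claim?p\to MUTEX(p)$; if $o\ne NULL$, $end\_claim.o\to MUTEX(o)$, $begin\_release.o\to MUTEX(o)$ and $lin\_release.o\to MUTEX(NULL)$. **Implementation.** $IMPL$ is the interleaving over all users $p$ of the processes $U(p)=CLAIM(p);RELEASE(p);U(p)$, in parallel with the shared data (synchronising on all data events), with all data events hidden. The shared data are: an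 atomic variable $owner$ with values in $\mathrm{PID}$, initially $NULL$; for each $p$ an atomic variable $state_p$ with values $WAITING, ENGAGING, SCHEDULED, ACTIVE$, initially $ACTIVE$; both kinds with load, store and compare-and-swap (CAS) events; and a concurrent FIFO queue, initially empty, whose operations are called by $enqueue.p.v$, $dequeue.p$, $peek.p$, take effect at an internal event of that call, and end by $end\_enqueue.p$ or $return.p.v$ (dequeue and peek yield $NULL$ on the empty queue). Every event of the queue is guarded by $\mathrm{length}\le max$, where $max\ge N$ is an arbitrary fixed number. Write $DONE=(state_p:=ACTIVE;\ end\_claim.p)$ and $WAIT=$ "CAS $state_p$ from $ENGAGING$ to $WAITING$; if it succeeds, wait until $state_p=SCHEDULED$, set $state_p:=ACTIVE$, then $end\_claim.p$; otherwise $DONE$". - $CLAIM(p)$: $begin\_claim.p$; $state_p:=ENGAGING$; enqueue $p$; peek, giving $h$. If $h\ne p$, do $WAIT$. If $h=p$: CAS $owner$ from $NULL$ to $p$; on success $DONE$; on failure load $owner$, giving $w$; if $w=NULL$, store $owner:=p$ and do $DONE$; if $w=p$, do $WAIT$; otherwise CAS $owner$ from $w$ to $p$, on success $DONE$, on failure CAS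 $owner$ from $NULL$ to $p$, on success $DONE$, on failure $WAIT$. - $RELEASE(p)$: $begin\_release.p$; dequeue, accepting only the result $p$; peek, giving $h$. If $h=NULL$, CAS $owner$ from $p$ to $NULL$. If $h\ne NULL$, CAS $owner$ from $p$ to $h$ and, if this succeeds, schedule $h$: CAS $state_h$ from $ENGAGING$ to $SCHEDULED$ and, if that fails, CAS $state_h$ from $WAITING$ to $SCHEDULED$. Finally $end\_release.p$. **Chase.** Let $\sigma$ be any function that assigns to each unstable state of $SPEC$ one of its $\tau$-successors. $TauPriorSpec=\mathtt{chase}(SPEC)$ is $SPEC$ with every state $s$ given exactly the transitions of the stable state reached from $s$ by following $\sigma$ (were there no such stable state, $s$ would diverge). Let $HIDE=\{|begin\_claim,end\_release|\}$. **Claim.** For every such $\sigma$ (and every $max\ge N$): (6a) $TauPriorSpec\setminus HIDE\ \sqsubseteq\ SPEC\setminus HIDE$ and (6b) $TauPriorSpec\setminus HIDE\ \sqsubseteq\ IMPL\setminus HIDE$, both in the stable-failures model (inclusion of traces and of stable failures) and in the failures-divergences model. Moreover, both for $Q=SPEC\setminus HIDE$ and for $Q=IMPL\setminus HIDE$, the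 lock is held stably: in every reachable state of $Q$, if $end\_claim.u$ is available it remains available after every internal action, and likewise for $begin\_release.u$; in every state reached after a trace ending in $end\_claim.u$, the event $begin\_release.u$ is available after some finite number (possibly $0$) of internal actions, and no observable event other than $begin\_release.u$ is possible, so that no other process can enter the critical section. -/

import Mathlib

/-! ## CSP: sequential terms, labelled transition systems, network operators -/

namespace CSP

/-- Observable actions: an event of the alphabet `E`, or successful termination `✓`. -/
inductive Obs (E : Type) : Type where
  | ev (a : E)
  | tick

/-- Labels of transitions: the internal action `τ`, or an observable action. -/
inductive Act (E : Type) : Type where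
  | tau
  | vis (o : Obs E)

/-- Sequential CSP terms over the events `E`, with process names (carrying their parameters) from
`K`. The term `input c k` is `c?x → k x`. -/
inductive Proc (E : Type) (K : Type) : Type 1 where
  | STOP : Proc E K
  | SKIP : Proc E K
  | pre (a : E) (P : Proc E K) : Proc E K
  | input {α : Type} (c : α → E) (k : α → Proc E K) : Proc E K
  | choice (P Q : Proc E K) : Proc E K
  | seq (P Q : Proc E K) : Proc E K
  | call (n : K) : Proc E K

/-- Event prefix. -/
infixr:67 " ⇝ " => Proc.pre
/-- External choice. -/
infixr:65 " □ " => Proc.choice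
/-- Sequential composition. -/
infixr:63 " ;; " => Proc.seq

/-- Boolean guard `b & P`. -/
def Proc.guard {E K : Type} (b : Prop) [Decidable b] (P : Proc E K) : Proc E K :=
  if b then P else Proc.STOP

/-- Operational semantics of sequential terms; `env` gives the right-hand side of the defining
equation of each process name. -/
inductive Proc.Step {E K : Type} (env : K → Proc E K) :
    Proc E K → Act E → Proc E K → Prop where
  | SKIP : Step env .SKIP (.vis .tick) .STOP
  | pre (a : E) (P : Proc E K) : Step env (.pre a P) (.vis (.ev a)) P
  | input {α : Type} (c : α → E) (k : α → Proc E K) (x : α) :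
      Step env (.input c k) (.vis (.ev (c x))) (k x)
  | choiceLeft {P Q P' : Proc E K} {o : Obs E} (h : Step env P (.vis o) P') :
      Step env (.choice P Q) (.vis o) P'
  | choiceRight {P Q Q' : Proc E K} {o : Obs E} (h : Step env Q (.vis o) Q') :
      Step env (.choice P Q) (.vis o) Q'
  | choiceTauLeft {P Q P' : Proc E K} (h : Step env P .tau P') :
      Step env (.choice P Q) .tau (.choice P' Q)
  | choiceTauRight {P Q Q' : Proc E K} (h : Step env Q .tau Q') :
      Step env (.choice P Q) .tau (.choice P Q')
  | seq {P Q P' : Proc E K} {l : Act E} (hl : l ≠ .vis .tick) (h : Step env P l P') :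
      Step env (.seq P Q) l (.seq P' Q)
  | seqTick {P Q P' : Proc E K} (h : Step env P (.vis .tick) P') :
      Step env (.seq P Q) .tau Q
  | call {n : K} {l : Act E} {P : Proc E K} (h : Step env (env n) l P) :
      Step env (.call n) l P

/-- A process, given as a labelled transition system with an initial state. -/
structure LTS (E : Type) where
  State : Type 1
  init : State
  step : State → Act E → State → Prop

/-- The process denoted by the term `P` under the defining equations `env`. -/
def Proc.toLTS {E K : Type} (env : K → Proc E K) (P : Proc E K) : LTS E where
  State := Proc E K
  init := P
  step := Proc.Step env

namespace LTS

variable {E : Type}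

/-! ### Network operators -/

/-- Transitions of the generalised parallel composition `P [| A |] Q`: synchronisation on `A` and
on termination. -/
inductive ParStep (A : Set E) (P Q : LTS E) :
    P.State × Q.State → Act E → P.State × Q.State → Prop where
  | tauLeft {p p' q} (h : P.step p .tau p') : ParStep A P Q (p, q) .tau (p', q)
  | tauRight {p q q'} (h : Q.step q .tau q') : ParStep A P Q (p, q) .tau (p, q')
  | left {p p' q a} (ha : a ∉ A) (h : P.step p (.vis (.ev a)) p') :
      ParStep A P Q (p, q) (.vis (.ev a)) (p', q)
  | right {p q q' a} (ha : a ∉ A) (h : Q.step q (.vis (.ev a)) q') :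
      ParStep A P Q (p, q) (.vis (.ev a)) (p, q')
  | sync {p p' q q' a} (ha : a ∈ A) (hP : P.step p (.vis (.ev a)) p')
      (hQ : Q.step q (.vis (.ev a)) q') : ParStep A P Q (p, q) (.vis (.ev a)) (p', q')
  | tick {p p' q q'} (hP : P.step p (.vis .tick) p') (hQ : Q.step q (.vis .tick) q') :
      ParStep A P Q (p, q) (.vis .tick) (p', q')

/-- Generalised parallel composition, synchronising on `A`. -/
def par (A : Set E) (P Q : LTS E) : LTS E where
  State := P.State × Q.State
  init := (P.init, Q.init)
  step := ParStep A P Q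

/-- Binary interleaving. -/
def interleave (P Q : LTS E) : LTS E := par ∅ P Q

/-- Transitions of the replicated interleaving `||| i • P i`. -/
inductive InterleaveAllStep {ι : Type} [DecidableEq ι] (P : ι → LTS E) :
    (∀ i, (P i).State) → Act E → (∀ i, (P i).State) → Prop where
  | single {s : ∀ i, (P i).State} (i : ι) {l : Act E} {p : (P i).State} (hl : l ≠ .vis .tick)
      (h : (P i).step (s i) l p) : InterleaveAllStep P s l (Function.update s i p)
  | tick {s t : ∀ i, (P i).State} (h : ∀ i, (P i).step (s i) (.vis .tick) (t i)) :
      InterleaveAllStep P s (.vis .tick) t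

/-- Replicated interleaving `||| i • P i`. -/
def interleaveAll {ι : Type} [DecidableEq ι] (P : ι → LTS E) : LTS E where
  State := ∀ i, (P i).State
  init := fun i => (P i).init
  step := InterleaveAllStep P

/-- Transitions of `P \ A`: events of `A` become internal. -/
inductive HideStep (A : Set E) (P : LTS E) : P.State → Act E → P.State → Prop where
  | tau {p p'} (h : P.step p .tau p') : HideStep A P p .tau p'
  | hidden {p p' a} (ha : a ∈ A) (h : P.step p (.vis (.ev a)) p') : HideStep A P p .tau p'
  | event {p p' a} (ha : a ∉ A) (h : P.step p (.vis (.ev a)) p') :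
      HideStep A P p (.vis (.ev a)) p'
  | tick {p p'} (h : P.step p (.vis .tick) p') : HideStep A P p (.vis .tick) p'

/-- Hiding `P \ A`. -/
def hide (P : LTS E) (A : Set E) : LTS E where
  State := P.State
  init := P.init
  step := HideStep A P

/-! ### Stability and `chase` -/

/-- A stable state: no internal action is possible. -/
def Stable (P : LTS E) (q : P.State) : Prop := ∀ q', ¬ P.step q .tau q'

/-- `sel` chooses a `τ`-successor of every unstable state (its value at stable states is
irrelevant). -/
def IsTauSelection (P : LTS E) (sel : P.State → P.State) : Prop :=
  ∀ q, ¬ P.Stable q → P.step q .tau (sel q)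

/-- Following the selected `τ`-transitions from `q` ends in the stable state `r`. -/
inductive ChasesTo (P : LTS E) (sel : P.State → P.State) : P.State → P.State → Prop where
  | stable {q} (h : P.Stable q) : ChasesTo P sel q q
  | tau {q r} (hq : ¬ P.Stable q) (h : ChasesTo P sel (sel q) r) : ChasesTo P sel q r

/-- Transitions of `chase`: a state has exactly the transitions of the stable state to which the
selected `τ`-path leads. If that path is infinite, the chased process diverges. -/
inductive ChaseStep (P : LTS E) (sel : P.State → P.State) :
    P.State → Act E → P.State → Prop where
  | vis {q r q'} {o : Obs E} (hr : ChasesTo P sel q r) (h : P.step r (.vis o) q') :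
      ChaseStep P sel q (.vis o) q'
  | diverge {q} (h : ∀ r, ¬ ChasesTo P sel q r) : ChaseStep P sel q .tau q

/-- `chase P`, where `sel` resolves the arbitrary choice between several `τ`-transitions. -/
def chase (P : LTS E) (sel : P.State → P.State) : LTS E where
  State := P.State
  init := P.init
  step := ChaseStep P sel

/-! ### Semantic models and refinement -/

/-- `P.Weak q s q'`: from `q` the process can reach `q'` while performing exactly the observable
actions `s`, interspersed with internal ones. -/
inductive Weak (P : LTS E) : P.State → List (Obs E) → P.State → Prop where
  | nil (q) : Weak P q [] q
  | tau {q q' q'' s} (h : P.step q .tau q') (hw : Weak P q' s q'') : Weak P q s q''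
  | cons {q q' q'' s} {o : Obs E} (h : P.step q (.vis o) q') (hw : Weak P q' s q'') :
      Weak P q (o :: s) q''

/-- The observable action `o` is available in the state `q`. -/
def Enabled (P : LTS E) (q : P.State) (o : Obs E) : Prop := ∃ q', P.step q (.vis o) q'

/-- `q` refuses `X`: either `q` is stable and cannot perform any member of `X`, or `q` can terminate
and `X` does not contain `✓`. -/
def Refuses (P : LTS E) (q : P.State) (X : Set (Obs E)) : Prop :=
  (P.Stable q ∧ ∀ o ∈ X, ¬ P.Enabled q o) ∨ (P.Enabled q .tick ∧ Obs.tick ∉ X)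

/-- There is an infinite sequence of internal actions from `q`. -/
def Diverges (P : LTS E) (q : P.State) : Prop :=
  ∃ f : ℕ → P.State, f 0 = q ∧ ∀ n, P.step (f n) .tau (f (n + 1))

/-- The set of traces. -/
def traces (P : LTS E) : Set (List (Obs E)) := {s | ∃ q, P.Weak P.init s q}

/-- The set of stable failures. -/
def failures (P : LTS E) : Set (List (Obs E) × Set (Obs E)) :=
  {f | ∃ q, P.Weak P.init f.1 q ∧ P.Refuses q f.2}

/-- The set of divergences: traces with a prefix after which the process can diverge. -/
def divergences (P : LTS E) : Set (List (Obs E)) :=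
  {s | ∃ s₁ s₂ q, s = s₁ ++ s₂ ∧ P.Weak P.init s₁ q ∧ P.Diverges q}

/-- Failures extended by the divergences. -/
def failuresBot (P : LTS E) : Set (List (Obs E) × Set (Obs E)) :=
  P.failures ∪ {f | f.1 ∈ P.divergences}

/-- `P ⊑_F Q`: refinement in the stable-failures model. -/
def RefinedByF (P Q : LTS E) : Prop := Q.traces ⊆ P.traces ∧ Q.failures ⊆ P.failures

/-- `P ⊑_FD Q`: refinement in the failures-divergences model. -/
def RefinedByFD (P Q : LTS E) : Prop :=
  Q.failuresBot ⊆ P.failuresBot ∧ Q.divergences ⊆ P.divergences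

end LTS

end CSP

/-! ## The claim/release protocol and its specification -/

namespace ClaimRelease

open CSP

/-- Identifiers of the `N` user processes. -/
abbrev NonNullPID (N : ℕ) : Type := Fin N

/-- Process identifiers including `NULL`. -/
abbrev PID (N : ℕ) : Type := Option (NonNullPID N)

/-- The null process identifier. -/
abbrev NULL {N : ℕ} : PID N := none

/-- Operations on variables. -/
inductive Operations : Type where
  | load
  | store

/-- The possible states of a process. -/
inductive STATE : Type where
  | WAITING
  | ENGAGING
  | SCHEDULED
  | ACTIVE
deriving DecidableEq

/-- All events; one constructor for each channel. -/
inductive Event (N : ℕ) : Type where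
  | beginClaim (p : NonNullPID N)
  | endClaim (p : NonNullPID N)
  | beginRelease (p : NonNullPID N)
  | endRelease (p : NonNullPID N)
  | linClaim (p : NonNullPID N)
  | linRelease (p : NonNullPID N)
  | owner (op : Operations) (v : PID N)
  | casOwner (expected newVal : PID N) (succ : Bool)
  | state (op : Operations) (p : NonNullPID N) (v : STATE)
  | casState (p : NonNullPID N) (expected newVal : STATE) (succ : Bool)
  | enqueue (caller v : NonNullPID N)
  | endEnqueue (caller : NonNullPID N)
  | dequeue (caller : NonNullPID N)
  | peek (caller : NonNullPID N)
  | ret (caller : NonNullPID N) (v : PID N)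
  | linEnqueue (caller v : NonNullPID N)
  | linDequeue (caller : NonNullPID N) (v : PID N)
  | linPeek (caller : NonNullPID N) (v : PID N)

section Models

variable {N : ℕ}

open Event STATE Proc

abbrev getOwner (v : PID N) : Event N := owner .load v
abbrev setOwner (v : PID N) : Event N := owner .store v
abbrev getState (p : NonNullPID N) (v : STATE) : Event N := state .load p v
abbrev setState (p : NonNullPID N) (v : STATE) : Event N := state .store p v

/-! ### The mutex specification -/

/-- The defining equation of `MUTEX_SPEC(user)`. -/
def mutexSpec (user : PID N) : Proc (Event N) (PID N) :=
  input beginClaim (fun _ => call user)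
  □ Proc.guard (user = NULL) (input linClaim fun p => call (some p))
  □ (match user with
      | none => STOP
      | some u => endClaim u ⇝ call user)
  □ (match user with
      | none => STOP
      | some u => beginRelease u ⇝ call user)
  □ (match user with
      | none => STOP
      | some u => linRelease u ⇝ call NULL)
  □ input endRelease (fun _ => call user)

/-- The process `MUTEX_SPEC(user)`. -/
def MUTEX_SPEC (user : PID N) : LTS (Event N) := Proc.toLTS mutexSpec (call user)

/-- The defining equation of the specification's `USER(pid)`. -/
def specUser (pid : NonNullPID N) : Proc (Event N) Unit :=
  beginClaim pid ⇝ linClaim pid ⇝ endClaim pid ⇝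
    beginRelease pid ⇝ linRelease pid ⇝ endRelease pid ⇝ call ()

/-- The process `USER(pid)` of the specification. -/
def SPEC_USER (pid : NonNullPID N) : LTS (Event N) :=
  Proc.toLTS (fun _ => specUser pid) (call ())

/-- The alphabet of the specification. -/
def alphaSPEC : Set (Event N) := {e | match e with
  | beginClaim _ | linClaim _ | endClaim _ | beginRelease _ | linRelease _ | endRelease _ => True
  | _ => False}

/-- The linearization events of the specification. -/
def LIN : Set (Event N) := {e | match e with
  | linClaim _ | linRelease _ => True
  | _ => False}

variable (N) in
/-- The mutex specification for `N` users. -/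
def SPEC : LTS (Event N) :=
  (LTS.par alphaSPEC (LTS.interleaveAll fun u : NonNullPID N => SPEC_USER u)
    (MUTEX_SPEC NULL)).hide LIN

/-! ### Shared variables and the concurrent queue -/

/-- The defining equation of `ATOMIC_VARIABLE(get, set, cas, val)`. -/
def atomicVariable {V : Type} [DecidableEq V] (get set : V → Event N)
    (cas : V → V → Bool → Event N) (val : V) : Proc (Event N) V :=
  (get val ⇝ call val)
  □ input set (fun newVal => call newVal)
  □ input (fun x : V × V => cas x.1 x.2 (decide (x.1 = val)))
      (fun x => if x.1 = val then call x.2 else call val)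

/-- The process `ATOMIC_VARIABLE(get, set, cas, val)`. -/
def ATOMIC_VARIABLE {V : Type} [DecidableEq V] (get set : V → Event N)
    (cas : V → V → Bool → Event N) (val : V) : LTS (Event N) :=
  Proc.toLTS (atomicVariable get set cas) (call val)

/-- The owner field. -/
def OWNER : LTS (Event N) := ATOMIC_VARIABLE getOwner setOwner casOwner NULL

/-- The state fields of all processes. -/
def STATE_VAR : LTS (Event N) :=
  LTS.interleaveAll fun p : NonNullPID N =>
    ATOMIC_VARIABLE (getState p) (setState p) (casState p) ACTIVE

/-- The defining equation of the queue module's `USER(id)`. -/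
def queueUser (id : NonNullPID N) : Proc (Event N) Unit :=
  input (enqueue id) (fun val => linEnqueue id val ⇝ endEnqueue id ⇝ call ())
  □ (dequeue id ⇝ input (linDequeue id) fun val => ret id val ⇝ call ())
  □ (peek id ⇝ input (linPeek id) fun val => ret id val ⇝ call ())

/-- The process `USER(id)` of the queue module. -/
def QUEUE_USER (id : NonNullPID N) : LTS (Event N) :=
  Proc.toLTS (fun _ => queueUser id) (call ())

/-- The defining equation of `QUEUE_SPEC(q)`, with the bound `maxLen` on the length. The term
`q.head?` is `NULL` for the empty queue. -/
def queueSpec (maxLen : ℕ) (q : List (NonNullPID N)) :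
    Proc (Event N) (List (NonNullPID N)) :=
  Proc.guard (q.length ≤ maxLen)
    (input (fun x : NonNullPID N × NonNullPID N => enqueue x.1 x.2) (fun _ => call q)
    □ input (fun x : NonNullPID N × NonNullPID N => linEnqueue x.1 x.2)
        (fun x => call (q ++ [x.2]))
    □ input endEnqueue (fun _ => call q)
    □ input dequeue (fun _ => call q)
    □ input (fun proc => linDequeue proc q.head?) (fun _ => call q.tail)
    □ input peek (fun _ => call q)
    □ input (fun proc => linPeek proc q.head?) (fun _ => call q)
    □ input (fun x : NonNullPID N × PID N => ret x.1 x.2) (fun _ => call q))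

/-- The process `QUEUE_SPEC(q)`. -/
def QUEUE_SPEC (maxLen : ℕ) (q : List (NonNullPID N)) : LTS (Event N) :=
  Proc.toLTS (queueSpec maxLen) (call q)

/-- Synchronisation set inside the queue module. -/
def queueSYNC : Set (Event N) := {e | match e with
  | enqueue _ _ | dequeue _ | peek _ | endEnqueue _ | ret _ _
  | linEnqueue _ _ | linDequeue _ _ | linPeek _ _ => True
  | _ => False}

/-- Hidden events of the queue module. -/
def queueHIDE : Set (Event N) := {e | match e with
  | linEnqueue _ _ | linDequeue _ _ | linPeek _ _ => True
  | _ => False}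

/-- The concurrent queue. -/
def QUEUE (maxLen : ℕ) : LTS (Event N) :=
  (LTS.par queueSYNC (LTS.interleaveAll fun id : NonNullPID N => QUEUE_USER id)
    (QUEUE_SPEC maxLen [])).hide queueHIDE

/-! ### The implementation -/

/-- `YIELD(pid)`. -/
def YIELD (pid : NonNullPID N) : Proc (Event N) Unit :=
  getState pid SCHEDULED ⇝ setState pid ACTIVE ⇝ SKIP

/-- `SCHEDULE(pid)`. -/
def SCHEDULE (pid : NonNullPID N) : Proc (Event N) Unit :=
  input (casState pid ENGAGING SCHEDULED) fun succ =>
    if succ then SKIP else input (casState pid WAITING SCHEDULED) fun _ => SKIP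

/-- `CLAIM(pid)`. -/
def CLAIM (pid : NonNullPID N) : Proc (Event N) Unit :=
  beginClaim pid ⇝
  setState pid ENGAGING ⇝
  enqueue pid pid ⇝ endEnqueue pid ⇝
  peek pid ⇝ input (ret pid) fun headQ =>
  if headQ = some pid then
    input (casOwner NULL (some pid)) fun succ =>
    if succ then setState pid ACTIVE ⇝ endClaim pid ⇝ SKIP
    else
      input getOwner fun own =>
      if own = NULL then setOwner (some pid) ⇝ setState pid ACTIVE ⇝ endClaim pid ⇝ SKIP
      else if own = some pid then
        input (casState pid ENGAGING WAITING) fun succ =>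
        if succ then YIELD pid ;; endClaim pid ⇝ SKIP
        else setState pid ACTIVE ⇝ endClaim pid ⇝ SKIP
      else
        input (casOwner own (some pid)) fun succ =>
        if succ then setState pid ACTIVE ⇝ endClaim pid ⇝ SKIP
        else
          input (casOwner NULL (some pid)) fun succ =>
          if succ then setState pid ACTIVE ⇝ endClaim pid ⇝ SKIP
          else
            input (casState pid ENGAGING WAITING) fun succ =>
            if succ then YIELD pid ;; endClaim pid ⇝ SKIP
            else setState pid ACTIVE ⇝ endClaim pid ⇝ SKIP
  else
    input (casState pid ENGAGING WAITING) fun succ =>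
    if succ then YIELD pid ;; endClaim pid ⇝ SKIP
    else setState pid ACTIVE ⇝ endClaim pid ⇝ SKIP

/-- `RELEASE(pid)`. -/
def RELEASE (pid : NonNullPID N) : Proc (Event N) Unit :=
  beginRelease pid ⇝
  dequeue pid ⇝ ret pid (some pid) ⇝
  peek pid ⇝ input (ret pid) fun headQ =>
  match headQ with
  | none => input (casOwner (some pid) NULL) fun _ => endRelease pid ⇝ SKIP
  | some h =>
    input (casOwner (some pid) (some h)) fun succ =>
    if succ then SCHEDULE h ;; endRelease pid ⇝ SKIP
    else endRelease pid ⇝ SKIP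

/-- The process `USER(pid) = CLAIM(pid); RELEASE(pid); USER(pid)` of the implementation. -/
def IMPL_USER (pid : NonNullPID N) : LTS (Event N) :=
  Proc.toLTS (fun _ => CLAIM pid ;; RELEASE pid ;; call ()) (call ())

/-- All events on the shared variables and on the queue. -/
def DATA : Set (Event N) := {e | match e with
  | owner _ _ | casOwner _ _ _ | state _ _ _ | casState _ _ _ _
  | enqueue _ _ | endEnqueue _ | dequeue _ | peek _ | ret _ _ => True
  | _ => False}

/-- The users together with the shared data. -/
def SYSTEM (maxLen : ℕ) : LTS (Event N) :=
  LTS.par DATA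
    (LTS.interleave (QUEUE maxLen) (LTS.interleave STATE_VAR OWNER))
    (LTS.interleaveAll fun u : NonNullPID N => IMPL_USER u)

variable (N) in
/-- The implementation for `N` users: the system with the data events hidden. -/
def IMPL (maxLen : ℕ) : LTS (Event N) := (SYSTEM maxLen).hide DATA

/-! ### The lockability test -/

variable (N) in
/-- `TauPriorSpec = chase(SPEC)`, where `sel` resolves the arbitrary choices of `chase`. -/
def TauPriorSpec (sel : (SPEC N).State → (SPEC N).State) : LTS (Event N) := (SPEC N).chase sel

/-- The events hidden for the lockability test. -/
def HIDE : Set (Event N) := {e | match e with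
  | beginClaim _ | endRelease _ => True
  | _ => False}

/-- The lock is held stably in the process `P`. -/
structure HoldsLockStably (P : LTS (Event N)) : Prop where
  /-- An available `end_claim` is not withdrawn by an internal action. -/
  end_claim_stable : ∀ s q q' u, P.Weak P.init s q → P.Enabled q (.ev (endClaim u)) →
    P.step q .tau q' → P.Enabled q' (.ev (endClaim u))
  /-- After `end_claim.u`, internal actions alone can always make `begin_release.u` available. -/
  begin_release_available : ∀ s q u, P.Weak P.init (s ++ [.ev (endClaim u)]) q →
    ∃ q', P.Weak q [] q' ∧ P.Enabled q' (.ev (beginRelease u))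
  /-- An available `begin_release` is not withdrawn by an internal action. -/
  begin_release_stable : ∀ s q q' u, P.Weak P.init s q → P.Enabled q (.ev (beginRelease u)) →
    P.step q .tau q' → P.Enabled q' (.ev (beginRelease u))
  /-- After `end_claim.u`, nothing but `begin_release.u` can be observed next; in particular no
  other process can enter the critical section. -/
  exclusive : ∀ s q u o, P.Weak P.init (s ++ [.ev (endClaim u)]) q → P.Enabled q o →
    o = .ev (beginRelease u)

end Models

end ClaimRelease

/-! Once `HIDE` is hidden, only `endClaim` and `beginRelease` stay visible, and every process in the
theorem is compared with one abstract object: a lock whose traces (`LockTrace`) alternate `endClaim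
u` and `beginRelease u`. The proof splits into an upper and a lower description of a lock, which
meet in `AllowsLock.refinedByF`.

A refining process `Q` satisfies `LockInvariant`: it performs only lock traces, never diverges, and
each stable state offers a next lock event for at least one user. The refined process `P` satisfies
`AllowsLock`: after every lock trace, and for every possible next event, it can reach a stable state
offering that event alone. If `Q` stably refuses `X`, the event it offers lies outside `X`, so the
state of `P` offering only that event refuses `X` too. Since `Q` has no divergences, the
failures-divergences refinement follows. The stability claims are read off the same invariant.

The chased specification is as nondeterministic as this requires. From the state with all users
idle, let a single `u` begin its claim. Each unstable state on its way round the cycle then has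
exactly one internal successor, so the selection `sel` is irrelevant. While `u` has the mutex, all
others can begin their claims invisibly and get stuck before `linClaim`; this yields a stable state
offering only the event of `u` (`tauPriorSpec_allowsLock`).

For the implementation, the terms are first replaced by control points and explicit data
(`impl_step_cases`, `impl_step`), then abstracted to roles, for which `PhaseInv` is inductive.
Safety: the queue has no duplicates, and a user that holds the lock is both its head and the value
of `owner`, so it is unique. A claimant at the head is the only one that can install itself, and the
only other writer of `owner` is a user that has already left the queue and is still recorded as
owner; it writes `NULL` or the current head. This makes the plain store and the theft from an old
owner harmless. Progress: a claimant that goes passive at the head leaves behind an owner that will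
hand over to it, or is itself the owner and has been, or is being, scheduled. So the users cannot
all be parked and unscheduled (`PhaseInv.exists_not_blocked`), and any other user has an internal
step or a lock event to offer; here `N ≤ maxLen` keeps the queue's guard open. Internal activity
ends because each user runs through its program without retry loops, which gives the rank
`implRank`. -/

namespace CSP

/-! ### Inversion of the transitions of sequential terms -/

namespace Proc

variable {E K : Type} {env : K → Proc E K}

theorem step_STOP_iff {l : Act E} {X : Proc E K} : Step env .STOP l X ↔ False :=
  ⟨nofun, nofun⟩

theorem step_SKIP_iff {l : Act E} {X : Proc E K} :
    Step env .SKIP l X ↔ l = .vis .tick ∧ X = .STOP :=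
  ⟨fun h => by cases h; exact ⟨rfl, rfl⟩, by rintro ⟨rfl, rfl⟩; exact .SKIP⟩

theorem step_pre_iff {a : E} {P X : Proc E K} {l : Act E} :
    Step env (a ⇝ P) l X ↔ l = .vis (.ev a) ∧ X = P :=
  ⟨fun h => by cases h; exact ⟨rfl, rfl⟩, by rintro ⟨rfl, rfl⟩; exact .pre _ _⟩

theorem step_input_iff {α : Type} {c : α → E} {k : α → Proc E K} {X : Proc E K} {l : Act E} :
    Step env (.input c k) l X ↔ ∃ x, l = .vis (.ev (c x)) ∧ X = k x :=
  ⟨fun h => by cases h with | input _ _ x => exact ⟨x, rfl, rfl⟩,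
    by rintro ⟨x, rfl, rfl⟩; exact .input _ _ _⟩

theorem step_call_iff {n : K} {X : Proc E K} {l : Act E} :
    Step env (.call n) l X ↔ Step env (env n) l X :=
  ⟨fun h => by cases h with | call h => exact h, .call⟩

theorem step_choice_vis_iff {P Q X : Proc E K} {o : Obs E} :
    Step env (P □ Q) (.vis o) X ↔ Step env P (.vis o) X ∨ Step env Q (.vis o) X := by
  constructor
  · intro h
    cases h with
    | choiceLeft h => exact .inl h
    | choiceRight h => exact .inr h
  · rintro (h | h)
    · exact .choiceLeft h
    · exact .choiceRight h

theorem step_choice_tau_iff {P Q X : Proc E K} :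
    Step env (P □ Q) .tau X ↔
      (∃ P', Step env P .tau P' ∧ X = P' □ Q) ∨ (∃ Q', Step env Q .tau Q' ∧ X = P □ Q') := by
  constructor
  · intro h
    cases h with
    | choiceTauLeft h => exact .inl ⟨_, h, rfl⟩
    | choiceTauRight h => exact .inr ⟨_, h, rfl⟩
  · rintro (⟨_, h, rfl⟩ | ⟨_, h, rfl⟩)
    · exact .choiceTauLeft h
    · exact .choiceTauRight h

theorem step_seq_iff {P Q X : Proc E K} {l : Act E} :
    Step env (P ;; Q) l X ↔
      (l ≠ .vis .tick ∧ ∃ P', Step env P l P' ∧ X = P' ;; Q) ∨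
      (l = .tau ∧ X = Q ∧ ∃ P', Step env P (.vis .tick) P') := by
  constructor
  · intro h
    cases h with
    | seq hl h => exact .inl ⟨hl, _, h, rfl⟩
    | seqTick h => exact .inr ⟨rfl, rfl, _, h⟩
  · rintro (⟨hl, _, h, rfl⟩ | ⟨rfl, rfl, _, h⟩)
    · exact .seq hl h
    · exact .seqTick h

end Proc

/-! ### Weak transitions, hiding, and ranks that exclude divergence -/

namespace LTS

variable {E : Type}

theorem Weak.append {P : LTS E} {q q' q'' : P.State} {s t : List (Obs E)}
    (h : P.Weak q s q') (h' : P.Weak q' t q'') : P.Weak q (s ++ t) q'' := by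
  induction h with
  | nil => exact h'
  | tau h _ ih => exact .tau h (ih h')
  | cons h _ ih => exact .cons h (ih h')

theorem Weak.single {P : LTS E} {q q' : P.State} {o : Obs E} (h : P.step q (.vis o) q') :
    P.Weak q [o] q' := .cons h (.nil _)

theorem Weak.single_tau {P : LTS E} {q q' : P.State} (h : P.step q .tau q') :
    P.Weak q [] q' := .tau h (.nil _)

theorem hide_step_iff {P : LTS E} {A : Set E} {p p' : P.State} {l : Act E} :
    (P.hide A).step p l p' ↔ (∃ a ∈ A, l = .tau ∧ P.step p (.vis (.ev a)) p') ∨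
      ((∀ a ∈ A, l ≠ .vis (.ev a)) ∧ P.step p l p') := by
  constructor
  · intro h
    cases h with
    | tau h => exact .inr ⟨nofun, h⟩
    | hidden ha h => exact .inl ⟨_, ha, rfl, h⟩
    | event ha h => exact .inr ⟨by rintro a ha' ⟨⟩; exact ha ha', h⟩
    | tick h => exact .inr ⟨nofun, h⟩
  · rintro (⟨a, ha, rfl, h⟩ | ⟨ha, h⟩)
    · exact .hidden ha h
    · match l with
      | .tau => exact .tau h
      | .vis .tick => exact .tick h
      | .vis (.ev a) => exact .event (fun h' => ha a h' rfl) h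

/-- Turns an update in a dependent family of process states into an update of the family of control
points that index them, so that configurations keep the shape `fun j => f j (g j)`. -/
theorem update_comp_apply {ι : Type} [DecidableEq ι] {α : Type} {β : ι → Type*}
    (f : ∀ i, α → β i) (g : ι → α) (i : ι) (a : α) :
    Function.update (fun j => f j (g j)) i (f i a) = fun j => f j (Function.update g i a j) := by
  funext j
  by_cases h : j = i
  · subst h; simp
  · simp [h]

/-- A process whose internal actions from a closed set of states decrease a rank does not diverge
from that set. -/
theorem not_diverges_of_rank {P : LTS E} {α : Type} (conf : α → P.State) (I : α → Prop)
    (rank : α → ℕ)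
    (h : ∀ a q, I a → P.step (conf a) .tau q → ∃ b, q = conf b ∧ I b ∧ rank b < rank a)
    {a : α} (ha : I a) : ¬ P.Diverges (conf a) := by
  induction hn : rank a using Nat.strong_induction_on generalizing a with
  | _ n ih =>
    rintro ⟨f, hf, hs⟩
    have h0 := hs 0
    rw [hf] at h0
    obtain ⟨b, hb, hIb, hlt⟩ := h _ _ ha h0
    exact ih (rank b) (hn ▸ hlt) hIb rfl ⟨fun n => f (n + 1), hb, fun n => hs (n + 1)⟩

end LTS

end CSP

/-! ### The abstract lock and the refinement criterion -/

namespace ClaimRelease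

open CSP Event

variable {N : ℕ}

/-- The lock-level traces between two lock states, where `none` is the free lock and `some u` the
lock held by `u`. -/
inductive LockTrace :
    PID N → List (Obs (Event N)) → PID N → Prop where
  | nil (m) : LockTrace m [] m
  | claim {u s m} (h : LockTrace (some u) s m) : LockTrace none (.ev (endClaim u) :: s) m
  | release {u s m} (h : LockTrace none s m) : LockTrace (some u) (.ev (beginRelease u) :: s) m

/-- Only the rule `claim` produces `endClaim u`, and it leads to `some u`; the history before it is
irrelevant. -/
theorem LockTrace.eq_some_of_append_endClaim {m m' : PID N} {s : List (Obs (Event N))}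
    {u : NonNullPID N} (h : LockTrace m (s ++ [.ev (endClaim u)]) m') : m' = some u := by
  induction s generalizing m with
  | nil =>
    cases h with
    | claim h => cases h; rfl
  | cons o s ih =>
    cases h with
    | claim h => exact ih h
    | release h => exact ih h

/-- `I m` describes reachable states of a lock whose visible behaviour is the alternation of
`endClaim u` and `beginRelease u`, where `m` is the current visible holder. -/
structure LockInvariant (Q : LTS (Event N)) (I : PID N → Q.State → Prop) : Prop where
  init : I none Q.init
  tau : ∀ {m q q'}, I m q → Q.step q .tau q' → I m q'
  vis : ∀ {m q o q'}, I m q → Q.step q (.vis o) q' →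
    (m = none ∧ ∃ u, o = .ev (endClaim u) ∧ I (some u) q') ∨
    (∃ u, m = some u ∧ o = .ev (beginRelease u) ∧ I none q')
  claimable : ∀ {q}, I none q → Q.Stable q → ∃ u, Q.Enabled q (.ev (endClaim u))
  releasable : ∀ {q u}, I (some u) q → ∃ q', Q.Weak q [] q' ∧
    Q.Enabled q' (.ev (beginRelease u))
  not_diverges : ∀ {m q}, I m q → ¬ Q.Diverges q
  endClaim_stable : ∀ {m q q' u}, I m q → Q.Enabled q (.ev (endClaim u)) → Q.step q .tau q' →
    Q.Enabled q' (.ev (endClaim u))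
  beginRelease_stable : ∀ {m q q' u}, I m q → Q.Enabled q (.ev (beginRelease u)) →
    Q.step q .tau q' → Q.Enabled q' (.ev (beginRelease u))

namespace LockInvariant

variable {Q : LTS (Event N)} {I : PID N → Q.State → Prop}

theorem weak (hI : LockInvariant Q I) {m : PID N} {q q' : Q.State} {s : List (Obs (Event N))}
    (hw : Q.Weak q s q') (hq : I m q) : ∃ m', I m' q' ∧ LockTrace m s m' := by
  induction hw generalizing m with
  | nil => exact ⟨m, hq, .nil m⟩
  | tau h _ ih => exact ih (hI.tau hq h)
  | cons h _ ih =>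
    rcases hI.vis hq h with ⟨rfl, u, rfl, h'⟩ | ⟨u, rfl, rfl, h'⟩
    · obtain ⟨m', h1, h2⟩ := ih h'
      exact ⟨m', h1, .claim h2⟩
    · obtain ⟨m', h1, h2⟩ := ih h'
      exact ⟨m', h1, .release h2⟩

theorem not_enabled_tick (hI : LockInvariant Q I) {m : PID N} {q : Q.State} (hq : I m q) :
    ¬ Q.Enabled q .tick := by
  rintro ⟨q', h⟩
  rcases hI.vis hq h with ⟨_, u, h, _⟩ | ⟨u, _, h, _⟩ <;> cases h

theorem divergences_eq_empty (hI : LockInvariant Q I) : Q.divergences = ∅ := by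
  ext s
  simp only [LTS.divergences, Set.mem_ofPred_eq, Set.mem_empty_iff_false, iff_false]
  rintro ⟨s₁, s₂, q, _, hw, hd⟩
  obtain ⟨m, hm, _⟩ := hI.weak hw hI.init
  exact hI.not_diverges hm hd

/-- In a stable state the internal path promised by `releasable` must be empty, so the event is
available at once. -/
theorem exists_enabled_of_stable (hI : LockInvariant Q I) {m : PID N} {q : Q.State}
    (hq : I m q) (hs : Q.Stable q) :
    (m = none ∧ ∃ u, Q.Enabled q (.ev (endClaim u))) ∨
    (∃ u, m = some u ∧ Q.Enabled q (.ev (beginRelease u))) := by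
  cases m with
  | none => exact .inl ⟨rfl, hI.claimable hq hs⟩
  | some u =>
    obtain ⟨q', hw, he⟩ := hI.releasable hq
    cases hw with
    | nil => exact .inr ⟨u, rfl, he⟩
    | tau h _ => exact absurd h (hs _)

theorem holdsLockStably (hI : LockInvariant Q I) : HoldsLockStably Q where
  end_claim_stable _ _ _ _ hw he ht :=
    let ⟨_, hm, _⟩ := hI.weak hw hI.init
    hI.endClaim_stable hm he ht
  begin_release_available _ _ _ hw := by
    obtain ⟨m, hm, ht⟩ := hI.weak hw hI.init
    obtain rfl := ht.eq_some_of_append_endClaim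
    exact hI.releasable hm
  begin_release_stable _ _ _ _ hw he ht :=
    let ⟨_, hm, _⟩ := hI.weak hw hI.init
    hI.beginRelease_stable hm he ht
  exclusive _ _ _ _ hw he := by
    obtain ⟨m, hm, ht⟩ := hI.weak hw hI.init
    obtain rfl := ht.eq_some_of_append_endClaim
    obtain ⟨q', h⟩ := he
    rcases hI.vis hm h with ⟨hu, _⟩ | ⟨u, hu, rfl, _⟩
    · cases hu
    · cases hu; rfl

end LockInvariant

/-- `P` has every lock-level trace and, after it, the stable state which offers only the next lock
event, for every choice of that event. -/
structure AllowsLock (P : LTS (Event N)) (R : PID N → P.State) : Prop where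
  init : P.init = R none
  claim : ∀ u, P.Weak (R none) [.ev (endClaim u)] (R (some u))
  release : ∀ u, P.Weak (R (some u)) [.ev (beginRelease u)] (R none)
  stable_claim : ∀ u, ∃ q, P.Weak (R none) [] q ∧ P.Stable q ∧
    ∀ o, P.Enabled q o → o = .ev (endClaim u)
  stable_release : ∀ u, ∃ q, P.Weak (R (some u)) [] q ∧ P.Stable q ∧
    ∀ o, P.Enabled q o → o = .ev (beginRelease u)

namespace AllowsLock

variable {P Q : LTS (Event N)} {R : PID N → P.State} {I : PID N → Q.State → Prop}

theorem weak (hP : AllowsLock P R) {m m' : PID N} {s : List (Obs (Event N))}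
    (h : LockTrace m s m') : P.Weak (R m) s (R m') := by
  induction h with
  | nil => exact .nil _
  | claim _ ih => exact (hP.claim _).append ih
  | release _ ih => exact (hP.release _).append ih

/-- Each trace of `Q` is a lock trace, hence a trace of `P`. A refusal set of a stable state of `Q`
misses some lock event that is offered there; the stable state of `P` that offers only this event
refuses the same set. Refusals by termination do not occur, since `Q` never offers `✓`. -/
theorem refinedByF (hP : AllowsLock P R) (hI : LockInvariant Q I) : P.RefinedByF Q := by
  constructor
  · rintro s ⟨q, hw⟩
    obtain ⟨m, _, ht⟩ := hI.weak hw hI.init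
    exact ⟨R m, hP.init ▸ hP.weak ht⟩
  · rintro ⟨s, X⟩ ⟨q, hw, hr⟩
    obtain ⟨m, hm, ht⟩ := hI.weak hw hI.init
    have hw' := hP.weak ht
    rw [← hP.init] at hw'
    rcases hr with ⟨hs, hX⟩ | ⟨h, _⟩
    · rcases hI.exists_enabled_of_stable hm hs with ⟨rfl, u, he⟩ | ⟨u, rfl, he⟩
      · obtain ⟨r, hr, hrs, ho⟩ := hP.stable_claim u
        refine ⟨r, by simpa using hw'.append hr, .inl ⟨hrs, fun o hoX h => ?_⟩⟩
        exact hX o hoX (ho o h ▸ he)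
      · obtain ⟨r, hr, hrs, ho⟩ := hP.stable_release u
        refine ⟨r, by simpa using hw'.append hr, .inl ⟨hrs, fun o hoX h => ?_⟩⟩
        exact hX o hoX (ho o h ▸ he)
    · exact absurd h (hI.not_enabled_tick hm)

theorem refinedByFD (hP : AllowsLock P R) (hI : LockInvariant Q I) : P.RefinedByFD Q := by
  have h := hP.refinedByF hI
  refine ⟨?_, by simp [hI.divergences_eq_empty]⟩
  rintro f (hf | hf)
  · exact .inl (h.2 hf)
  · simp [hI.divergences_eq_empty] at hf

end AllowsLock

end ClaimRelease

/-! ### Replicated interleaving indexed by control points -/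

namespace CSP.LTS

variable {E : Type}

theorem interleaveAll_step_cases {ι α : Type} [DecidableEq ι] {P : ι → LTS E}
    {conf : ∀ i, α → (P i).State} {R : ι → α → Act E → α → Prop}
    (hR : ∀ i a l X, (P i).step (conf i a) l X → ∃ b, X = conf i b ∧ R i a l b)
    {g : ι → α} {l : Act E} {X : ∀ i, (P i).State} (hl : l ≠ .vis .tick)
    (h : InterleaveAllStep P (fun i => conf i (g i)) l X) :
    ∃ i b, R i (g i) l b ∧ X = fun j => conf j (Function.update g i b j) := by
  cases h with
  | single i hl h =>
    obtain ⟨b, rfl, hb⟩ := hR _ _ _ _ h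
    exact ⟨i, b, hb, update_comp_apply conf g i b⟩
  | tick h => exact absurd rfl hl

theorem interleaveAll_step_update {ι α : Type} [DecidableEq ι] {P : ι → LTS E}
    {conf : ∀ i, α → (P i).State} {g : ι → α} {l : Act E} (i : ι) {b : α} (hl : l ≠ .vis .tick)
    (h : (P i).step (conf i (g i)) l (conf i b)) :
    InterleaveAllStep P (fun i => conf i (g i)) l
      (fun j => conf j (Function.update g i b j)) := by
  rw [← update_comp_apply conf g i b]
  exact .single i hl h

end CSP.LTS

/-! ### The specification as a transition system on control points -/

namespace ClaimRelease

open CSP Event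

variable {N : ℕ}

/-- Control points of a user of the specification. -/
inductive SpecPC : Type where
  | idle
  | claiming
  | claimed
  | holding
  | releasing
  | released
deriving DecidableEq

namespace SpecPC

/-- The term of the specification's `USER(u)` at a control point. -/
def term (u : NonNullPID N) : SpecPC → Proc (Event N) Unit
  | idle => .call ()
  | claiming => linClaim u ⇝ endClaim u ⇝ beginRelease u ⇝ linRelease u ⇝ endRelease u ⇝ .call ()
  | claimed => endClaim u ⇝ beginRelease u ⇝ linRelease u ⇝ endRelease u ⇝ .call ()
  | holding => beginRelease u ⇝ linRelease u ⇝ endRelease u ⇝ .call ()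
  | releasing => linRelease u ⇝ endRelease u ⇝ .call ()
  | released => endRelease u ⇝ .call ()

/-- The next event of a user, and its next control point. -/
def event (u : NonNullPID N) : SpecPC → Event N
  | idle => beginClaim u
  | claiming => linClaim u
  | claimed => endClaim u
  | holding => beginRelease u
  | releasing => linRelease u
  | released => endRelease u

/-- The control point after the next event. -/
def next : SpecPC → SpecPC
  | idle => claiming
  | claiming => claimed
  | claimed => holding
  | holding => releasing
  | releasing => released
  | released => idle

/-- The number of internal or hidden actions before the next visible one. -/
def rank : SpecPC → ℕ
  | idle => 2
  | claiming => 1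
  | claimed => 0
  | holding => 0
  | releasing => 4
  | released => 3

theorem step_term_iff (u : NonNullPID N) (k : SpecPC) (l : Act (Event N)) (X : Proc (Event N) Unit) :
    (SPEC_USER u).step (k.term u) l X ↔ l = .vis (.ev (k.event u)) ∧ X = k.next.term u := by
  cases k <;>
  simp [SPEC_USER, Proc.toLTS, term, event, next, specUser, Proc.step_pre_iff, Proc.step_call_iff]

end SpecPC

/-- The configuration of the specification with the users at the control points `pc` and the lock
held by `o`. -/
def specConf (pc : NonNullPID N → SpecPC) (o : PID N) : (SPEC N).State :=
  ((fun u => (pc u).term u, Proc.call o) :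
    (∀ u : NonNullPID N, (SPEC_USER u).State) × (MUTEX_SPEC (N := N) NULL).State)

/-- The effect of the events of the specification on the holder of the lock. -/
inductive MutexStep : PID N → Event N → PID N → Prop where
  | beginClaim (u o) : MutexStep o (beginClaim u) o
  | linClaim (u) : MutexStep none (linClaim u) (some u)
  | endClaim (u) : MutexStep (some u) (endClaim u) (some u)
  | beginRelease (u) : MutexStep (some u) (beginRelease u) (some u)
  | linRelease (u) : MutexStep (some u) (linRelease u) none
  | endRelease (u o) : MutexStep o (endRelease u) o

theorem mutex_step_iff (o : PID N) (l : Act (Event N)) (X : Proc (Event N) (PID N)) :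
    (MUTEX_SPEC (N := N) NULL).step (Proc.call o) l X ↔
      ∃ a o', l = .vis (.ev a) ∧ X = Proc.call o' ∧ MutexStep o a o' := by
  constructor
  · intro h
    simp only [MUTEX_SPEC, Proc.toLTS, Proc.step_call_iff, mutexSpec] at h
    cases l with
    | tau =>
      cases o <;> simp [Proc.guard, Proc.step_choice_tau_iff, Proc.step_input_iff,
        Proc.step_pre_iff, Proc.step_STOP_iff] at h
    | vis b =>
      cases o with
      | none =>
        simp only [Proc.guard, Proc.step_choice_vis_iff, Proc.step_input_iff, if_true,
          Proc.step_STOP_iff, false_or] at h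
        rcases h with ⟨x, h, rfl⟩ | ⟨x, h, rfl⟩ | ⟨x, h, rfl⟩ <;> refine ⟨_, _, h, rfl, ?_⟩ <;>
          constructor
      | some u =>
        simp only [Proc.guard, Proc.step_choice_vis_iff, Proc.step_input_iff,
          Proc.step_pre_iff, reduceCtorEq, if_false, Proc.step_STOP_iff, false_or] at h
        rcases h with ⟨x, h, rfl⟩ | ⟨h, rfl⟩ | ⟨h, rfl⟩ | ⟨h, rfl⟩ | ⟨x, h, rfl⟩ <;>
          refine ⟨_, _, h, rfl, ?_⟩ <;> constructor
  · rintro ⟨a, o', rfl, rfl, h⟩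
    simp only [MUTEX_SPEC, Proc.toLTS, Proc.step_call_iff, mutexSpec]
    cases h <;> try cases o
    all_goals simp [Proc.guard, Proc.step_choice_vis_iff, Proc.step_input_iff,
      Proc.step_pre_iff, Proc.step_STOP_iff]

/-- The label with which the specification shows the event `a`. -/
def specLabel : Event N → Act (Event N)
  | linClaim _ | linRelease _ => .tau
  | a => .vis (.ev a)

/-- All events of the users and of the mutex lie in `alphaSPEC`, and neither side has `τ` or `✓`, so
synchronisation is the only rule that applies; the move is then named by the user that takes part.
-/
theorem spec_step_cases {pc : NonNullPID N → SpecPC} {o : PID N} {l : Act (Event N)}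
    {X : (SPEC N).State} (hs : (SPEC N).step (specConf pc o) l X) :
    ∃ u o', MutexStep o ((pc u).event u) o' ∧ l = specLabel ((pc u).event u) ∧
      X = specConf (Function.update pc u (pc u).next) o' := by
  have key : ∀ {l X}, LTS.ParStep alphaSPEC (LTS.interleaveAll fun u : NonNullPID N => SPEC_USER u)
      (MUTEX_SPEC NULL) (specConf pc o) l X → ∃ u o', MutexStep o ((pc u).event u) o' ∧
        l = .vis (.ev ((pc u).event u)) ∧ 
        X = specConf (Function.update pc u (pc u).next) o' := by
    intro l X h
    have hU : ∀ {l X}, l ≠ .vis .tick → (LTS.interleaveAll fun u : NonNullPID N => SPEC_USER u).step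
        (fun u => (pc u).term u) l X → ∃ u, l = .vis (.ev ((pc u).event u)) ∧
          X = fun v => (Function.update pc u (pc u).next v).term v := by
      intro l X hl h
      obtain ⟨u, k, ⟨h1, h2⟩, h3⟩ := LTS.interleaveAll_step_cases
        (P := fun u : NonNullPID N => SPEC_USER u) (conf := fun u k => SpecPC.term u k)
        (R := fun u k l k' => l = .vis (.ev (k.event u)) ∧ k' = k.next)
        (fun u k l X h => ⟨k.next, ((SpecPC.step_term_iff u k l X).1 h).2,
          ((SpecPC.step_term_iff u k l X).1 h).1, rfl⟩) hl h
      exact ⟨u, h1, h2 ▸ h3⟩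
    have hα : ∀ u, (pc u).event u ∈ (alphaSPEC : Set (Event N)) := by
      intro u
      cases pc u <;> simp [SpecPC.event, alphaSPEC]
    cases h with
    | tauLeft h => 
      obtain ⟨u, h, _⟩ := hU (by simp) h
      cases h
    | tauRight h =>
      obtain ⟨_, _, h, _⟩ := (mutex_step_iff _ _ _).1 h
      cases h
    | left ha h =>
      obtain ⟨u, h, _⟩ := hU (by simp) h
      cases h
      exact absurd (hα u) ha
    | right ha h =>
      obtain ⟨_, _, h, _, hm⟩ := (mutex_step_iff _ _ _).1 h
      cases h
      cases hm <;> simp [alphaSPEC] at ha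
    | @sync _ _ _ _ a ha hP hQ =>
      obtain ⟨u, h, hX⟩ := hU (by simp) hP
      obtain ⟨b, o', h', rfl, hm⟩ := (mutex_step_iff _ _ _).1 hQ
      obtain rfl : a = (pc u).event u := by simpa using h
      obtain rfl : (pc u).event u = b := by simpa using h'
      exact ⟨u, o', hm, rfl, by rw [hX]; rfl⟩
    | tick h h' =>
      obtain ⟨_, _, h, _⟩ := (mutex_step_iff _ _ _).1 h'
      cases h
  rcases LTS.hide_step_iff.1 hs with ⟨a, ha, rfl, h⟩ | ⟨ha, h⟩
  · obtain ⟨u, o', hm, hl, rfl⟩ := key h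
    obtain rfl : a = (pc u).event u := by simpa using hl
    refine ⟨u, o', hm, ?_, rfl⟩
    revert ha
    cases pc u <;> simp [LIN, specLabel, SpecPC.event]
  · obtain ⟨u, o', hm, rfl, rfl⟩ := key h
    refine ⟨u, o', hm, ?_, rfl⟩
    revert ha
    cases pc u <;> simp [LIN, specLabel, SpecPC.event]

theorem spec_step_specConf {pc : NonNullPID N → SpecPC} {o o' : PID N} (u : NonNullPID N)
    (h : MutexStep o ((pc u).event u) o') :
    (SPEC N).step (specConf pc o) (specLabel ((pc u).event u))
      (specConf (Function.update pc u (pc u).next) o') := by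
  have hU : (LTS.interleaveAll fun u : NonNullPID N => SPEC_USER u).step
      (fun u => (pc u).term u) (.vis (.ev ((pc u).event u)))
      (fun v => (Function.update pc u (pc u).next v).term v) :=
    LTS.interleaveAll_step_update (P := fun u : NonNullPID N => SPEC_USER u)
      (conf := fun u k => SpecPC.term u k) u (by simp)
      ((SpecPC.step_term_iff u (pc u) _ _).2 ⟨rfl, rfl⟩)
  have hM := (mutex_step_iff o _ _).2 ⟨_, _, rfl, rfl, h⟩
  have hα : (pc u).event u ∈ (alphaSPEC : Set (Event N)) := by
    cases pc u <;> simp [SpecPC.event, alphaSPEC]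
  have hP := LTS.ParStep.sync hα hU hM
  by_cases hL : (pc u).event u ∈ (LIN : Set (Event N))
  · have : specLabel ((pc u).event u) = .tau := by
      revert hL
      cases pc u <;> simp [LIN, specLabel, SpecPC.event]
    rw [this]
    exact .hidden hL hP
  · have : specLabel ((pc u).event u) = .vis (.ev ((pc u).event u)) := by
      revert hL
      cases pc u <;> simp [LIN, specLabel, SpecPC.event]
    rw [this]
    exact .event hL hP

end ClaimRelease

/-! ### The specification is a lock -/

namespace ClaimRelease

open CSP Event

variable {N : ℕ}

theorem sum_update_lt {ι α : Type} [Fintype ι] [DecidableEq ι] (r : ι → α → ℕ) (g : ι → α)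
    (i : ι) (a : α) (h : r i a < r i (g i)) :
    ∑ j, r j (Function.update g i a j) < ∑ j, r j (g j) := by
  refine Finset.sum_lt_sum (fun j _ => ?_) ⟨i, Finset.mem_univ i, by simpa using h⟩
  by_cases hj : j = i
  · subst hj; simpa using h.le
  · simp [hj]

/-- The user is in possession of the lock. -/
def SpecPC.Locked (k : SpecPC) : Prop := k = claimed ∨ k = holding ∨ k = releasing

/-- The label with which the specification with `HIDE` hidden shows the event `a`. -/
def specHideLabel : Event N → Act (Event N)
  | linClaim _ | linRelease _ | beginClaim _ | endRelease _ => .tau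
  | a => .vis (.ev a)

theorem spec_hide_step_cases {pc : NonNullPID N → SpecPC} {o : PID N} {l : Act (Event N)}
    {X : (SPEC N).State} (hs : ((SPEC N).hide HIDE).step (specConf pc o) l X) :
    ∃ u o', MutexStep o ((pc u).event u) o' ∧ l = specHideLabel ((pc u).event u) ∧
      X = specConf (Function.update pc u (pc u).next) o' := by
  rcases LTS.hide_step_iff.1 hs with ⟨a, ha, rfl, h⟩ | ⟨ha, h⟩
  · obtain ⟨u, o', hm, hl, rfl⟩ := spec_step_cases h
    refine ⟨u, o', hm, ?_, rfl⟩
    revert ha hl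
    cases pc u <;> simp [HIDE, specLabel, specHideLabel, SpecPC.event] <;> rintro h rfl <;>
      simp at h
  · obtain ⟨u, o', hm, rfl, rfl⟩ := spec_step_cases h
    refine ⟨u, o', hm, ?_, rfl⟩
    revert ha
    cases pc u <;> simp [HIDE, specLabel, specHideLabel, SpecPC.event]

theorem spec_hide_step_specConf {pc : NonNullPID N → SpecPC} {o o' : PID N} (u : NonNullPID N)
    (h : MutexStep o ((pc u).event u) o') :
    ((SPEC N).hide HIDE).step (specConf pc o) (specHideLabel ((pc u).event u))
      (specConf (Function.update pc u (pc u).next) o') := by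
  have h := spec_step_specConf u h
  refine LTS.hide_step_iff.2 ?_
  by_cases hH : (pc u).event u ∈ (HIDE : Set (Event N))
  · refine .inl ⟨_, hH, ?_⟩
    revert h hH
    cases pc u <;> simp [specHideLabel, specLabel, SpecPC.event, HIDE]
  · refine .inr ⟨?_, ?_⟩
    · rintro a ha h
      revert hH h
      cases pc u <;> simp [specHideLabel, SpecPC.event, HIDE] <;> rintro rfl <;>
        simp [HIDE] at ha
    · revert h hH
      cases pc u <;> simp [specHideLabel, specLabel, SpecPC.event, HIDE]

/-- The lock of the specification belongs to `o`, and `m` is the user that has ended its claim and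
not begun its release. -/
def SpecLockInv (m : PID N) (c : (NonNullPID N → SpecPC) × PID N) : Prop :=
  (∀ u, (c.1 u).Locked ↔ c.2 = some u) ∧ ∀ u, c.1 u = .holding ↔ m = some u

/-- Classifies the steps as the lock sees them: invisible ones, which lower the rank of the acting
user, and the two visible ones, which change the visible holder. -/
theorem SpecLockInv.step {m o o' : PID N} {pc : NonNullPID N → SpecPC} {u : NonNullPID N}
    (hI : SpecLockInv m (pc, o)) (h : MutexStep o ((pc u).event u) o') :
    ∃ m', SpecLockInv m' (Function.update pc u (pc u).next, o') ∧
      ((m' = m ∧ specHideLabel ((pc u).event u) = .tau ∧ (pc u).next.rank < (pc u).rank) ∨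
      (m = none ∧ m' = some u ∧ specHideLabel ((pc u).event u) = .vis (.ev (endClaim u))) ∨
      (m = some u ∧ m' = none ∧
        specHideLabel ((pc u).event u) = .vis (.ev (beginRelease u)))) := by
  obtain ⟨h1, h2⟩ := hI
  have h1u := h1 u
  have h2u := h2 u
  have h2m : ∀ v, m = some v → pc v = .holding := fun v => (h2 v).2
  -- The visible holder changes only when `u` leaves `claimed` (by `endClaim u`) or `holding` (by
  -- `beginRelease u`).
  refine ⟨if pc u = .claimed then some u else if pc u = .holding then none else m, ?_⟩
  generalize hk : pc u = k at *
  cases k <;> cases h <;>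
    simp_all [SpecLockInv, SpecPC.next, SpecPC.rank, specHideLabel, SpecPC.event,
      SpecPC.Locked, Function.update_apply] <;> cases m <;> grind

/-- The next event of `v` is visible, so an internal step belongs to another user `w`. With the
mutex at `some v`, `w` can only begin a claim or end a release, and neither moves the mutex. -/
theorem SpecLockInv.locked_stable {m o : PID N} {pc : NonNullPID N → SpecPC} {v : NonNullPID N}
    (hI : SpecLockInv m (pc, o)) (hk : pc v = .claimed ∨ pc v = .holding) {X : (SPEC N).State}
    (h : ((SPEC N).hide HIDE).step (specConf pc o) .tau X) :
    ∃ pc', X = specConf pc' (some v) ∧ pc' v = pc v := by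
  obtain ⟨w, o', hw, hl, rfl⟩ := spec_hide_step_cases h
  obtain rfl : o = some v := (hI.1 v).1 (by rcases hk with hk | hk <;> simp [hk, SpecPC.Locked])
  have hwv : v ≠ w := by
    rintro rfl
    rcases hk with hk | hk <;> simp [hk, specHideLabel, SpecPC.event] at hl
  have hIw := hI.1 w
  obtain rfl : o' = some v := by
    revert hIw hw
    cases pc w <;> intro hw <;> cases hw <;> simp_all [SpecPC.Locked]
  exact ⟨_, rfl, Function.update_of_ne hwv _ _⟩

theorem spec_lockInvariant (hN : 1 ≤ N) :
    LockInvariant ((SPEC N).hide HIDE)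
      (fun m X => ∃ c, X = specConf c.1 c.2 ∧ SpecLockInv m c) where
  init := ⟨(fun _ => .idle, none), rfl, by simp [SpecLockInv, SpecPC.Locked]⟩
  tau := by
    rintro m _ q' ⟨⟨pc, o⟩, rfl, hI⟩ h
    obtain ⟨u, o', hm, hl, rfl⟩ := spec_hide_step_cases h
    obtain ⟨m', hI', h'⟩ := hI.step hm
    rcases h' with ⟨rfl, _⟩ | ⟨_, _, h'⟩ | ⟨_, _, h'⟩
    · exact ⟨_, rfl, hI'⟩
    · simp [h'] at hl
    · simp [h'] at hl
  vis := by
    rintro m _ a q' ⟨⟨pc, o⟩, rfl, hI⟩ h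
    obtain ⟨u, o', hm, hl, rfl⟩ := spec_hide_step_cases h
    obtain ⟨m', hI', h'⟩ := hI.step hm
    rcases h' with ⟨rfl, h', _⟩ | ⟨rfl, rfl, h'⟩ | ⟨rfl, rfl, h'⟩
    · simp [h'] at hl
    · exact .inl ⟨rfl, u, by simpa [h'] using hl, _, rfl, hI'⟩
    · exact .inr ⟨u, rfl, by simpa [h'] using hl, _, rfl, hI'⟩
  claimable := by
    rintro _ ⟨⟨pc, o⟩, rfl, hI⟩ hs
    have hs' : ∀ u o', MutexStep o ((pc u).event u) o' →
        specHideLabel ((pc u).event u) ≠ .tau := fun u o' h hl =>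
      hs _ (hl ▸ spec_hide_step_specConf u h)
    -- At each control point excluded here, the next event is hidden and permitted by the mutex,
    -- against stability.
    have h3 : ∀ u, (o = none → pc u ≠ .claiming) ∧ pc u ≠ .idle ∧ pc u ≠ .released ∧
        (o = some u → pc u ≠ .releasing) := by
      intro u
      refine ⟨?_, ?_, ?_, ?_⟩
      · rintro rfl hp
        refine hs' u (some u) ?_ ?_ <;> rw [hp]
        · exact .linClaim u
        · simp [specHideLabel, SpecPC.event]
      · rintro hp
        refine hs' u o ?_ ?_ <;> rw [hp]
        · exact .beginClaim u o
        · simp [specHideLabel, SpecPC.event]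
      · rintro hp
        refine hs' u o ?_ ?_ <;> rw [hp]
        · exact .endRelease u o
        · simp [specHideLabel, SpecPC.event]
      · rintro rfl hp
        refine hs' u none ?_ ?_ <;> rw [hp]
        · exact .linRelease u
        · simp [specHideLabel, SpecPC.event]
    obtain ⟨h1, h2⟩ := hI
    cases o with
    | none =>
      -- With the mutex free, any user is idle, claiming or released, and all three are excluded;
      -- `hN` provides a user to apply this to.
      have := h1 ⟨0, hN⟩
      have := h2 ⟨0, hN⟩
      have := h3 ⟨0, hN⟩
      cases hk : pc ⟨0, hN⟩ <;> simp_all [SpecPC.Locked]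
    | some u =>
      -- The mutex belongs to `u`, which is not `holding` because the visible holder is `none`, and
      -- not `releasing` by stability; it must be about to perform `endClaim u`.
      have := h1 u
      have := h2 u
      have := h3 u
      have hk : pc u = .claimed := by
        cases hk : pc u <;> simp_all [SpecPC.Locked]
      have h := spec_hide_step_specConf (pc := pc) (o := some u) (o' := some u) u
        (by rw [hk]; exact .endClaim u)
      rw [hk] at h
      exact ⟨u, _, h⟩
  releasable := by
    rintro _ u ⟨⟨pc, o⟩, rfl, h1, h2⟩
    have hk : pc u = .holding := (h2 u).2 rfl
    obtain rfl : o = some u := (h1 u).1 (by simp [hk, SpecPC.Locked])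
    have h := spec_hide_step_specConf (pc := pc) (o := some u) (o' := some u) u
      (by rw [hk]; exact .beginRelease u)
    rw [hk] at h
    exact ⟨_, .nil _, _, h⟩
  not_diverges := by
    rintro m _ ⟨c, rfl, hI⟩
    refine LTS.not_diverges_of_rank (P := (SPEC N).hide HIDE) (fun c => specConf c.1 c.2)
      (SpecLockInv m)
      (fun c => ∑ u, (c.1 u).rank) ?_ hI
    rintro ⟨pc, o⟩ q hI h
    obtain ⟨u, o', hm, hl, rfl⟩ := spec_hide_step_cases h
    obtain ⟨m', hI', h'⟩ := hI.step hm
    rcases h' with ⟨rfl, _, h'⟩ | ⟨_, _, h'⟩ | ⟨_, _, h'⟩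
    · exact ⟨_, rfl, hI', sum_update_lt (fun _ k => SpecPC.rank k) pc u _ h'⟩
    · simp [h'] at hl
    · simp [h'] at hl
  endClaim_stable := by
    rintro m _ q' u ⟨⟨pc, o⟩, rfl, hI⟩ ⟨r, hr⟩ h
    obtain ⟨v, o₁, hv, hl, rfl⟩ := spec_hide_step_cases hr
    have hk : pc v = .claimed ∧ v = u := by
      dsimp only at hl
      revert hl
      cases pc v <;> simp [specHideLabel, SpecPC.event, eq_comm]
    obtain ⟨hk, rfl⟩ := hk
    obtain ⟨pc', rfl, hk'⟩ := hI.locked_stable (.inl hk) h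
    have h := spec_hide_step_specConf (pc := pc') (o := some v) (o' := some v) v
      (by rw [hk', hk]; exact .endClaim v)
    rw [hk', hk] at h
    exact ⟨_, h⟩
  beginRelease_stable := by
    rintro m _ q' u ⟨⟨pc, o⟩, rfl, hI⟩ ⟨r, hr⟩ h
    obtain ⟨v, o₁, hv, hl, rfl⟩ := spec_hide_step_cases hr
    have hk : pc v = .holding ∧ v = u := by
      dsimp only at hl
      revert hl
      cases pc v <;> simp [specHideLabel, SpecPC.event, eq_comm]
    obtain ⟨hk, rfl⟩ := hk
    obtain ⟨pc', rfl, hk'⟩ := hI.locked_stable (.inr hk) h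
    have h := spec_hide_step_specConf (pc := pc') (o := some v) (o' := some v) v
      (by rw [hk', hk]; exact .beginRelease v)
    rw [hk', hk] at h
    exact ⟨_, h⟩

end ClaimRelease

/-! ### Chase and its interaction with hiding -/

namespace CSP.LTS

variable {E : Type} {P : LTS E} {sel : P.State → P.State}

theorem ChasesTo.unique {q r r' : P.State} (h : ChasesTo P sel q r) (h' : ChasesTo P sel q r') :
    r' = r := by
  induction h with
  | stable hq =>
    cases h' with
    | stable => rfl
    | tau hn => exact absurd hq hn
  | tau hn _ ih =>
    cases h' with
    | stable hq => exact absurd hq hn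
    | tau _ h' => exact ih h'

/-- Where the internal successor is unique, every selection has to follow it, so the outcome of the
chase does not depend on `sel`. -/
theorem ChasesTo.of_unique_tau (hsel : P.IsTauSelection sel) {q r : P.State}
    (h : P.step q .tau r) (hu : ∀ r', P.step q .tau r' → r' = r) (hr : P.Stable r) :
    ChasesTo P sel q r := by
  have hq : ¬ P.Stable q := fun hs => hs _ h
  refine .tau hq ?_
  rw [hu _ (hsel q hq)]
  exact .stable hr

theorem ChasesTo.hide_step_tau {q r q' : P.State} {A : Set E} {a : E} (h : ChasesTo P sel q r)
    (ha : a ∈ A) (hs : P.step r (.vis (.ev a)) q') :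
    ((P.chase sel).hide A).step q .tau q' :=
  .hidden ha (.vis h hs)

theorem ChasesTo.hide_step_vis {q r q' : P.State} {A : Set E} {a : E} (h : ChasesTo P sel q r)
    (ha : a ∉ A) (hs : P.step r (.vis (.ev a)) q') :
    ((P.chase sel).hide A).step q (.vis (.ev a)) q' :=
  .event ha (.vis h hs)

/-- A chase that ends excludes the divergent loop, so the chased state has no `τ` of its own:
internal steps after hiding come from hidden events of `r`. -/
theorem ChasesTo.hide_step_cases {q r q' : P.State} {A : Set E} {l : Act E}
    (h : ChasesTo P sel q r) (hs : ((P.chase sel).hide A).step q l q') :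
    ∃ o, P.step r (.vis o) q' ∧ ((∃ a ∈ A, o = .ev a) ∨ l = .vis o) := by
  have key : ∀ {l}, (P.chase sel).step q l q' → ∃ o, l = .vis o ∧ P.step r (.vis o) q' := by
    intro l hc
    cases hc with
    | vis hr hc => exact ⟨_, rfl, h.unique hr ▸ hc⟩
    | diverge hn => exact absurd h (hn r)
  rcases hide_step_iff.1 hs with ⟨a, ha, rfl, hc⟩ | ⟨ha, hc⟩
  · obtain ⟨o, ho, hr⟩ := key hc
    cases ho
    exact ⟨_, hr, .inl ⟨a, ha, rfl⟩⟩
  · obtain ⟨o, rfl, hr⟩ := key hc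
    exact ⟨_, hr, .inr rfl⟩

end CSP.LTS

/-! ### The chased specification allows every behaviour of the lock -/

namespace ClaimRelease

open CSP Event

variable {N : ℕ}

/-- The only internal actions of the specification are `linClaim`, which needs a free mutex, and
`linRelease`. -/
theorem spec_stable {pc : NonNullPID N → SpecPC} {o : PID N}
    (h : ∀ v, (pc v = .claiming → o ≠ none) ∧ pc v ≠ .releasing) :
    (SPEC N).Stable (specConf pc o) := by
  intro X hX
  obtain ⟨v, o', hm, hl, _⟩ := spec_step_cases hX
  have := h v
  revert this hm hl
  cases pc v <;> intro hm <;> cases hm <;> simp [specLabel, SpecPC.event]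

/-- The user `u` is at `k`, the users of `S` wait for the lock, and all others are idle. -/
def waitPC (u : NonNullPID N) (k : SpecPC) (S : Finset (NonNullPID N)) (v : NonNullPID N) :
    SpecPC :=
  if v = u then k else if v ∈ S then .claiming else .idle

theorem waitPC_self (u : NonNullPID N) (k : SpecPC) (S : Finset (NonNullPID N)) :
    waitPC u k S u = k := if_pos rfl

theorem update_waitPC_self (u : NonNullPID N) (k k' : SpecPC) (S : Finset (NonNullPID N)) :
    Function.update (waitPC u k S) u k' = waitPC u k' S := by
  funext v
  by_cases h : v = u <;> simp [waitPC, h]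

theorem update_waitPC_of_ne {u w : NonNullPID N} (h : w ≠ u) (k : SpecPC)
    (S : Finset (NonNullPID N)) :
    Function.update (waitPC u k S) w .claiming = waitPC u k (insert w S) := by
  funext v
  by_cases hv : v = w
  · subst hv; simp [waitPC, h]
  · simp [waitPC, hv]

theorem waitPC_idle (u : NonNullPID N) : waitPC u .idle ∅ = fun _ => .idle := by
  funext v
  simp [waitPC]

theorem spec_step_waitPC {u : NonNullPID N} {k : SpecPC} {o o' : PID N}
    {S : Finset (NonNullPID N)} (h : MutexStep o (k.event u) o') :
    (SPEC N).step (specConf (waitPC u k S) o) (specLabel (k.event u))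
      (specConf (waitPC u k.next S) o') := by
  have := spec_step_specConf (pc := waitPC u k S) u (by rwa [waitPC_self])
  rwa [waitPC_self, update_waitPC_self] at this

theorem waitPC_stable {u : NonNullPID N} {k : SpecPC} {S : Finset (NonNullPID N)}
    (hk : k = .claimed ∨ k = .holding) :
    (SPEC N).Stable (specConf (waitPC u k S) (some u)) := by
  refine spec_stable fun v => ⟨by simp, ?_⟩
  rcases hk with rfl | rfl <;> simp only [waitPC] <;> split_ifs <;> simp

theorem waitPC_empty_stable {u : NonNullPID N} {k : SpecPC}
    (hk : k = .idle ∨ k = .released) :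
    (SPEC N).Stable (specConf (waitPC u k ∅) none) := by
  refine spec_stable fun v => ?_
  rcases hk with rfl | rfl <;> simp only [waitPC] <;> split_ifs <;> simp_all

variable {sel : (SPEC N).State → (SPEC N).State}

/-- With everyone but `u` idle, only `u` has an internal action, which is what
`ChasesTo.of_unique_tau` needs. -/
theorem chasesTo_waitPC (hsel : (SPEC N).IsTauSelection sel) {u : NonNullPID N} {k : SpecPC}
    {o o' : PID N} (h : MutexStep o (k.event u) o') (hk : k = .claiming ∨ k = .releasing)
    (hs : (SPEC N).Stable (specConf (waitPC u k.next ∅) o')) :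
    LTS.ChasesTo (SPEC N) sel (specConf (waitPC u k ∅) o)
      (specConf (waitPC u k.next ∅) o') := by
  refine .of_unique_tau hsel ?_ ?_ hs
  · have := spec_step_waitPC (S := ∅) h
    rcases hk with rfl | rfl <;> exact this
  · intro r hr
    obtain ⟨v, o₁, hm, hl, rfl⟩ := spec_step_cases hr
    obtain rfl : v = u := by
      by_contra hv
      simp [waitPC, hv, specLabel, SpecPC.event] at hl
    rw [waitPC_self] at hm ⊢
    rw [update_waitPC_self]
    rcases hk with rfl | rfl <;> cases hm <;> cases h <;> rfl

/-- The users of `S` begin their claims one after another through hidden events. The mutex stays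
with `u`, so none of these claims can linearize, and every intermediate state is stable and chases
to itself. -/
theorem exists_weak_waitPC {u : NonNullPID N} {k : SpecPC} (hk : k = .claimed ∨ k = .holding)
    {q : (SPEC N).State} (hq : LTS.ChasesTo (SPEC N) sel q (specConf (waitPC u k ∅) (some u)))
    (S : Finset (NonNullPID N)) :
    ∃ q', ((TauPriorSpec N sel).hide HIDE).Weak q [] q' ∧
      LTS.ChasesTo (SPEC N) sel q' (specConf (waitPC u k S) (some u)) := by
  induction S using Finset.induction_on with
  | empty => exact ⟨q, .nil _, hq⟩
  | insert w S hw ih =>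
    obtain ⟨q', hw', hc⟩ := ih
    by_cases hwu : w = u
    · subst hwu
      -- Membership of `u` in the waiting set is irrelevant, because `waitPC` tests for `u` first.
      refine ⟨q', hw', ?_⟩
      convert hc using 2
      funext v
      by_cases hv : v = w <;> simp [waitPC, hv]
    · have hs := spec_step_specConf (pc := waitPC u k S) (o := some u) (o' := some u) w
        (by simp only [waitPC, hwu, hw, if_false]; exact .beginClaim w _)
      simp only [show waitPC u k S w = .idle by simp [waitPC, hwu, hw], SpecPC.next,
        update_waitPC_of_ne hwu] at hs
      exact ⟨_, hw'.append (.single_tau (hc.hide_step_tau (a := beginClaim w) (by simp [HIDE]) hs)),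
        .stable (waitPC_stable hk)⟩

/-- Let all other users wait: they can do nothing but `linClaim`, which the mutex blocks, so the
event of `u` is the only one left and no hidden event remains. -/
theorem exists_weak_stable {u : NonNullPID N} {k : SpecPC} (hk : k = .claimed ∨ k = .holding)
    {q : (SPEC N).State} (hq : LTS.ChasesTo (SPEC N) sel q (specConf (waitPC u k ∅) (some u))) :
    ∃ q', ((TauPriorSpec N sel).hide HIDE).Weak q [] q' ∧
      ((TauPriorSpec N sel).hide HIDE).Stable q' ∧
      ∀ o, ((TauPriorSpec N sel).hide HIDE).Enabled q' o → o = .ev (k.event u) := by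
  obtain ⟨q', hw, hc⟩ := exists_weak_waitPC hk hq Finset.univ
  have key : ∀ {o X}, (SPEC N).step (specConf (waitPC u k Finset.univ) (some u)) (.vis o) X →
      o = .ev (k.event u) := by
    intro o X hX
    obtain ⟨v, o₁, hm, hl, rfl⟩ := spec_step_cases hX
    by_cases hv : v = u
    · subst hv
      rw [waitPC_self] at hl
      rcases hk with rfl | rfl <;> simpa [specLabel, SpecPC.event] using hl
    · simp only [waitPC, hv, if_false, Finset.mem_univ, if_true, SpecPC.event] at hm
      cases hm
  refine ⟨q', hw, ?_, ?_⟩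
  · intro X hX
    obtain ⟨o, ho, ⟨a, ha, rfl⟩ | h⟩ := hc.hide_step_cases hX
    · have := key ho
      simp only [Obs.ev.injEq] at this
      subst this
      rcases hk with rfl | rfl <;> simp [HIDE, SpecPC.event] at ha
    · cases h
  · rintro o ⟨X, hX⟩
    obtain ⟨o', ho, ⟨a, ha, rfl⟩ | h⟩ := hc.hide_step_cases hX
    · have := key ho
      simp only [Obs.ev.injEq] at this
      subst this
      rcases hk with rfl | rfl <;> simp [HIDE, SpecPC.event] at ha
    · cases h
      exact key ho

/-- The states in which the chased specification is free, and held by `u` with all others idle. -/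
def restConf : PID N → (SPEC N).State
  | none => specConf (fun _ => .idle) none
  | some u => specConf (waitPC u .holding ∅) (some u)

/-- One user completes a whole cycle while the others stay idle: its hidden `beginClaim` picks the
next holder, and the chase performs `linClaim` and `linRelease` as forced moves. The stable states
with a single offer come from letting the others pile up behind it. -/
theorem tauPriorSpec_allowsLock (hsel : (SPEC N).IsTauSelection sel) :
    AllowsLock ((TauPriorSpec N sel).hide HIDE) restConf := by
  have hclaim : ∀ u, ∃ q, ((TauPriorSpec N sel).hide HIDE).Weak (restConf none) [] q ∧
      LTS.ChasesTo (SPEC N) sel q (specConf (waitPC u .claimed ∅) (some u)) := by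
    intro u
    refine ⟨specConf (waitPC u .claiming ∅) none, .single_tau ?_, ?_⟩
    · have h := LTS.ChasesTo.hide_step_tau (sel := sel) (A := HIDE)
        (.stable (waitPC_empty_stable (u := u) (.inl rfl))) (a := beginClaim u) (by simp [HIDE])
        (spec_step_waitPC (.beginClaim u none))
      rw [waitPC_idle] at h
      exact h
    · exact chasesTo_waitPC hsel (.linClaim u) (.inl rfl) (waitPC_stable (.inl rfl))
  have hhold : ∀ u, LTS.ChasesTo (SPEC N) sel (restConf (some u))
      (specConf (waitPC u .holding ∅) (some u)) := fun u => .stable (waitPC_stable (.inr rfl))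
  refine ⟨rfl, fun u => ?_, fun u => ?_, fun u => ?_, fun u => ?_⟩
  · obtain ⟨q, hw, hc⟩ := hclaim u
    exact hw.append (.single (hc.hide_step_vis (a := endClaim u) (by simp [HIDE])
      (spec_step_waitPC (.endClaim u))))
  · have h1 := (hhold u).hide_step_vis (A := HIDE) (a := beginRelease u) (by simp [HIDE])
      (spec_step_waitPC (.beginRelease u))
    have h2 := LTS.ChasesTo.hide_step_tau (A := HIDE) (chasesTo_waitPC hsel (.linRelease u)
      (.inr rfl) (waitPC_empty_stable (.inr rfl))) (a := endRelease u) (by simp [HIDE])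
      (spec_step_waitPC (.endRelease u none))
    simp only [SpecPC.next, waitPC_idle] at h2
    exact .cons h1 (.single_tau h2)
  · obtain ⟨q, hw, hc⟩ := hclaim u
    obtain ⟨q', hw', h⟩ := exists_weak_stable (.inl rfl) hc
    exact ⟨q', hw.append hw', h⟩
  · exact exists_weak_stable (.inr rfl) (hhold u)

end ClaimRelease

namespace ClaimRelease

open CSP Event STATE Proc

variable {N : ℕ}

/-! ### The users of the implementation -/

/-- The end of `CLAIM(p)` once the lock is held. -/
def claimDone (p : NonNullPID N) : Proc (Event N) Unit :=
  setState p ACTIVE ⇝ endClaim p ⇝ SKIP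

/-- The part of `CLAIM(p)` which waits to be scheduled. -/
def claimWait (p : NonNullPID N) : Proc (Event N) Unit :=
  input (casState p ENGAGING WAITING) fun succ =>
  if succ then YIELD p ;; endClaim p ⇝ SKIP else claimDone p

/-- The part of `CLAIM(p)` from the second compare-and-swap of the owner from `NULL`. -/
def claimRetryNull (p : NonNullPID N) : Proc (Event N) Unit :=
  input (casOwner NULL (some p)) fun succ => if succ then claimDone p else claimWait p

/-- The part of `CLAIM(p)` which takes the lock from the previous owner `own`. -/
def claimSteal (p : NonNullPID N) (own : PID N) : Proc (Event N) Unit :=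
  input (casOwner own (some p)) fun succ => if succ then claimDone p else claimRetryNull p

/-- The part of `CLAIM(p)` which loads the owner. -/
def claimLoad (p : NonNullPID N) : Proc (Event N) Unit :=
  input getOwner fun own =>
  if own = NULL then setOwner (some p) ⇝ claimDone p
  else if own = some p then claimWait p else claimSteal p own

/-- The part of `CLAIM(p)` from the first compare-and-swap of the owner. -/
def claimTryNull (p : NonNullPID N) : Proc (Event N) Unit :=
  input (casOwner NULL (some p)) fun succ => if succ then claimDone p else claimLoad p

/-- The part of `CLAIM(p)` from the result of `peek`. -/
def claimPeeked (p : NonNullPID N) : Proc (Event N) Unit :=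
  input (ret p) fun headQ => if headQ = some p then claimTryNull p else claimWait p

/-- The part of `RELEASE(p)` from the compare-and-swap of the owner, with the head `h`. -/
def releaseTransfer (p : NonNullPID N) (h : PID N) : Proc (Event N) Unit :=
  match h with
  | none => input (casOwner (some p) NULL) fun _ => endRelease p ⇝ SKIP
  | some h =>
    input (casOwner (some p) (some h)) fun succ =>
    if succ then SCHEDULE h ;; endRelease p ⇝ SKIP
    else endRelease p ⇝ SKIP

/-- Control points of a user of the implementation, each named for what comes next. -/
inductive UserPC (N : ℕ) : Type where
  | idle
  | engage
  | enqueue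
  | enqueueReturn
  | peek
  | peekReturn
  | tryNull
  | load
  | storeOwner
  | steal (own : PID N)
  | retryNull
  | casWaiting
  | yieldWait
  | yieldActive
  | yieldEnd
  | activate
  | endClaim
  | claimed
  | holding
  | dequeue
  | dequeueReturn
  | releasePeek
  | releasePeekReturn
  | transfer (h : PID N)
  | schedule (h : NonNullPID N)
  | reschedule (h : NonNullPID N)
  | scheduled
  | endRelease
  | released

/-- The term of the implementation's `USER(p)` at a control point. -/
def UserPC.term (p : NonNullPID N) : UserPC N → Proc (Event N) Unit
  | idle => call ()
  | engage => (setState p ENGAGING ⇝ Event.enqueue p p ⇝ endEnqueue p ⇝ Event.peek p ⇝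
      claimPeeked p) ;; RELEASE p ;; call ()
  | enqueue => (Event.enqueue p p ⇝ endEnqueue p ⇝ Event.peek p ⇝ claimPeeked p) ;;
      RELEASE p ;; call ()
  | enqueueReturn => (endEnqueue p ⇝ Event.peek p ⇝ claimPeeked p) ;; RELEASE p ;; call ()
  | peek => (Event.peek p ⇝ claimPeeked p) ;; RELEASE p ;; call ()
  | peekReturn => claimPeeked p ;; RELEASE p ;; call ()
  | tryNull => claimTryNull p ;; RELEASE p ;; call ()
  | load => claimLoad p ;; RELEASE p ;; call ()
  | storeOwner => (setOwner (some p) ⇝ claimDone p) ;; RELEASE p ;; call ()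
  | steal own => claimSteal p own ;; RELEASE p ;; call ()
  | retryNull => claimRetryNull p ;; RELEASE p ;; call ()
  | casWaiting => claimWait p ;; RELEASE p ;; call ()
  | yieldWait => (YIELD p ;; Event.endClaim p ⇝ SKIP) ;; RELEASE p ;; call ()
  | yieldActive => ((setState p ACTIVE ⇝ SKIP) ;; Event.endClaim p ⇝ SKIP) ;; RELEASE p ;; call ()
  | yieldEnd => (SKIP ;; Event.endClaim p ⇝ SKIP) ;; RELEASE p ;; call ()
  | activate => claimDone p ;; RELEASE p ;; call ()
  | endClaim => (Event.endClaim p ⇝ SKIP) ;; RELEASE p ;; call ()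
  | claimed => SKIP ;; RELEASE p ;; call ()
  | holding => RELEASE p ;; call ()
  | dequeue => (Event.dequeue p ⇝ ret p (some p) ⇝ Event.peek p ⇝ input (ret p) (releaseTransfer p))
      ;; call ()
  | dequeueReturn => (ret p (some p) ⇝ Event.peek p ⇝ input (ret p) (releaseTransfer p)) ;; call ()
  | releasePeek => (Event.peek p ⇝ input (ret p) (releaseTransfer p)) ;; call ()
  | releasePeekReturn => input (ret p) (releaseTransfer p) ;; call ()
  | transfer h => releaseTransfer p h ;; call ()
  | schedule h => (SCHEDULE h ;; Event.endRelease p ⇝ SKIP) ;; call ()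
  | reschedule h => ((input (casState h WAITING SCHEDULED) fun _ => SKIP) ;;
      Event.endRelease p ⇝ SKIP) ;; call ()
  | scheduled => (SKIP ;; Event.endRelease p ⇝ SKIP) ;; call ()
  | endRelease => (Event.endRelease p ⇝ SKIP) ;; call ()
  | released => SKIP ;; call ()

/-- Transitions between the control points of a user. -/
inductive UserStep (p : NonNullPID N) : UserPC N → Act (Event N) → UserPC N → Prop where
  | beginClaim : UserStep p .idle (.vis (.ev (beginClaim p))) .engage
  | engage : UserStep p .engage (.vis (.ev (setState p ENGAGING))) .enqueue
  | enqueue : UserStep p .enqueue (.vis (.ev (enqueue p p))) .enqueueReturn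
  | endEnqueue : UserStep p .enqueueReturn (.vis (.ev (endEnqueue p))) .peek
  | peek : UserStep p .peek (.vis (.ev (peek p))) .peekReturn
  | peekHead : UserStep p .peekReturn (.vis (.ev (ret p (some p)))) .tryNull
  | peekOther {v} (h : v ≠ some p) : UserStep p .peekReturn (.vis (.ev (ret p v))) .casWaiting
  | tryNullSucc : UserStep p .tryNull (.vis (.ev (casOwner none (some p) true))) .activate
  | tryNullFail : UserStep p .tryNull (.vis (.ev (casOwner none (some p) false))) .load
  | loadNull : UserStep p .load (.vis (.ev (getOwner none))) .storeOwner
  | loadSelf : UserStep p .load (.vis (.ev (getOwner (some p)))) .casWaiting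
  | loadOther {own} (h : own ≠ none) (h' : own ≠ some p) :
      UserStep p .load (.vis (.ev (getOwner own))) (.steal own)
  | storeOwner : UserStep p .storeOwner (.vis (.ev (setOwner (some p)))) .activate
  | stealSucc {own} : UserStep p (.steal own) (.vis (.ev (casOwner own (some p) true))) .activate
  | stealFail {own} : UserStep p (.steal own) (.vis (.ev (casOwner own (some p) false))) .retryNull
  | retryNullSucc : UserStep p .retryNull (.vis (.ev (casOwner none (some p) true))) .activate
  | retryNullFail : UserStep p .retryNull (.vis (.ev (casOwner none (some p) false))) .casWaiting
  | waitSucc : UserStep p .casWaiting (.vis (.ev (casState p ENGAGING WAITING true))) .yieldWait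
  | waitFail : UserStep p .casWaiting (.vis (.ev (casState p ENGAGING WAITING false))) .activate
  | yieldWait : UserStep p .yieldWait (.vis (.ev (getState p SCHEDULED))) .yieldActive
  | yieldActive : UserStep p .yieldActive (.vis (.ev (setState p ACTIVE))) .yieldEnd
  | yieldEnd : UserStep p .yieldEnd .tau .endClaim
  | activate : UserStep p .activate (.vis (.ev (setState p ACTIVE))) .endClaim
  | endClaim : UserStep p .endClaim (.vis (.ev (endClaim p))) .claimed
  | claimed : UserStep p .claimed .tau .holding
  | beginRelease : UserStep p .holding (.vis (.ev (beginRelease p))) .dequeue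
  | dequeue : UserStep p .dequeue (.vis (.ev (dequeue p))) .dequeueReturn
  | dequeueReturn : UserStep p .dequeueReturn (.vis (.ev (ret p (some p)))) .releasePeek
  | releasePeek : UserStep p .releasePeek (.vis (.ev (peek p))) .releasePeekReturn
  | releasePeekReturn {v} : UserStep p .releasePeekReturn (.vis (.ev (ret p v))) (.transfer v)
  | transferNull {b} :
      UserStep p (.transfer none) (.vis (.ev (casOwner (some p) none b))) .endRelease
  | transferSucc {h} : UserStep p (.transfer (some h))
      (.vis (.ev (casOwner (some p) (some h) true))) (.schedule h)
  | transferFail {h} : UserStep p (.transfer (some h))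
      (.vis (.ev (casOwner (some p) (some h) false))) .endRelease
  | scheduleSucc {h} : UserStep p (.schedule h)
      (.vis (.ev (casState h ENGAGING SCHEDULED true))) .scheduled
  | scheduleFail {h} : UserStep p (.schedule h)
      (.vis (.ev (casState h ENGAGING SCHEDULED false))) (.reschedule h)
  | reschedule {h b} : UserStep p (.reschedule h)
      (.vis (.ev (casState h WAITING SCHEDULED b))) .scheduled
  | scheduled : UserStep p .scheduled .tau .endRelease
  | endRelease : UserStep p .endRelease (.vis (.ev (endRelease p))) .released
  | released : UserStep p .released .tau .idle

section Steps

variable {p h : NonNullPID N} {own : PID N} {l : Act (Event N)} {X : Proc (Event N) Unit}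
  {env : Unit → Proc (Event N) Unit}

theorem step_claimDone_iff : Step env (claimDone p) l X ↔
    l = .vis (.ev (setState p ACTIVE)) ∧ X = endClaim p ⇝ SKIP := step_pre_iff

theorem step_claimWait_iff : Step env (claimWait p) l X ↔
    ∃ b : Bool, l = .vis (.ev (casState p ENGAGING WAITING b)) ∧
      X = if b then YIELD p ;; endClaim p ⇝ SKIP else claimDone p := step_input_iff

theorem step_claimRetryNull_iff : Step env (claimRetryNull p) l X ↔
    ∃ b : Bool, l = .vis (.ev (casOwner NULL (some p) b)) ∧
      X = if b then claimDone p else claimWait p := step_input_iff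

theorem step_claimSteal_iff : Step env (claimSteal p own) l X ↔
    ∃ b : Bool, l = .vis (.ev (casOwner own (some p) b)) ∧
      X = if b then claimDone p else claimRetryNull p := step_input_iff

theorem step_claimLoad_iff : Step env (claimLoad p) l X ↔
    ∃ own, l = .vis (.ev (getOwner own)) ∧
      X = if own = NULL then setOwner (some p) ⇝ claimDone p
        else if own = some p then claimWait p else claimSteal p own := step_input_iff

theorem step_claimTryNull_iff : Step env (claimTryNull p) l X ↔
    ∃ b : Bool, l = .vis (.ev (casOwner NULL (some p) b)) ∧
      X = if b then claimDone p else claimLoad p := step_input_iff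

theorem step_claimPeeked_iff : Step env (claimPeeked p) l X ↔
    ∃ v, l = .vis (.ev (ret p v)) ∧
      X = if v = some p then claimTryNull p else claimWait p := step_input_iff

theorem step_releaseTransfer_none_iff : Step env (releaseTransfer p none) l X ↔
    ∃ b : Bool, l = .vis (.ev (casOwner (some p) NULL b)) ∧ X = endRelease p ⇝ SKIP :=
  step_input_iff

theorem step_releaseTransfer_some_iff : Step env (releaseTransfer p (some h)) l X ↔
    ∃ b : Bool, l = .vis (.ev (casOwner (some p) (some h) b)) ∧
      X = if b then SCHEDULE h ;; endRelease p ⇝ SKIP else endRelease p ⇝ SKIP :=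
  step_input_iff

theorem step_YIELD_iff : Step env (YIELD p) l X ↔
    l = .vis (.ev (getState p SCHEDULED)) ∧ X = setState p ACTIVE ⇝ SKIP := step_pre_iff

theorem step_SCHEDULE_iff : Step env (SCHEDULE p) l X ↔
    ∃ b : Bool, l = .vis (.ev (casState p ENGAGING SCHEDULED b)) ∧
      X = if b then SKIP else input (casState p WAITING SCHEDULED) fun _ => SKIP :=
  step_input_iff

theorem step_CLAIM_iff : Step env (CLAIM p) l X ↔
    l = .vis (.ev (beginClaim p)) ∧ X = setState p ENGAGING ⇝
      enqueue p p ⇝ endEnqueue p ⇝ peek p ⇝ claimPeeked p := step_pre_iff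

theorem step_RELEASE_iff : Step env (RELEASE p) l X ↔
    l = .vis (.ev (beginRelease p)) ∧ X = dequeue p ⇝
    ret p (some p) ⇝ peek p ⇝ input (ret p) (releaseTransfer p) := step_pre_iff

end Steps

theorem user_step_term {p : NonNullPID N} {k k' : UserPC N} {l : Act (Event N)}
    (h : UserStep p k l k') : (IMPL_USER p).step (k.term p) l (k'.term p) := by
  simp only [IMPL_USER, Proc.toLTS]
  cases h <;>
  simp [UserPC.term, step_call_iff, step_seq_iff, step_pre_iff,
    step_input_iff, step_SKIP_iff, step_claimDone_iff, step_claimWait_iff, step_claimRetryNull_iff,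
    step_claimSteal_iff, step_claimLoad_iff, step_claimTryNull_iff, step_claimPeeked_iff,
    step_releaseTransfer_none_iff, step_releaseTransfer_some_iff, step_YIELD_iff,
    step_SCHEDULE_iff, step_CLAIM_iff, step_RELEASE_iff, *]

/-- Together with `user_step_term` this shows that the control points are closed under transitions
and that `UserStep` describes them exactly. -/
theorem user_step_cases {p : NonNullPID N} {k : UserPC N} {l : Act (Event N)}
    {X : Proc (Event N) Unit} (h : (IMPL_USER p).step (k.term p) l X) :
    ∃ k', X = k'.term p ∧ UserStep p k l k' := by
  -- Taking the transition before the equation of terms lets the transition determine `k'`.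
  have hX : ∀ {k' : UserPC N}, UserStep p k l k' →
      X = k'.term p → ∃ k', X = k'.term p ∧ UserStep p k l k' := fun h hX => ⟨_, hX, h⟩
  simp only [IMPL_USER, Proc.toLTS] at h
  cases k
  case transfer v =>
    cases v <;> simp only [UserPC.term, step_seq_iff, step_releaseTransfer_none_iff,
      step_releaseTransfer_some_iff] at h
    · obtain ⟨-, _, ⟨b, rfl, rfl⟩, rfl⟩ | ⟨rfl, rfl, _, _, ⟨⟩, _⟩ := h
      exact hX .transferNull rfl
    · obtain ⟨-, _, ⟨_ | _, rfl, rfl⟩, rfl⟩ | ⟨rfl, rfl, _, _, ⟨⟩, _⟩ := h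
      · exact hX .transferFail rfl
      · exact hX .transferSucc rfl
  all_goals
    simp only [UserPC.term, step_call_iff, step_seq_iff, step_pre_iff,
      step_input_iff, step_SKIP_iff, step_claimDone_iff, step_claimWait_iff,
      step_claimRetryNull_iff, step_claimSteal_iff, step_claimLoad_iff, step_claimTryNull_iff,
      step_claimPeeked_iff, step_YIELD_iff, step_SCHEDULE_iff, step_CLAIM_iff,
      step_RELEASE_iff] at h
  case load =>
    obtain ⟨-, _, ⟨v, rfl, rfl⟩, rfl⟩ | ⟨rfl, rfl, _, _, ⟨⟩, _⟩ := h
    split_ifs with h1 h2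
    · exact ⟨.storeOwner, rfl, h1 ▸ .loadNull⟩
    · exact ⟨.casWaiting, rfl, h2 ▸ .loadSelf⟩
    · exact ⟨.steal v, rfl, .loadOther h1 h2⟩
  case peekReturn =>
    obtain ⟨-, _, ⟨v, rfl, rfl⟩, rfl⟩ | ⟨rfl, rfl, _, _, ⟨⟩, _⟩ := h
    split_ifs with h1
    · exact ⟨.tryNull, rfl, h1 ▸ .peekHead⟩
    · exact ⟨.casWaiting, rfl, .peekOther h1⟩
  case tryNull | steal | retryNull | casWaiting =>
    obtain ⟨-, _, ⟨_ | _, rfl, rfl⟩, rfl⟩ | ⟨rfl, rfl, _, _, ⟨⟩, _⟩ := h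
    all_goals exact hX (by constructor) rfl
  case releasePeekReturn =>
    obtain ⟨-, _, ⟨v, rfl, rfl⟩, rfl⟩ | ⟨rfl, rfl, _, _, ⟨⟩, _⟩ := h
    exact hX .releasePeekReturn rfl
  case schedule =>
    obtain ⟨-, _, ⟨-, _, ⟨_ | _, rfl, rfl⟩, rfl⟩ | ⟨rfl, rfl, _, _, ⟨⟩, _⟩, rfl⟩ |
      ⟨rfl, rfl, _, ⟨h, _⟩ | ⟨⟨⟩, _⟩⟩ := h
    · exact hX .scheduleFail rfl
    · exact hX .scheduleSucc rfl
    · simp at h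
  case reschedule =>
    obtain ⟨-, _, ⟨-, _, ⟨b, rfl, rfl⟩, rfl⟩ | ⟨rfl, rfl, _, _, ⟨⟩, _⟩, rfl⟩ |
      ⟨rfl, rfl, _, ⟨h, _⟩ | ⟨⟨⟩, _⟩⟩ := h
    · exact hX .reschedule rfl
    · simp at h
  case yieldWait | yieldActive =>
    obtain ⟨-, _, ⟨-, _, ⟨rfl, rfl⟩, rfl⟩ | ⟨rfl, rfl, _, ⟨⟩, _⟩, rfl⟩ |
      ⟨rfl, rfl, _, ⟨h, _⟩ | ⟨⟨⟩, _⟩⟩ := h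
    · exact hX (by constructor) rfl
    · simp at h
  case yieldEnd | scheduled =>
    obtain ⟨-, _, ⟨h, _, ⟨rfl, rfl⟩, rfl⟩ | ⟨rfl, rfl, _, _⟩, rfl⟩ |
      ⟨rfl, rfl, _, ⟨h, _⟩ | ⟨⟨⟩, _⟩⟩ := h
    · simp at h
    · exact hX (by constructor) rfl
    · simp at h
  case claimed | released =>
    obtain ⟨h, _, ⟨rfl, rfl⟩, rfl⟩ | ⟨rfl, rfl, _⟩ := h
    · simp at h
    · exact hX (by constructor) rfl
  all_goals
    obtain ⟨-, _, ⟨rfl, rfl⟩, rfl⟩ | ⟨rfl, rfl, _, ⟨⟩, _⟩ := h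
    exact hX (by constructor) rfl

end ClaimRelease

namespace ClaimRelease

open CSP Event STATE Proc

variable {N : ℕ}

/-! ### The shared data -/

/-- Control points of a user of the queue module. -/
inductive QueuePC (N : ℕ) : Type where
  | idle
  | enqueuing (v : NonNullPID N)
  | enqueued
  | dequeuing
  | peeking
  | returning (v : PID N)

/-- The term of the queue module's `USER(id)` at a control point. -/
def QueuePC.term (id : NonNullPID N) : QueuePC N → Proc (Event N) Unit
  | idle => call ()
  | enqueuing v => linEnqueue id v ⇝ endEnqueue id ⇝ call ()
  | enqueued => endEnqueue id ⇝ call ()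
  | dequeuing => input (linDequeue id) fun val => ret id val ⇝ call ()
  | peeking => input (linPeek id) fun val => ret id val ⇝ call ()
  | returning v => ret id v ⇝ call ()

/-- Transitions between the control points of a user of the queue module. -/
inductive QueueUserStep (id : NonNullPID N) : QueuePC N → Event N → QueuePC N → Prop where
  | enqueue (v) : QueueUserStep id .idle (enqueue id v) (.enqueuing v)
  | linEnqueue (v) : QueueUserStep id (.enqueuing v) (linEnqueue id v) .enqueued
  | endEnqueue : QueueUserStep id .enqueued (endEnqueue id) .idle
  | dequeue : QueueUserStep id .idle (dequeue id) .dequeuing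
  | linDequeue (v) : QueueUserStep id .dequeuing (linDequeue id v) (.returning v)
  | peek : QueueUserStep id .idle (peek id) .peeking
  | linPeek (v) : QueueUserStep id .peeking (linPeek id v) (.returning v)
  | ret (v) : QueueUserStep id (.returning v) (ret id v) .idle

theorem queueUser_step_iff {id : NonNullPID N} {k : QueuePC N} {l : Act (Event N)}
    {X : Proc (Event N) Unit} : (QUEUE_USER id).step (k.term id) l X ↔
      ∃ a k', l = .vis (.ev a) ∧ X = k'.term id ∧ QueueUserStep id k a k' := by
  simp only [QUEUE_USER, Proc.toLTS]
  constructor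
  · intro h
    cases k
    case idle =>
      simp only [QueuePC.term, step_call_iff, queueUser] at h
      cases l with
      | tau => simp [step_choice_tau_iff, step_input_iff, step_pre_iff] at h
      | vis o =>
        simp only [step_choice_vis_iff, step_input_iff, step_pre_iff] at h
        obtain ⟨v, h, rfl⟩ | ⟨h, rfl⟩ | ⟨h, rfl⟩ := h
        · exact ⟨_, _, h, rfl, .enqueue v⟩
        · exact ⟨_, _, h, rfl, .dequeue⟩
        · exact ⟨_, _, h, rfl, .peek⟩
    all_goals simp only [QueuePC.term, step_input_iff, step_pre_iff] at h
    case dequeuing =>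
      obtain ⟨v, rfl, rfl⟩ := h
      exact ⟨_, _, rfl, rfl, .linDequeue v⟩
    case peeking =>
      obtain ⟨v, rfl, rfl⟩ := h
      exact ⟨_, _, rfl, rfl, .linPeek v⟩
    all_goals
      obtain ⟨rfl, rfl⟩ := h
      exact ⟨_, _, rfl, rfl, by constructor⟩
  · rintro ⟨a, k', rfl, rfl, h⟩
    cases h <;> simp [QueuePC.term, step_call_iff, queueUser, step_choice_vis_iff, step_input_iff,
      step_pre_iff]

/-- Transitions of the sequential queue. -/
inductive QueueSpecStep : List (NonNullPID N) → Event N → List (NonNullPID N) → Prop where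
  | enqueue (q id v) : QueueSpecStep q (enqueue id v) q
  | linEnqueue (q id v) : QueueSpecStep q (linEnqueue id v) (q ++ [v])
  | endEnqueue (q id) : QueueSpecStep q (endEnqueue id) q
  | dequeue (q id) : QueueSpecStep q (dequeue id) q
  | linDequeue (q id) : QueueSpecStep q (linDequeue id q.head?) q.tail
  | peek (q id) : QueueSpecStep q (peek id) q
  | linPeek (q id) : QueueSpecStep q (linPeek id q.head?) q
  | ret (q id v) : QueueSpecStep q (ret id v) q

theorem queueSpec_step_iff {maxLen : ℕ} {q₀ q : List (NonNullPID N)} {l : Act (Event N)}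
    {X : Proc (Event N) (List (NonNullPID N))} :
    (QUEUE_SPEC maxLen q₀).step (call q) l X ↔ q.length ≤ maxLen ∧
      ∃ a q', l = .vis (.ev a) ∧ X = call q' ∧ QueueSpecStep q a q' := by
  simp only [QUEUE_SPEC, Proc.toLTS, step_call_iff, queueSpec, Proc.guard]
  split_ifs with hq
  · simp only [hq, true_and]
    constructor
    · intro h
      cases l with
      | tau => simp [step_choice_tau_iff, step_input_iff] at h
      | vis o =>
        simp only [step_choice_vis_iff, step_input_iff] at h
        obtain ⟨v, h, rfl⟩ | ⟨v, h, rfl⟩ | ⟨v, h, rfl⟩ | ⟨v, h, rfl⟩ | ⟨v, h, rfl⟩ | ⟨v, h, rfl⟩ |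
          ⟨v, h, rfl⟩ | ⟨v, h, rfl⟩ := h <;>
        exact ⟨_, _, h, rfl, by constructor⟩
    · rintro ⟨a, q', rfl, rfl, h⟩
      cases h <;> simp [step_choice_vis_iff, step_input_iff]
  · simp [step_STOP_iff, hq]

/-- The label with which the queue module shows the event `a`. -/
def queueLabel : Event N → Act (Event N)
  | linEnqueue _ _ | linDequeue _ _ | linPeek _ _ => .tau
  | a => .vis (.ev a)

theorem queueLabel_cases (a : Event N) :
    (a ∈ (queueHIDE : Set (Event N)) ∧ queueLabel a = .tau) ∨
      (a ∉ (queueHIDE : Set (Event N)) ∧ queueLabel a = .vis (.ev a)) := by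
  cases a <;> simp [queueHIDE, queueLabel]

/-- The configuration of the queue module. -/
def queueConf (maxLen : ℕ) (qpc : NonNullPID N → QueuePC N) (q : List (NonNullPID N)) :
    (QUEUE (N := N) maxLen).State :=
  ((fun u => (qpc u).term u, Proc.call q) :
    (∀ u : NonNullPID N, (QUEUE_USER u).State) × (QUEUE_SPEC (N := N) maxLen []).State)

theorem mem_queueSYNC {id : NonNullPID N} {k k' : QueuePC N} {a : Event N}
    (h : QueueUserStep id k a k') : a ∈ (queueSYNC : Set (Event N)) := by
  cases h <;> simp [queueSYNC]

theorem queue_step_iff {maxLen : ℕ} {qpc : NonNullPID N → QueuePC N} {q : List (NonNullPID N)}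
    {l : Act (Event N)} {X : (QUEUE (N := N) maxLen).State} :
    (QUEUE (N := N) maxLen).step (queueConf maxLen qpc q) l X ↔
      q.length ≤ maxLen ∧ ∃ id a k' q', QueueUserStep id (qpc id) a k' ∧ QueueSpecStep q a q' ∧
        l = queueLabel a ∧ X = queueConf maxLen (Function.update qpc id k') q' := by
  have key : ∀ {l X}, (LTS.par queueSYNC (LTS.interleaveAll fun u : NonNullPID N => QUEUE_USER u)
      (QUEUE_SPEC maxLen [])).step (queueConf maxLen qpc q) l X ↔
      q.length ≤ maxLen ∧ ∃ id a k' q', QueueUserStep id (qpc id) a k' ∧ QueueSpecStep q a q' ∧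
        l = .vis (.ev a) ∧ X = queueConf maxLen (Function.update qpc id k') q' := by
    intro l X
    have hU : ∀ {l X}, l ≠ .vis .tick → (LTS.interleaveAll fun u : NonNullPID N =>
        QUEUE_USER u).step (fun u => (qpc u).term u) l X → ∃ id a k', l = .vis (.ev a) ∧
          QueueUserStep id (qpc id) a k' ∧
          X = fun v => (Function.update qpc id k' v).term v := by
      intro l X hl h
      obtain ⟨u, k, ⟨a, h1, h2⟩, h3⟩ := LTS.interleaveAll_step_cases
        (P := fun u : NonNullPID N => QUEUE_USER u) (conf := fun u k => QueuePC.term u k)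
        (R := fun u k l k' => ∃ a, l = .vis (.ev a) ∧ QueueUserStep u k a k')
        (fun u k l X h => by
          obtain ⟨a, k', h1, h2, h3⟩ := queueUser_step_iff.1 h
          exact ⟨k', h2, a, h1, h3⟩) hl h
      exact ⟨u, a, k, h1, h2, h3⟩
    constructor
    · intro h
      cases h with
      | tauLeft h =>
        obtain ⟨_, _, _, h, _⟩ := hU (by simp) h
        cases h
      | tauRight h =>
        obtain ⟨_, _, _, h, _⟩ := queueSpec_step_iff.1 h
        cases h
      | left ha h =>
        obtain ⟨u, _, _, hl, h, _⟩ := hU (by simp) h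
        cases hl
        exact absurd (mem_queueSYNC h) ha
      | right ha h =>
        obtain ⟨_, _, _, hl, _, h⟩ := queueSpec_step_iff.1 h
        cases hl
        cases h <;> simp [queueSYNC] at ha
      | @sync _ _ _ _ a ha hP hQ =>
        obtain ⟨id, b, k', h1, h2, h3⟩ := hU (by simp) hP
        obtain ⟨hq, c, q', h4, rfl, h5⟩ := queueSpec_step_iff.1 hQ
        obtain rfl : a = b := by simpa using h1
        obtain rfl : a = c := by simpa using h4
        exact ⟨hq, id, a, k', q', h2, h5, rfl, by rw [h3]; rfl⟩
      | tick h h' =>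
        obtain ⟨_, _, _, h, _⟩ := queueSpec_step_iff.1 h'
        cases h
    · rintro ⟨hq, id, a, k', q', h1, h2, rfl, rfl⟩
      exact .sync (mem_queueSYNC h1)
        (LTS.interleaveAll_step_update (P := fun u : NonNullPID N => QUEUE_USER u)
          (conf := fun u k => QueuePC.term u k) id (by simp)
          (queueUser_step_iff.2 ⟨a, k', rfl, rfl, h1⟩))
        (queueSpec_step_iff.2 ⟨hq, a, q', rfl, rfl, h2⟩)
  constructor
  · intro h
    rcases LTS.hide_step_iff.1 h with ⟨a, ha, rfl, hs⟩ | ⟨ha, hs⟩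
    · obtain ⟨hq, id, b, k', q', h1, h2, h3, rfl⟩ := key.1 hs
      obtain rfl : a = b := by simpa using h3
      rcases queueLabel_cases a with ⟨_, hl⟩ | ⟨hn, _⟩
      · exact ⟨hq, id, a, k', q', h1, h2, hl.symm, rfl⟩
      · exact absurd ha hn
    · obtain ⟨hq, id, a, k', q', h1, h2, rfl, rfl⟩ := key.1 hs
      rcases queueLabel_cases a with ⟨hn, _⟩ | ⟨_, hl⟩
      · exact absurd rfl (ha a hn)
      · exact ⟨hq, id, a, k', q', h1, h2, hl.symm, rfl⟩
  · rintro ⟨hq, id, a, k', q', h1, h2, rfl, rfl⟩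
    have hs := key.2 ⟨hq, id, a, k', q', h1, h2, rfl, rfl⟩
    rcases queueLabel_cases a with ⟨ha, hl⟩ | ⟨ha, hl⟩ <;> rw [hl]
    · exact LTS.hide_step_iff.2 (.inl ⟨a, ha, rfl, hs⟩)
    · refine LTS.hide_step_iff.2 (.inr ⟨?_, hs⟩)
      rintro b hb ⟨⟩
      exact ha hb

/-- Transitions of an atomic variable. -/
inductive VarStep {V : Type} [DecidableEq V] (get set : V → Event N)
    (cas : V → V → Bool → Event N) : V → Event N → V → Prop where
  | get (v) : VarStep get set cas v (get v) v
  | set (v w) : VarStep get set cas v (set w) w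
  | cas (v e w) : VarStep get set cas v (cas e w (decide (e = v))) (if e = v then w else v)

theorem atomicVariable_step_iff {V : Type} [DecidableEq V] {get set : V → Event N}
    {cas : V → V → Bool → Event N} {v₀ v : V} {l : Act (Event N)} {X : Proc (Event N) V} :
    (ATOMIC_VARIABLE get set cas v₀).step (call v) l X ↔
      ∃ a w, l = .vis (.ev a) ∧ X = call w ∧ VarStep get set cas v a w := by
  simp only [ATOMIC_VARIABLE, Proc.toLTS, step_call_iff, atomicVariable]
  constructor
  · intro h
    cases l with
    | tau => simp [step_choice_tau_iff, step_input_iff, step_pre_iff] at h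
    | vis o =>
      simp only [step_choice_vis_iff, step_input_iff, step_pre_iff] at h
      obtain ⟨h, rfl⟩ | ⟨x, h, rfl⟩ | ⟨x, h, rfl⟩ := h
      · exact ⟨_, _, h, rfl, .get v⟩
      · exact ⟨_, _, h, rfl, .set v x⟩
      · refine ⟨_, if x.1 = v then x.2 else v, h, ?_, .cas v x.1 x.2⟩
        split_ifs <;> rfl
  · rintro ⟨a, w, rfl, rfl, h⟩
    simp only [step_choice_vis_iff, step_input_iff, step_pre_iff]
    cases h with
    | get => exact .inl ⟨rfl, rfl⟩
    | set => exact .inr (.inl ⟨_, rfl, rfl⟩)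
    | cas e w =>
      refine .inr (.inr ⟨(e, w), rfl, ?_⟩)
      split_ifs <;> simp_all

/-- The values of the shared data, with the control points of the users of the queue. -/
structure Data (N : ℕ) where
  qpc : NonNullPID N → QueuePC N
  queue : List (NonNullPID N)
  state : NonNullPID N → STATE
  owner : PID N

/-- The shared data, as a process. -/
def DATA_STORE (maxLen : ℕ) : LTS (Event N) :=
  LTS.interleave (QUEUE maxLen) (LTS.interleave STATE_VAR OWNER)

/-- The configuration of the shared data. -/
def Data.conf (maxLen : ℕ) (d : Data N) : (DATA_STORE (N := N) maxLen).State :=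
  ((queueConf maxLen d.qpc d.queue, ((fun p => Proc.call (d.state p)), Proc.call d.owner)) :
    (QUEUE (N := N) maxLen).State ×
      ((∀ p : NonNullPID N, (ATOMIC_VARIABLE (getState p) (setState p) (casState p) ACTIVE).State)
        × (OWNER (N := N)).State))

/-- Transitions of the shared data. -/
inductive DataStep (maxLen : ℕ) (d : Data N) : Act (Event N) → Data N → Prop where
  | queue {id a k' q'} (hq : d.queue.length ≤ maxLen) (hU : QueueUserStep id (d.qpc id) a k')
      (hQ : QueueSpecStep d.queue a q') : DataStep maxLen d (queueLabel a)
        { d with qpc := Function.update d.qpc id k', queue := q' }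
  | state {p a v} (h : VarStep (getState p) (setState p) (casState p) (d.state p) a v) :
      DataStep maxLen d (.vis (.ev a)) { d with state := Function.update d.state p v }
  | owner {a v} (h : VarStep getOwner setOwner casOwner d.owner a v) :
      DataStep maxLen d (.vis (.ev a)) { d with owner := v }

theorem interleave_step_iff {E : Type} {P Q : LTS E} {p : P.State} {q : Q.State} {l : Act E}
    {X : P.State × Q.State} (hl : l ≠ .vis .tick) : (LTS.interleave P Q).step (p, q) l X ↔
      (∃ p', P.step p l p' ∧ X = (p', q)) ∨ (∃ q', Q.step q l q' ∧ X = (p, q')) := by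
  constructor
  · intro h
    cases h with
    | tauLeft h => exact .inl ⟨_, h, rfl⟩
    | tauRight h => exact .inr ⟨_, h, rfl⟩
    | left _ h => exact .inl ⟨_, h, rfl⟩
    | right _ h => exact .inr ⟨_, h, rfl⟩
    | sync ha => exact absurd ha (Set.notMem_empty _)
    | tick => exact absurd rfl hl
  · rintro (⟨p', h, rfl⟩ | ⟨q', h, rfl⟩) <;> match l with
    | .tau => first | exact .tauLeft h | exact .tauRight h
    | .vis .tick => exact absurd rfl hl
    | .vis (.ev a) => first
      | exact .left (Set.notMem_empty _) h
      | exact .right (Set.notMem_empty _) h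

theorem interleave_tick {E : Type} {P Q : LTS E} {p p' : P.State} {q q' : Q.State}
    (h : (LTS.interleave P Q).step (p, q) (.vis .tick) (p', q')) :
    P.step p (.vis .tick) p' ∧ Q.step q (.vis .tick) q' := by
  cases h with
  | tick hP hQ => exact ⟨hP, hQ⟩

theorem data_step_iff {maxLen : ℕ} {d : Data N} {l : Act (Event N)}
    {X : (DATA_STORE (N := N) maxLen).State} (hl : l ≠ .vis .tick) :
    (DATA_STORE maxLen).step (d.conf maxLen) l X ↔
      ∃ d', X = d'.conf maxLen ∧ DataStep maxLen d l d' := by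
  constructor
  · intro h
    rcases (interleave_step_iff hl).1 h with ⟨p', hs, rfl⟩ | ⟨q', hs, rfl⟩
    · obtain ⟨hq, id, a, k', q', h1, h2, rfl, rfl⟩ := queue_step_iff.1 hs
      exact ⟨_, rfl, .queue hq h1 h2⟩
    · rcases (interleave_step_iff hl).1 hs with ⟨p', ht, rfl⟩ | ⟨q', ht, rfl⟩
      · obtain ⟨p, v, ⟨a, rfl, h1⟩, h2⟩ := LTS.interleaveAll_step_cases
          (P := fun p : NonNullPID N => ATOMIC_VARIABLE (getState p) (setState p) (casState p)
            ACTIVE) (conf := fun _ v => Proc.call v)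
          (R := fun p v l v' => ∃ a, l = .vis (.ev a) ∧
            VarStep (getState p) (setState p) (casState p) v a v')
          (fun p v l X h => by
            obtain ⟨a, k', h1, h2, h3⟩ := atomicVariable_step_iff.1 h
            exact ⟨k', h2, a, h1, h3⟩) hl ht
        exact ⟨_, by rw [h2]; rfl, .state h1⟩
      · obtain ⟨a, v, rfl, rfl, h1⟩ := atomicVariable_step_iff.1 ht
        exact ⟨_, rfl, .owner h1⟩
  · rintro ⟨d', rfl, h⟩
    cases h with
    | queue hq hU hQ =>
      exact (interleave_step_iff hl).2 (.inl ⟨_, queue_step_iff.2 ⟨hq, _, _, _, _, hU, hQ, rfl,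
        rfl⟩, rfl⟩)
    | @state p a v h =>
      refine (interleave_step_iff hl).2 (.inr ⟨_, (interleave_step_iff hl).2 (.inl ⟨_,
        LTS.interleaveAll_step_update (P := fun p : NonNullPID N => ATOMIC_VARIABLE (getState p)
          (setState p) (casState p) ACTIVE) (conf := fun _ v => Proc.call v) p hl
          (b := v) (atomicVariable_step_iff.2 ⟨_, _, rfl, rfl, h⟩), rfl⟩), rfl⟩)
    | owner h =>
      exact (interleave_step_iff hl).2 (.inr ⟨_, (interleave_step_iff hl).2 (.inr ⟨_,
        atomicVariable_step_iff.2 ⟨_, _, rfl, rfl, h⟩, rfl⟩), rfl⟩)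

/-- Joint termination would require the owner variable to terminate, and all its transitions are
events. -/
theorem data_not_tick {maxLen : ℕ} {d : Data N} {X : (DATA_STORE (N := N) maxLen).State} :
    ¬ (DATA_STORE maxLen).step (d.conf maxLen) (.vis .tick) X := by
  rintro (_ | _ | _ | _ | _ | ⟨-, h⟩)
  obtain ⟨-, hO⟩ := interleave_tick h
  obtain ⟨_, _, h, _⟩ := atomicVariable_step_iff.1 hO
  cases h

end ClaimRelease

namespace ClaimRelease

open CSP Event STATE Proc

variable {N : ℕ}

/-! ### The whole system -/

/-- The label with which the implementation with `HIDE` hidden shows the event `a`. -/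
def implLabel : Event N → Act (Event N)
  | endClaim u => .vis (.ev (endClaim u))
  | beginRelease u => .vis (.ev (beginRelease u))
  | _ => .tau

/-- The configuration of the implementation. -/
def implConf (maxLen : ℕ) (pc : NonNullPID N → UserPC N) (d : Data N) : (IMPL N maxLen).State :=
  ((d.conf maxLen, fun u => (pc u).term u) :
    (DATA_STORE (N := N) maxLen).State × (∀ u : NonNullPID N, (IMPL_USER u).State))

/-- Transitions of the implementation with `HIDE` hidden. -/
inductive ImplStep (maxLen : ℕ) (pc : NonNullPID N → UserPC N) (d : Data N) :
    Act (Event N) → (NonNullPID N → UserPC N) → Data N → Prop where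
  | tau {u k} (h : UserStep u (pc u) .tau k) :
      ImplStep maxLen pc d .tau (Function.update pc u k) d
  | ext {u a k} (h : UserStep u (pc u) (.vis (.ev a)) k) (ha : a ∉ (DATA : Set (Event N))) :
      ImplStep maxLen pc d (implLabel a) (Function.update pc u k) d
  | data {d'} (h : DataStep maxLen d .tau d') : ImplStep maxLen pc d .tau pc d'
  | sync {u a k d'} (h : UserStep u (pc u) (.vis (.ev a)) k) (ha : a ∈ (DATA : Set (Event N)))
      (hd : DataStep maxLen d (.vis (.ev a)) d') :
      ImplStep maxLen pc d .tau (Function.update pc u k) d'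

theorem DataStep.mem_DATA {maxLen : ℕ} {d d' : Data N} {a : Event N} {l : Act (Event N)}
    (h : DataStep maxLen d l d') (hl : l = .vis (.ev a)) : a ∈ (DATA : Set (Event N)) := by
  cases h with
  | queue hq hU hQ =>
    cases hQ <;> cases hl <;> simp [DATA]
  | state h => cases hl; cases h <;> simp [DATA]
  | owner h => cases hl; cases h <;> simp [DATA]

theorem UserStep.ne_tick {u : NonNullPID N} {k k' : UserPC N} {l : Act (Event N)}
    (h : UserStep u k l k') : l ≠ .vis .tick := by
  cases h <;> simp

theorem users_step_cases {pc : NonNullPID N → UserPC N} {l : Act (Event N)}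
    {X : ∀ u : NonNullPID N, (IMPL_USER u).State} (hl : l ≠ .vis .tick)
    (h : (LTS.interleaveAll fun u : NonNullPID N => IMPL_USER u).step
      (fun u => (pc u).term u) l X) :
    ∃ u k, UserStep u (pc u) l k ∧ X = fun v => (Function.update pc u k v).term v :=
  LTS.interleaveAll_step_cases (P := fun u : NonNullPID N => IMPL_USER u)
    (conf := fun u k => UserPC.term u k) (R := fun u k l k' => UserStep u k l k')
    (fun _ _ _ _ h => user_step_cases h) hl h

theorem users_step {pc : NonNullPID N → UserPC N} {l : Act (Event N)} {u : NonNullPID N}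
    {k : UserPC N} (h : UserStep u (pc u) l k) :
    (LTS.interleaveAll fun u : NonNullPID N => IMPL_USER u).step (fun u => (pc u).term u) l
      (fun v => (Function.update pc u k v).term v) :=
  LTS.interleaveAll_step_update (P := fun u : NonNullPID N => IMPL_USER u)
    (conf := fun u k => UserPC.term u k) u h.ne_tick (user_step_term h)

theorem implLabel_cases {u : NonNullPID N} {k k' : UserPC N} {a : Event N}
    (h : UserStep u k (.vis (.ev a)) k') (ha : a ∉ (DATA : Set (Event N))) :
    (a ∈ (HIDE : Set (Event N)) ∧ implLabel a = .tau) ∨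
      (a ∉ (HIDE : Set (Event N)) ∧ implLabel a = .vis (.ev a)) := by
  revert ha
  cases h <;> simp [DATA, HIDE, implLabel]

theorem system_step_cases {maxLen : ℕ} {pc : NonNullPID N → UserPC N} {d : Data N}
    {l : Act (Event N)} {X : (IMPL N maxLen).State}
    (h : (SYSTEM maxLen).step (implConf maxLen pc d) l X) :
    ∃ pc' d', X = implConf maxLen pc' d' ∧
      ((∃ u k, UserStep u (pc u) l k ∧ (∀ a ∈ (DATA : Set (Event N)), l ≠ .vis (.ev a)) ∧
        pc' = Function.update pc u k ∧ d' = d) ∨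
      (l = .tau ∧ pc' = pc ∧ DataStep maxLen d .tau d') ∨
      (∃ u k, ∃ a ∈ (DATA : Set (Event N)), l = .vis (.ev a) ∧ UserStep u (pc u) l k ∧
        DataStep maxLen d l d' ∧ pc' = Function.update pc u k)) := by
  cases h with
  | tauLeft h =>
    obtain ⟨d', rfl, h'⟩ := (data_step_iff (by simp)).1 h
    exact ⟨pc, d', rfl, .inr (.inl ⟨rfl, rfl, h'⟩)⟩
  | tauRight h =>
    obtain ⟨u, k, h', rfl⟩ := users_step_cases (by simp) h
    exact ⟨_, d, rfl, .inl ⟨u, k, h', by simp, rfl, rfl⟩⟩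
  | left ha h =>
    obtain ⟨d', rfl, h'⟩ := (data_step_iff (by simp)).1 h
    exact absurd (h'.mem_DATA rfl) ha
  | right ha h =>
    obtain ⟨u, k, h', rfl⟩ := users_step_cases (by simp) h
    exact ⟨_, d, rfl, .inl ⟨u, k, h', by rintro b hb ⟨⟩; exact ha hb, rfl, rfl⟩⟩
  | sync ha h₁ h₂ =>
    obtain ⟨d', rfl, h'⟩ := (data_step_iff (by simp)).1 h₁
    obtain ⟨u, k, h'', rfl⟩ := users_step_cases (by simp) h₂
    exact ⟨_, d', rfl, .inr (.inr ⟨u, k, _, ha, rfl, h'', h', rfl⟩)⟩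
  | tick h => exact absurd h data_not_tick

/-- The two layers of hiding are undone in turn. Data events occur only in synchronisation and
become internal; what survives the inner hiding is an event of a single user, which the outer hiding
shows as `implLabel`. -/
theorem impl_step_cases {maxLen : ℕ} {pc : NonNullPID N → UserPC N} {d : Data N}
    {l : Act (Event N)} {X : (IMPL N maxLen).State}
    (h : ((IMPL N maxLen).hide HIDE).step (implConf maxLen pc d) l X) :
    ∃ pc' d', X = implConf maxLen pc' d' ∧ ImplStep maxLen pc d l pc' d' := by
  have key : ∀ {l X}, (IMPL N maxLen).step (implConf maxLen pc d) l X →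
      ∃ pc' d', X = implConf maxLen pc' d' ∧ ((l = .tau ∧ ImplStep maxLen pc d .tau pc' d') ∨
        ∃ u k a, UserStep u (pc u) (.vis (.ev a)) k ∧ l = .vis (.ev a) ∧
          a ∉ (DATA : Set (Event N)) ∧ pc' = Function.update pc u k ∧ d' = d) := by
    intro l X h
    rcases LTS.hide_step_iff.1 h with ⟨a, ha, rfl, hs⟩ | ⟨ha, hs⟩
    · obtain ⟨pc', d', rfl, h'⟩ := system_step_cases hs
      refine ⟨pc', d', rfl, .inl ⟨rfl, ?_⟩⟩
      rcases h' with ⟨u, k, _, h', _⟩ | ⟨h', _⟩ | ⟨u, k, b, hb, hab, hu, hd, rfl⟩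
      · exact absurd rfl (h' a ha)
      · cases h'
      · cases hab
        exact .sync hu ha hd
    · obtain ⟨pc', d', rfl, h'⟩ := system_step_cases hs
      refine ⟨pc', d', rfl, ?_⟩
      rcases h' with ⟨u, k, hu, h', rfl, rfl⟩ | ⟨rfl, rfl, h'⟩ | ⟨u, k, b, hb, hab, hu, hd, rfl⟩
      · match l with
        | .tau => exact .inl ⟨rfl, .tau hu⟩
        | .vis .tick => exact absurd rfl hu.ne_tick
        | .vis (.ev a) => exact .inr ⟨u, k, a, hu, rfl, fun h => h' a h rfl, rfl, rfl⟩
      · exact .inl ⟨rfl, .data h'⟩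
      · exact absurd hab (ha b hb)
  rcases LTS.hide_step_iff.1 h with ⟨a, ha, rfl, hs⟩ | ⟨ha, hs⟩
  · obtain ⟨pc', d', rfl, ⟨hl, h'⟩ | ⟨u, k, b, hu, hab, hb, rfl, rfl⟩⟩ := key hs
    · cases hl
    · cases hab
      rcases implLabel_cases hu hb with ⟨_, hl⟩ | ⟨hn, _⟩
      · exact ⟨_, _, rfl, hl ▸ .ext hu hb⟩
      · exact absurd ha hn
  · obtain ⟨pc', d', rfl, ⟨rfl, h'⟩ | ⟨u, k, b, hu, rfl, hb, rfl, rfl⟩⟩ := key hs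
    · exact ⟨_, _, rfl, h'⟩
    · rcases implLabel_cases hu hb with ⟨hn, _⟩ | ⟨_, hl⟩
      · exact absurd rfl (ha b hn)
      · exact ⟨_, _, rfl, hl ▸ .ext hu hb⟩

theorem impl_step {maxLen : ℕ} {pc pc' : NonNullPID N → UserPC N} {d d' : Data N}
    {l : Act (Event N)} (h : ImplStep maxLen pc d l pc' d') :
    ((IMPL N maxLen).hide HIDE).step (implConf maxLen pc d) l (implConf maxLen pc' d') := by
  have tau_of_tau : (SYSTEM maxLen).step (implConf maxLen pc d) .tau (implConf maxLen pc' d') →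
      ((IMPL N maxLen).hide HIDE).step (implConf maxLen pc d) .tau (implConf maxLen pc' d') :=
    fun h => LTS.hide_step_iff.2 (.inr ⟨by simp, LTS.hide_step_iff.2 (.inr ⟨by simp, h⟩)⟩)
  cases h with
  | tau h => exact tau_of_tau (.tauRight (users_step h))
  | data h => exact tau_of_tau (.tauLeft ((data_step_iff (by simp)).2 ⟨_, rfl, h⟩))
  | @ext u a k h ha =>
    have hs : (IMPL N maxLen).step (implConf maxLen pc d) (.vis (.ev a))
        (implConf maxLen (Function.update pc u k) d) :=
      LTS.hide_step_iff.2 (.inr ⟨by rintro b hb ⟨⟩; exact ha hb, .right ha (users_step h)⟩)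
    rcases implLabel_cases h ha with ⟨hn, hl⟩ | ⟨hn, hl⟩ <;> rw [hl]
    · exact LTS.hide_step_iff.2 (.inl ⟨a, hn, rfl, hs⟩)
    · exact LTS.hide_step_iff.2 (.inr ⟨by rintro b hb ⟨⟩; exact hn hb, hs⟩)
  | @sync u a k d' h ha hd =>
    exact LTS.hide_step_iff.2 (.inr ⟨by simp, LTS.hide_step_iff.2 (.inl ⟨a, ha, rfl,
      .sync ha ((data_step_iff (by simp)).2 ⟨_, rfl, hd⟩) (users_step h)⟩)⟩)

end ClaimRelease

namespace ClaimRelease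

open CSP STATE

variable {ι : Type}

/-! ### The invariant of the protocol -/

/-- The role of a user in the protocol. -/
inductive Phase (ι : Type) : Type where
  /-- Not involved. -/
  | out
  /-- Engaging, but not yet in the queue. -/
  | engaged
  /-- In the queue, before looking at its head. -/
  | waiting
  /-- Has found itself at the head. -/
  | head
  /-- About to store itself as owner. -/
  | storing
  /-- About to replace the owner `own`. -/
  | stealing (own : Option ι)
  /-- About to replace the owner `NULL`, after a failure to replace the previous owner. -/
  | retrying
  /-- About to announce that it waits. -/
  | passive
  /-- Waiting to be scheduled. -/
  | parked
  /-- Holding the lock. -/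
  | owning
  /-- Has left the queue. -/
  | releasing
  /-- Has left the queue and seen `v` at its head. -/
  | peeked (v : Option ι)
  /-- Has made `h` the owner and is about to schedule it. -/
  | scheduling (h : ι)
  /-- Is about to schedule `h`, which has announced that it waits. -/
  | rescheduling (h : ι)

namespace Phase

/-- In the queue and not holding the lock. -/
def claiming : Phase ι → Bool
  | waiting => true
  | head => true
  | storing => true
  | stealing _ => true
  | retrying => true
  | passive => true
  | parked => true
  | out => false
  | engaged => false
  | owning => false
  | releasing => false
  | peeked _ => false
  | scheduling _ => false
  | rescheduling _ => false

/-- Known to be at the head of the queue while claiming. -/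
def atHead : Phase ι → Bool
  | head => true
  | storing => true
  | stealing _ => true
  | retrying => true
  | waiting => false
  | passive => false
  | parked => false
  | out => false
  | engaged => false
  | owning => false
  | releasing => false
  | peeked _ => false
  | scheduling _ => false
  | rescheduling _ => false

/-- The user to be scheduled. -/
def target : Phase ι → Option ι
  | scheduling h => some h
  | rescheduling h => some h
  | waiting => none
  | head => none
  | storing => none
  | stealing _ => none
  | retrying => none
  | passive => none
  | parked => none
  | out => none
  | engaged => none
  | owning => none
  | releasing => none
  | peeked _ => none

/-- Has left the queue and not yet given up the ownership. -/
def leaving : Phase ι → Bool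
  | releasing => true
  | peeked _ => true
  | scheduling _ => false
  | rescheduling _ => false
  | waiting => false
  | head => false
  | storing => false
  | stealing _ => false
  | retrying => false
  | passive => false
  | parked => false
  | out => false
  | engaged => false
  | owning => false

theorem claiming_of_leaving {p : Phase ι} (h : p.leaving = true) : p.claiming = false := by
  cases p <;> simp_all [leaving, claiming]

end Phase

/-- Transitions of the protocol at the level of roles, for the roles, the state variables, the queue
and the owner. -/
inductive PhaseStep [DecidableEq ι] : (ι → Phase ι) → (ι → STATE) → List ι → Option ι →
    (ι → Phase ι) → (ι → STATE) → List ι → Option ι → Prop where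
  | quiet {ph st q o} : PhaseStep ph st q o ph st q o
  | activate {ph st q o u} (h : ph u = .owning) :
      PhaseStep ph st q o ph (Function.update st u ACTIVE) q o
  | engage {ph st q o u} (h : ph u = .out) :
      PhaseStep ph st q o (Function.update ph u .engaged) (Function.update st u ENGAGING) q o
  | enqueue {ph st q o u} (h : ph u = .engaged) :
      PhaseStep ph st q o (Function.update ph u .waiting) st (q ++ [u]) o
  | peekHead {ph st q o u} (h : ph u = .waiting) (hq : q.head? = some u) :
      PhaseStep ph st q o (Function.update ph u .head) st q o
  | peekOther {ph st q o u} (h : ph u = .waiting) (hq : q.head? ≠ some u) :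
      PhaseStep ph st q o (Function.update ph u .passive) st q o
  | tryNull {ph st q u} (h : ph u = .head) :
      PhaseStep ph st q none (Function.update ph u .owning) st q (some u)
  | loadNull {ph st q u} (h : ph u = .head) :
      PhaseStep ph st q none (Function.update ph u .storing) st q none
  | loadSelf {ph st q u} (h : ph u = .head) :
      PhaseStep ph st q (some u) (Function.update ph u .passive) st q (some u)
  | loadOther {ph st q o u} (h : ph u = .head) (ho : o ≠ none) (hu : o ≠ some u) :
      PhaseStep ph st q o (Function.update ph u (.stealing o)) st q o
  | store {ph st q o u} (h : ph u = .storing) :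
      PhaseStep ph st q o (Function.update ph u .owning) st q (some u)
  | stealSucc {ph st q o u} (h : ph u = .stealing o) :
      PhaseStep ph st q o (Function.update ph u .owning) st q (some u)
  | stealFail {ph st q o u own} (h : ph u = .stealing own) (ho : own ≠ o) :
      PhaseStep ph st q o (Function.update ph u .retrying) st q o
  | retrySucc {ph st q u} (h : ph u = .retrying) :
      PhaseStep ph st q none (Function.update ph u .owning) st q (some u)
  | retryFail {ph st q o u} (h : ph u = .retrying) (ho : o ≠ none) :
      PhaseStep ph st q o (Function.update ph u .passive) st q o
  | park {ph st q o u} (h : ph u = .passive) (hs : st u = ENGAGING) :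
      PhaseStep ph st q o (Function.update ph u .parked) (Function.update st u WAITING) q o
  | pass {ph st q o u} (h : ph u = .passive) (hs : st u ≠ ENGAGING) :
      PhaseStep ph st q o (Function.update ph u .owning) st q o
  | yield {ph st q o u} (h : ph u = .parked) (hs : st u = SCHEDULED) :
      PhaseStep ph st q o (Function.update ph u .owning) st q o
  | dequeue {ph st q o u} (h : ph u = .owning) :
      PhaseStep ph st q o (Function.update ph u .releasing) st q.tail o
  | releasePeek {ph st q o u} (h : ph u = .releasing) :
      PhaseStep ph st q o (Function.update ph u (.peeked q.head?)) st q o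
  | transferNull {ph st q u} (h : ph u = .peeked none) :
      PhaseStep ph st q (some u) (Function.update ph u .out) st q none
  | transferSome {ph st q u v} (h : ph u = .peeked (some v)) :
      PhaseStep ph st q (some u) (Function.update ph u (.scheduling v)) st q (some v)
  | transferFail {ph st q o u v} (h : ph u = .peeked v) (ho : o ≠ some u) :
      PhaseStep ph st q o (Function.update ph u .out) st q o
  | scheduleSucc {ph st q o u v} (h : ph u = .scheduling v) (hs : st v = ENGAGING) :
      PhaseStep ph st q o (Function.update ph u .out) (Function.update st v SCHEDULED) q o
  | scheduleFail {ph st q o u v} (h : ph u = .scheduling v) (hs : st v ≠ ENGAGING) :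
      PhaseStep ph st q o (Function.update ph u (.rescheduling v)) st q o
  | rescheduleSucc {ph st q o u v} (h : ph u = .rescheduling v) (hs : st v = WAITING) :
      PhaseStep ph st q o (Function.update ph u .out) (Function.update st v SCHEDULED) q o
  | rescheduleFail {ph st q o u v} (h : ph u = .rescheduling v) (hs : st v ≠ WAITING) :
      PhaseStep ph st q o (Function.update ph u .out) st q o

/-- The invariant of the protocol. -/
structure PhaseInv (ph : ι → Phase ι) (st : ι → STATE)
    (q : List ι) (o : Option ι) : Prop where
  nodup : q.Nodup
  mem : ∀ p, p ∈ q ↔ (ph p).claiming = true ∨ ph p = .owning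
  owning : ∀ p, ph p = .owning → o = some p ∧ q.head? = some p
  storing : ∀ p, ph p = .storing → o = none
  atHead : ∀ p, (ph p).atHead = true → q.head? = some p
  stealing : ∀ p own, ph p = .stealing own →
    own ≠ none ∧ own ≠ some p ∧ (o = own ∨ o = none ∨ o = some p)
  retrying : ∀ p, ph p = .retrying → o = none ∨ o = some p
  owner : ∀ r, o = some r → ph r = .owning ∨ (ph r).leaving = true ∨
    ((ph r).claiming = true ∧ q.head? = some r ∧
      (st r = SCHEDULED ∨ ∃ s, (ph s).target = some r))
  target : ∀ s h, (ph s).target = some h → o = some h ∧ (ph h).claiming = true ∧ st h ≠ SCHEDULED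
  rescheduling : ∀ s h, ph s = .rescheduling h → st h = WAITING
  target_unique : ∀ s s' h, (ph s).target = some h → (ph s').target = some h → s = s'
  peeked : ∀ r v, ph r = .peeked (some v) → o = some r → q.head? = some v
  passive : ∀ p, ph p = .passive ∨ ph p = .parked → q.head? = some p →
    o ≠ none ∧ ∀ r, o = some r → ph r ≠ .peeked none
  engaged : ∀ p, ph p = .engaged → st p = ENGAGING
  unparked : ∀ p, (ph p).claiming = true → ph p ≠ .parked → st p = ENGAGING ∨ st p = SCHEDULED
  parked : ∀ p, ph p = .parked → st p = WAITING ∨ st p = SCHEDULED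
  scheduled : ∀ p, (ph p).claiming = true → st p = SCHEDULED → o = some p

attribute [local grind =] Phase.claiming Phase.atHead Phase.target Phase.leaving
attribute [local grind =] Function.update_apply

/-! ### Preservation of the protocol invariant -/

namespace PhaseInv

variable {ph ph' : ι → Phase ι} {st st' : ι → STATE}
  {q q' : List ι} {o o' : Option ι}

theorem of_head? (hI : PhaseInv ph st q o) (v : ι) (h : q.head? = some v) :
    (ph v).claiming = true ∨ ph v = .owning :=
  (hI.mem v).1 (List.mem_of_mem_head? h)

variable [DecidableEq ι]

theorem nodup_step (hI : PhaseInv ph st q o) (h : PhaseStep ph st q o ph' st' q' o') :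
    q'.Nodup := by
  have h_nodup := hI.nodup
  have h_mem := hI.mem
  clear hI
  cases h <;> grind -ring -linarith

/-- A user that dequeues is owning, hence at the head, so `tail` removes precisely that user, and by
`Nodup` no copy of it remains. -/
theorem mem_step (hI : PhaseInv ph st q o) (h : PhaseStep ph st q o ph' st' q' o') :
    ∀ p, p ∈ q' ↔ (ph' p).claiming = true ∨ ph' p = .owning := by
  have h_nodup := hI.nodup
  have h_mem := hI.mem
  have h_owning := hI.owning
  clear hI
  cases h <;> rcases q with _ | ⟨a, q⟩ <;> grind -ring -linarith

/-- A user comes to own either from the head of the queue by writing `owner`, or by finding its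
state changed to `SCHEDULED`; then `scheduled` makes it the recorded owner, and `owner` places it at
the head. An existing owner is not disturbed, since others that could overwrite it would have to be
at the head themselves or be leaving while still recorded as owner. -/
theorem owning_step (hI : PhaseInv ph st q o) (h : PhaseStep ph st q o ph' st' q' o') :
    ∀ p, ph' p = .owning → o' = some p ∧ q'.head? = some p := by
  have h_owning := hI.owning
  have h_atHead := hI.atHead
  have h_owner := hI.owner
  have h_storing := hI.storing
  have h_scheduled := hI.scheduled
  have h_unparked := hI.unparked
  have h_parked := hI.parked
  clear hI
  cases h <;> grind -ring -linarith

/-- Nobody else can replace `NULL` between the load and the store: this takes a claimant at the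
head, and the storing user occupies that place. Hence the unconditional store is safe. -/
theorem storing_step (hI : PhaseInv ph st q o) (h : PhaseStep ph st q o ph' st' q' o') :
    ∀ p, ph' p = .storing → o' = none := by
  have h_storing := hI.storing
  have h_atHead := hI.atHead
  clear hI
  cases h <;> grind -ring -linarith

theorem atHead_step (hI : PhaseInv ph st q o) (h : PhaseStep ph st q o ph' st' q' o') :
    ∀ p, (ph' p).atHead = true → q'.head? = some p := by
  have h_atHead := hI.atHead
  have h_owning := hI.owning
  clear hI
  cases h <;> grind -ring -linarith

/-- While `p` is at the head, the loaded owner can disappear only by its own transfer, which writes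
`NULL` or, by `peeked`, the head `p`. It cannot reinstall itself, so there is no ABA problem. -/
theorem stealing_step (hI : PhaseInv ph st q o) (h : PhaseStep ph st q o ph' st' q' o') :
    ∀ p own, ph' p = .stealing own →
    own ≠ none ∧ own ≠ some p ∧ (o' = own ∨ o' = none ∨ o' = some p) := by
  have h_stealing := hI.stealing
  have h_atHead := hI.atHead
  have h_peeked := hI.peeked
  clear hI
  cases h <;> grind -ring -linarith

/-- A failed theft rules out the loaded owner among the three values allowed by `stealing`. If the
retry from `NULL` fails as well, the lock has already been passed to `p`, so waiting is right. -/
theorem retrying_step (hI : PhaseInv ph st q o) (h : PhaseStep ph st q o ph' st' q' o') :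
    ∀ p, ph' p = .retrying → o' = none ∨ o' = some p := by
  have h_stealing := hI.stealing
  have h_retrying := hI.retrying
  have h_atHead := hI.atHead
  have h_peeked := hI.peeked
  clear hI
  cases h <;> grind -ring -linarith

/-- A transfer to `v` finds `v` at the head, still claiming and not yet scheduled, because the
recorded owner was another user. Afterwards `v` cannot stop claiming on its own: every way out needs
the owner `NULL`, a foreign owner to replace, or the state `SCHEDULED`. -/
theorem target_step (hI : PhaseInv ph st q o) (h : PhaseStep ph st q o ph' st' q' o') :
    ∀ s h, (ph' s).target = some h →
    o' = some h ∧ (ph' h).claiming = true ∧ st' h ≠ SCHEDULED := by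
  have h_target := hI.target
  have h_owner := hI.owner
  have h_scheduled := hI.scheduled
  have h_peeked := hI.peeked
  have h_atHead := hI.atHead
  have h_mem := hI.mem
  have h_owning := hI.owning
  have h_stealing := hI.stealing
  have h_storing := hI.storing
  have h_unparked := hI.unparked
  have h_parked := hI.parked
  have h_rescheduling := hI.rescheduling
  have h_target_unique := hI.target_unique
  have h_head := hI.of_head?
  have h_leaving := fun p => (ph p).claiming_of_leaving
  clear hI
  cases h <;> grind -ring -linarith

/-- The failed first attempt excludes `ENGAGING` and `target` excludes `SCHEDULED`, so by `unparked`
the target is parked, and by `parked` its state is `WAITING`. As it has no second scheduler, nobody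
changes this, and the second attempt is bound to succeed. -/
theorem rescheduling_step (hI : PhaseInv ph st q o) (h : PhaseStep ph st q o ph' st' q' o') :
    ∀ s h, ph' s = .rescheduling h → st' h = WAITING := by
  have h_rescheduling := hI.rescheduling
  have h_target := hI.target
  have h_target_unique := hI.target_unique
  have h_unparked := hI.unparked
  have h_parked := hI.parked
  clear hI
  cases h <;> grind -ring -linarith

/-- A new target arises while the owner is the transferring user, whereas a target already being
scheduled is itself the recorded owner and still claiming. -/
theorem target_unique_step (hI : PhaseInv ph st q o) (h : PhaseStep ph st q o ph' st' q' o') :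
    ∀ s s' h,
    (ph' s).target = some h → (ph' s').target = some h → s = s' := by
  have h_target_unique := hI.target_unique
  have h_target := hI.target
  clear hI
  cases h <;> grind -ring -linarith

/-- As long as `r` is the recorded owner nobody else owns, so nobody dequeues, and enqueuing does
not change the head of a nonempty queue. Nor can ownership come back to a user that has left the
queue. -/
theorem peeked_step (hI : PhaseInv ph st q o) (h : PhaseStep ph st q o ph' st' q' o') :
    ∀ r v, ph' r = .peeked (some v) → o' = some r → q'.head? = some v := by
  have h_peeked := hI.peeked
  have h_owning := hI.owning
  have h_mem := hI.mem
  have h_head := hI.of_head?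
  have h_leaving := fun p => (ph p).claiming_of_leaving
  clear hI
  cases h <;> grind -ring -linarith

/-- This excludes lost wake-ups. A passive user becomes the head only when the owner dequeues, and
that owner peeks afterwards, so it sees the new head and cannot take the queue for empty. A user
that turns passive while at the head does so only on finding itself recorded as owner. -/
theorem passive_step (hI : PhaseInv ph st q o) (h : PhaseStep ph st q o ph' st' q' o') :
    ∀ p, ph' p = .passive ∨ ph' p = .parked → q'.head? = some p →
    o' ≠ none ∧ ∀ r, o' = some r → ph' r ≠ .peeked none := by
  have h_passive := hI.passive
  have h_owning := hI.owning
  have h_retrying := hI.retrying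
  have h_peeked := hI.peeked
  have h_atHead := hI.atHead
  clear hI
  cases h <;> rcases q with _ | ⟨a, q⟩ <;> grind -ring -linarith

theorem engaged_step (hI : PhaseInv ph st q o) (h : PhaseStep ph st q o ph' st' q' o') :
    ∀ p, ph' p = .engaged → st' p = ENGAGING := by
  have h_engaged := hI.engaged
  have h_target := hI.target
  clear hI
  cases h <;> grind -ring -linarith

theorem unparked_step (hI : PhaseInv ph st q o) (h : PhaseStep ph st q o ph' st' q' o') :
    ∀ p, (ph' p).claiming = true → ph' p ≠ .parked →
    st' p = ENGAGING ∨ st' p = SCHEDULED := by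
  have h_unparked := hI.unparked
  have h_engaged := hI.engaged
  have h_target := hI.target
  clear hI
  cases h <;> grind -ring -linarith

theorem parked_step (hI : PhaseInv ph st q o) (h : PhaseStep ph st q o ph' st' q' o') :
    ∀ p, ph' p = .parked → st' p = WAITING ∨ st' p = SCHEDULED := by
  have h_parked := hI.parked
  have h_target := hI.target
  clear hI
  cases h <;> grind -ring -linarith

/-- Only schedulers write `SCHEDULED`, and their target is the recorded owner. A transfer away from
`p` would need `p` to be leaving, and a theft would need a thief at the head, where `owner` puts `p`
itself. -/
theorem scheduled_step (hI : PhaseInv ph st q o) (h : PhaseStep ph st q o ph' st' q' o') :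
    ∀ p, (ph' p).claiming = true → st' p = SCHEDULED → o' = some p := by
  have h_scheduled := hI.scheduled
  have h_engaged := hI.engaged
  have h_target := hI.target
  have h_owner := hI.owner
  have h_stealing := hI.stealing
  have h_atHead := hI.atHead
  have h_storing := hI.storing
  have h_head := hI.of_head?
  have h_leaving := fun p => (ph p).claiming_of_leaving
  clear hI
  cases h <;> grind -ring -linarith

/-- A scheduler gives up its target only after success; failure of the second attempt contradicts
`rescheduling`. -/
theorem target_or_scheduled (hI : PhaseInv ph st q o) (h : PhaseStep ph st q o ph' st' q' o') :
    ∀ s r, (ph s).target = some r → st' r = SCHEDULED ∨ (ph' s).target = some r := by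
  have h_target := hI.target
  have h_rescheduling := hI.rescheduling
  clear hI
  cases h <;> grind -ring -linarith

/-- The recorded owner passes from owning to leaving, and then a transfer makes the head the owner
with the transferring user as its scheduler. When that scheduler finishes, `target_or_scheduled`
supplies the state `SCHEDULED` instead. -/
theorem owner_step (hI : PhaseInv ph st q o) (h : PhaseStep ph st q o ph' st' q' o') :
    ∀ r, o' = some r → ph' r = .owning ∨ (ph' r).leaving = true ∨
    ((ph' r).claiming = true ∧ q'.head? = some r ∧
      (st' r = SCHEDULED ∨ ∃ s, (ph' s).target = some r)) := by
  have h_t := hI.target_or_scheduled h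
  have h_owner := hI.owner
  have h_owning := hI.owning
  have h_target := hI.target
  have h_scheduled := hI.scheduled
  have h_unparked := hI.unparked
  have h_parked := hI.parked
  have h_peeked := hI.peeked
  have h_head := hI.of_head?
  have h_leaving := fun p => (ph p).claiming_of_leaving
  clear hI
  cases h
  -- The existential needs the transferring user `u` as witness; the other two goals say that the
  -- peeked `v` is claiming and still the head.
  case transferSome u v h =>
    intro r hr
    obtain rfl : v = r := by simpa using hr
    refine .inr (.inr ⟨?_, ?_, .inr ⟨u, by simp [Phase.target]⟩⟩) <;> grind -ring -linarith
  all_goals rcases q with _ | ⟨a, q⟩ <;> grind -ring -linarith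

theorem step (hI : PhaseInv ph st q o) (h : PhaseStep ph st q o ph' st' q' o') :
    PhaseInv ph' st' q' o' where
  nodup := hI.nodup_step h
  mem := hI.mem_step h
  owning := hI.owning_step h
  storing := hI.storing_step h
  atHead := hI.atHead_step h
  stealing := hI.stealing_step h
  retrying := hI.retrying_step h
  owner := hI.owner_step h
  target := hI.target_step h
  rescheduling := hI.rescheduling_step h
  target_unique := hI.target_unique_step h
  peeked := hI.peeked_step h
  passive := hI.passive_step h
  engaged := hI.engaged_step h
  unparked := hI.unparked_step h
  parked := hI.parked_step h
  scheduled := hI.scheduled_step h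

end PhaseInv

end ClaimRelease

namespace ClaimRelease

open CSP Event STATE Proc

variable {N : ℕ}

/-! ### The implementation follows the protocol -/

/-- The role of the user `p` at a pair of control points of itself and of its queue access. -/
inductive HasPhase (p : NonNullPID N) : UserPC N → QueuePC N → Phase (NonNullPID N) → Prop where
  | idle : HasPhase p .idle .idle .out
  | engage : HasPhase p .engage .idle .out
  | enqueue : HasPhase p .enqueue .idle .engaged
  | enqueuing : HasPhase p .enqueueReturn (.enqueuing p) .engaged
  | enqueued : HasPhase p .enqueueReturn .enqueued .waiting
  | peek : HasPhase p .peek .idle .waiting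
  | peeking : HasPhase p .peekReturn .peeking .waiting
  | peekedSelf : HasPhase p .peekReturn (.returning (some p)) .head
  | peekedOther {v} (hv : v ≠ some p) : HasPhase p .peekReturn (.returning v) .passive
  | tryNull : HasPhase p .tryNull .idle .head
  | load : HasPhase p .load .idle .head
  | storeOwner : HasPhase p .storeOwner .idle .storing
  | steal {own} : HasPhase p (.steal own) .idle (.stealing own)
  | retryNull : HasPhase p .retryNull .idle .retrying
  | casWaiting : HasPhase p .casWaiting .idle .passive
  | yieldWait : HasPhase p .yieldWait .idle .parked
  | yieldActive : HasPhase p .yieldActive .idle .owning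
  | yieldEnd : HasPhase p .yieldEnd .idle .owning
  | activate : HasPhase p .activate .idle .owning
  | endClaim : HasPhase p .endClaim .idle .owning
  | claimed : HasPhase p .claimed .idle .owning
  | holding : HasPhase p .holding .idle .owning
  | dequeue : HasPhase p .dequeue .idle .owning
  | dequeuing : HasPhase p .dequeueReturn .dequeuing .owning
  | dequeued : HasPhase p .dequeueReturn (.returning (some p)) .releasing
  | releasePeek : HasPhase p .releasePeek .idle .releasing
  | releasePeeking : HasPhase p .releasePeekReturn .peeking .releasing
  | releasePeeked {v} : HasPhase p .releasePeekReturn (.returning v) (.peeked v)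
  | transfer {v} : HasPhase p (.transfer v) .idle (.peeked v)
  | schedule {h} : HasPhase p (.schedule h) .idle (.scheduling h)
  | reschedule {h} : HasPhase p (.reschedule h) .idle (.rescheduling h)
  | scheduled : HasPhase p .scheduled .idle .out
  | endRelease : HasPhase p .endRelease .idle .out
  | released : HasPhase p .released .idle .out

/-- The effect of the data event `a` on the shared data. -/
def DataEffect (d : Data N) : Event N → Data N → Prop
  | .owner .load v, d' => d.owner = v ∧ d' = d
  | .owner .store v, d' => d' = { d with owner := v }
  | .casOwner e w b, d' => b = decide (e = d.owner) ∧
      d' = { d with owner := if e = d.owner then w else d.owner }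
  | .state .load p v, d' => d.state p = v ∧ d' = d
  | .state .store p v, d' => d' = { d with state := Function.update d.state p v }
  | .casState p e w b, d' => b = decide (e = d.state p) ∧
      d' = { d with state := Function.update d.state p (if e = d.state p then w else d.state p) }
  | .enqueue p v, d' => d.qpc p = .idle ∧
      d' = { d with qpc := Function.update d.qpc p (.enqueuing v) }
  | .endEnqueue p, d' => d.qpc p = .enqueued ∧
      d' = { d with qpc := Function.update d.qpc p .idle }
  | .dequeue p, d' => d.qpc p = .idle ∧
      d' = { d with qpc := Function.update d.qpc p .dequeuing }
  | .peek p, d' => d.qpc p = .idle ∧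
      d' = { d with qpc := Function.update d.qpc p .peeking }
  | .ret p v, d' => d.qpc p = .returning v ∧
      d' = { d with qpc := Function.update d.qpc p .idle }
  | .linEnqueue p v, d' => d.qpc p = .enqueuing v ∧
      d' = { d with qpc := Function.update d.qpc p .enqueued, queue := d.queue ++ [v] }
  | .linDequeue p v, d' => d.qpc p = .dequeuing ∧ v = d.queue.head? ∧
      d' = { d with qpc := Function.update d.qpc p (.returning v), queue := d.queue.tail }
  | .linPeek p v, d' => d.qpc p = .peeking ∧ v = d.queue.head? ∧
      d' = { d with qpc := Function.update d.qpc p (.returning v) }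
  | _, _ => False

theorem DataEffect.of_queue {d : Data N} {id : NonNullPID N} {a : Event N} {k' : QueuePC N}
    {q' : List (NonNullPID N)} (hU : QueueUserStep id (d.qpc id) a k')
    (hQ : QueueSpecStep d.queue a q') :
    DataEffect d a { d with qpc := Function.update d.qpc id k', queue := q' } := by
  generalize hk : d.qpc id = k at hU
  cases hU <;> generalize hq : d.queue = q at hQ <;> cases hQ <;> simp [DataEffect, hk, hq]

theorem DataStep.dataEffect_vis {maxLen : ℕ} {d d' : Data N} {a : Event N}
    (h : DataStep maxLen d (.vis (.ev a)) d') : DataEffect d a d' := by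
  generalize hl : Act.vis (Obs.ev a) = l at h
  cases h with
  | @queue id b k' q' hq hU hQ =>
    obtain rfl : a = b := by
      rcases queueLabel_cases b with ⟨_, hb⟩ | ⟨_, hb⟩ <;> rw [hb] at hl <;> cases hl; rfl
    exact .of_queue hU hQ
  | @state p b v h =>
    cases hl
    generalize hs : d.state p = s at h
    cases h with
    | get => subst hs; simp [DataEffect]
    | set => simp [DataEffect]
    | cas => simp [DataEffect, hs]
  | owner h =>
    cases hl
    generalize hs : d.owner = s at h
    cases h with
    | get => subst hs; simp [DataEffect]
    | set => simp [DataEffect]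
    | cas => simp [DataEffect, hs]

theorem DataStep.dataEffect_tau {maxLen : ℕ} {d d' : Data N} (h : DataStep maxLen d .tau d') :
    ∃ a ∈ (queueHIDE : Set (Event N)), DataEffect d a d' := by
  generalize hl : Act.tau = l at h
  cases h with
  | @queue id b k' q' hq hU hQ =>
    rcases queueLabel_cases b with ⟨hb', hb⟩ | ⟨_, hb⟩ <;> rw [hb] at hl <;> cases hl
    exact ⟨b, hb', .of_queue hU hQ⟩
  | state h => cases hl
  | owner h => cases hl

section Simulation

variable {ph : NonNullPID N → Phase (NonNullPID N)} {d d' : Data N} {u : NonNullPID N}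
  {k k' : UserPC N} {a : Event N} {maxLen : ℕ}

theorem PhaseStep.quiet_update {ι : Type} [DecidableEq ι] {ph : ι → Phase ι} {st : ι → STATE}
    {q : List ι} {o : Option ι} {u : ι} {φ : Phase ι} (h : ph u = φ) :
    PhaseStep ph st q o (Function.update ph u φ) st q o := by
  subst h
  rw [Function.update_eq_self]
  exact .quiet

theorem UserStep.hasPhase_of_not_data {l : Act (Event N)} {qk : QueuePC N}
    {φ : Phase (NonNullPID N)} (h : UserStep u k l k')
    (hl : ∀ a ∈ (DATA : Set (Event N)), l ≠ .vis (.ev a)) (hk : HasPhase u k qk φ) :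
    HasPhase u k' qk φ := by
  cases h <;> first
    | (cases hk; constructor)
    | exact absurd rfl (hl _ (by simp [DATA]))

/-- Calls and returns of the queue are quiet for the roles, because its operations take effect at
internal events. A failed first attempt on `owner` is quiet too: the user merely goes on to load it.
-/
theorem UserStep.phaseStep (h : UserStep u k (.vis (.ev a)) k')
    (hd : DataEffect d a d') (hk : HasPhase u k (d.qpc u) (ph u)) :
    ∃ qk φ, d'.qpc = Function.update d.qpc u qk ∧ HasPhase u k' qk φ ∧
      PhaseStep ph d.state d.queue d.owner (Function.update ph u φ) d'.state d'.queue d'.owner := by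
  obtain ⟨qpc, q, st, o⟩ := d
  dsimp only at hk
  generalize hφ : ph u = φ at hk
  generalize hqk : qpc u = qk at hk
  -- Events on variables leave the queue accesses alone; this trivial update puts them in the common
  -- form of the conclusion.
  have hup : qpc = Function.update qpc u qk := by simp [← hqk]
  cases h <;> simp only [DataEffect] at hd
  case engage =>
    cases hk; subst hd
    exact ⟨_, _, hup, .enqueue, .engage hφ⟩
  case enqueue =>
    obtain ⟨-, rfl⟩ := hd; cases hk
    exact ⟨_, _, rfl, .enqueuing, .quiet_update hφ⟩
  case endEnqueue =>
    obtain ⟨hd, rfl⟩ := hd; cases hk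
    · simp [hqk] at hd
    · exact ⟨_, _, rfl, .peek, .quiet_update hφ⟩
  case peek =>
    obtain ⟨-, rfl⟩ := hd; cases hk
    exact ⟨_, _, rfl, .peeking, .quiet_update hφ⟩
  case peekHead =>
    obtain ⟨hd, rfl⟩ := hd; cases hk
    · simp [hqk] at hd
    · exact ⟨_, _, rfl, .tryNull, .quiet_update hφ⟩
    · rename_i hv
      simp [hqk, hv] at hd
  case peekOther hv =>
    obtain ⟨hd, rfl⟩ := hd; cases hk
    · simp [hqk] at hd
    · simp [hqk, hv.symm] at hd
    · exact ⟨_, _, rfl, .casWaiting, .quiet_update hφ⟩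
  case tryNullSucc =>
    obtain ⟨hb, rfl⟩ := hd; cases hk
    obtain rfl : none = o := by simpa using hb
    exact ⟨_, _, hup, .activate, by simpa using .tryNull hφ⟩
  case tryNullFail =>
    obtain ⟨hb, rfl⟩ := hd; cases hk
    have hb : none ≠ o := by simpa using hb
    exact ⟨_, _, hup, .load, by simpa [hb] using .quiet_update hφ⟩
  case loadNull =>
    obtain ⟨rfl, rfl⟩ := hd; cases hk
    exact ⟨_, _, hup, .storeOwner, .loadNull hφ⟩
  case loadSelf =>
    obtain ⟨rfl, rfl⟩ := hd; cases hk
    exact ⟨_, _, hup, .casWaiting, .loadSelf hφ⟩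
  case loadOther h1 h2 =>
    obtain ⟨rfl, rfl⟩ := hd; cases hk
    exact ⟨_, _, hup, .steal, .loadOther hφ h1 h2⟩
  case storeOwner =>
    subst hd; cases hk
    exact ⟨_, _, hup, .activate, .store hφ⟩
  case stealSucc own =>
    obtain ⟨hb, rfl⟩ := hd; cases hk
    obtain rfl : own = o := by simpa using hb
    exact ⟨_, _, hup, .activate, by simpa using .stealSucc hφ⟩
  case stealFail own =>
    obtain ⟨hb, rfl⟩ := hd; cases hk
    have hb : own ≠ o := by simpa using hb
    exact ⟨_, _, hup, .retryNull, by simpa [hb] using .stealFail hφ hb⟩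
  case retryNullSucc =>
    obtain ⟨hb, rfl⟩ := hd; cases hk
    obtain rfl : none = o := by simpa using hb
    exact ⟨_, _, hup, .activate, by simpa using .retrySucc hφ⟩
  case retryNullFail =>
    obtain ⟨hb, rfl⟩ := hd; cases hk
    have hb : none ≠ o := by simpa using hb
    exact ⟨_, _, hup, .casWaiting, by simpa [hb] using .retryFail hφ hb.symm⟩
  case waitSucc =>
    obtain ⟨hb, rfl⟩ := hd; cases hk
    have hb : ENGAGING = st u := by simpa using hb
    exact ⟨_, _, hup, .yieldWait, by simpa [hb] using .park hφ hb.symm⟩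
  case waitFail =>
    obtain ⟨hb, rfl⟩ := hd; cases hk
    have hb : ENGAGING ≠ st u := by simpa using hb
    exact ⟨_, _, hup, .activate, by simpa [hb] using .pass hφ hb.symm⟩
  case yieldWait =>
    obtain ⟨hs, rfl⟩ := hd; cases hk
    exact ⟨_, _, hup, .yieldActive, .yield hφ hs⟩
  case yieldActive =>
    subst hd; cases hk
    exact ⟨_, _, hup, .yieldEnd, by simpa [← hφ] using .activate hφ⟩
  case activate =>
    subst hd; cases hk
    exact ⟨_, _, hup, .endClaim, by simpa [← hφ] using .activate hφ⟩
  case dequeue =>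
    obtain ⟨-, rfl⟩ := hd; cases hk
    exact ⟨_, _, rfl, .dequeuing, .quiet_update hφ⟩
  case dequeueReturn =>
    obtain ⟨hd, rfl⟩ := hd; cases hk
    · simp [hqk] at hd
    · exact ⟨_, _, rfl, .releasePeek, .quiet_update hφ⟩
  case releasePeek =>
    obtain ⟨-, rfl⟩ := hd; cases hk
    exact ⟨_, _, rfl, .releasePeeking, .quiet_update hφ⟩
  case releasePeekReturn v =>
    obtain ⟨hd, rfl⟩ := hd; cases hk
    · simp [hqk] at hd
    · obtain rfl : _ = v := by simpa [hqk] using hd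
      exact ⟨_, _, rfl, .transfer, .quiet_update hφ⟩
  case transferNull b =>
    obtain ⟨-, rfl⟩ := hd; cases hk
    refine ⟨_, _, hup, .endRelease, ?_⟩
    dsimp only
    split_ifs with hb
    · subst hb
      exact .transferNull hφ
    · exact .transferFail hφ (Ne.symm hb)
  case transferSucc v =>
    obtain ⟨hb, rfl⟩ := hd; cases hk
    obtain rfl : some u = o := by simpa using hb
    exact ⟨_, _, hup, .schedule, by simpa using .transferSome hφ⟩
  case transferFail v =>
    obtain ⟨hb, rfl⟩ := hd; cases hk
    have hb : some u ≠ o := by simpa using hb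
    exact ⟨_, _, hup, .endRelease, by simpa [hb] using .transferFail hφ hb.symm⟩
  case scheduleSucc v =>
    obtain ⟨hb, rfl⟩ := hd; cases hk
    have hb : ENGAGING = st v := by simpa using hb
    exact ⟨_, _, hup, .scheduled, by simpa [hb] using .scheduleSucc hφ hb.symm⟩
  case scheduleFail v =>
    obtain ⟨hb, rfl⟩ := hd; cases hk
    have hb : ENGAGING ≠ st v := by simpa using hb
    exact ⟨_, _, hup, .reschedule, by simpa [hb] using .scheduleFail hφ hb.symm⟩
  case reschedule v b =>
    obtain ⟨-, rfl⟩ := hd; cases hk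
    refine ⟨_, _, hup, .scheduled, ?_⟩
    dsimp only
    split_ifs with hb
    · exact .rescheduleSucc hφ hb.symm
    · rw [Function.update_eq_self]
      exact .rescheduleFail hφ (Ne.symm hb)

/-- The linearization points of the queue carry the changes of role. The invariant is needed for
`linDequeue`: an owning user is the head, so it gets itself back, the only result that `RELEASE`
accepts. -/
theorem DataEffect.phaseStep {pc : NonNullPID N → UserPC N} (hd : DataEffect d a d')
    (ha : a ∈ (queueHIDE : Set (Event N))) (hk : ∀ p, HasPhase p (pc p) (d.qpc p) (ph p))
    (hI : PhaseInv ph d.state d.queue d.owner) :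
    ∃ u qk φ, d'.qpc = Function.update d.qpc u qk ∧ HasPhase u (pc u) qk φ ∧
      PhaseStep ph d.state d.queue d.owner (Function.update ph u φ) d'.state d'.queue d'.owner := by
  obtain ⟨qpc, q, st, o⟩ := d
  cases a <;> simp [queueHIDE] at ha <;> simp only [DataEffect] at hd
  case linEnqueue u v =>
    obtain ⟨hq, rfl⟩ := hd
    have hu := hk u
    dsimp only at hu
    rw [hq] at hu
    generalize hpc : pc u = k at hu
    generalize hφ : ph u = φ at hu
    cases hu
    exact ⟨u, _, _, rfl, hpc ▸ .enqueued, .enqueue hφ⟩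
  case linDequeue u v =>
    obtain ⟨hq, rfl, rfl⟩ := hd
    have hu := hk u
    dsimp only at hu
    rw [hq] at hu
    generalize hpc : pc u = k at hu
    generalize hφ : ph u = φ at hu
    cases hu
    have hh : q.head? = some u := (hI.owning u hφ).2
    exact ⟨u, _, _, rfl, by rw [hpc, hh]; exact .dequeued, .dequeue hφ⟩
  case linPeek u v =>
    obtain ⟨hq, rfl, rfl⟩ := hd
    have hu := hk u
    dsimp only at hu
    rw [hq] at hu
    generalize hpc : pc u = k at hu
    generalize hφ : ph u = φ at hu
    cases hu
    · by_cases hh : q.head? = some u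
      · exact ⟨u, _, _, rfl, by rw [hpc, hh]; exact .peekedSelf, .peekHead hφ hh⟩
      · exact ⟨u, _, _, rfl, by rw [hpc]; exact .peekedOther hh, .peekOther hφ hh⟩
    · exact ⟨u, _, _, rfl, hpc ▸ .releasePeeked, .releasePeek hφ⟩

/-- The control points and the data are consistent with the invariant of the protocol. -/
def ImplInv (pc : NonNullPID N → UserPC N) (d : Data N) : Prop :=
  ∃ ph : NonNullPID N → Phase (NonNullPID N), (∀ p, HasPhase p (pc p) (d.qpc p) (ph p)) ∧
    PhaseInv ph d.state d.queue d.owner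

theorem ImplInv.step {pc pc' : NonNullPID N → UserPC N} {l : Act (Event N)}
    (hI : ImplInv pc d) (h : ImplStep maxLen pc d l pc' d') : ImplInv pc' d' := by
  obtain ⟨ph, hk, hI⟩ := hI
  have user : ∀ {u k l}, UserStep u (pc u) l k →
      (∀ a ∈ (DATA : Set (Event N)), l ≠ .vis (.ev a)) →
      ImplInv (Function.update pc u k) d := by
    intro u k l h hl
    refine ⟨ph, fun p => ?_, hI⟩
    obtain rfl | hp := eq_or_ne p u
    · simpa using h.hasPhase_of_not_data hl (hk p)
    · simpa [hp] using hk p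
  cases h with
  | tau h => exact user h (by simp)
  | ext h ha => exact user h (by rintro b hb ⟨⟩; exact ha hb)
  | data h =>
    obtain ⟨a, ha, hd⟩ := h.dataEffect_tau
    obtain ⟨u, qk, φ, hq, hu, hs⟩ := hd.phaseStep ha hk hI
    refine ⟨_, fun p => ?_, hI.step hs⟩
    rw [hq]
    obtain rfl | hp := eq_or_ne p u
    · simpa using hu
    · simpa [hp] using hk p
  | sync h ha hd =>
    rename_i u a k
    obtain ⟨qk, φ, hq, hu, hs⟩ := h.phaseStep hd.dataEffect_vis (hk u)
    refine ⟨_, fun p => ?_, hI.step hs⟩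
    rw [hq]
    obtain rfl | hp := eq_or_ne p u
    · simpa using hu
    · simpa [hp] using hk p

end Simulation

end ClaimRelease

namespace ClaimRelease

open CSP Event STATE Proc

variable {N : ℕ}

/-! ### The implementation as a lock -/

/-- The user holds the lock visibly. -/
def UserPC.Critical (k : UserPC N) : Prop := k = claimed ∨ k = holding

/-- A bound on the number of invisible steps of a user before its next visible one. -/
def UserPC.rank : UserPC N → ℕ
  | dequeue => 40
  | dequeueReturn => 39
  | releasePeek => 38
  | releasePeekReturn => 37
  | transfer _ => 36
  | schedule _ => 35
  | reschedule _ => 34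
  | scheduled => 33
  | endRelease => 32
  | released => 31
  | idle => 30
  | engage => 29
  | enqueue => 28
  | enqueueReturn => 27
  | peek => 26
  | peekReturn => 25
  | tryNull => 24
  | load => 23
  | storeOwner => 22
  | steal _ => 21
  | retryNull => 20
  | casWaiting => 19
  | yieldWait => 18
  | yieldActive => 17
  | yieldEnd => 16
  | activate => 15
  | claimed => 1
  | endClaim => 0
  | holding => 0

/-- The number of internal steps of a queue access. -/
def QueuePC.rank : QueuePC N → ℕ
  | enqueuing _ => 1
  | dequeuing => 1
  | peeking => 1
  | idle => 0
  | enqueued => 0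
  | returning _ => 0

theorem QueuePC.rank_le_one (k : QueuePC N) : k.rank ≤ 1 := by
  cases k <;> simp [rank]

/-- The label of the implementation with `HIDE` hidden for an action of a user. -/
def userLabel : Act (Event N) → Act (Event N)
  | .tau => .tau
  | .vis .tick => .vis .tick
  | .vis (.ev a) => implLabel a

theorem UserStep.visible_or {u : NonNullPID N} {k k' : UserPC N} {l : Act (Event N)}
    (h : UserStep u k l k') :
    (userLabel l = .tau ∧ k'.rank < k.rank ∧ (k'.Critical ↔ k.Critical) ∧
      k ≠ .endClaim ∧ k ≠ .holding) ∨
    (userLabel l = .vis (.ev (Event.endClaim u)) ∧ k = .endClaim ∧ k' = .claimed) ∨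
    (userLabel l = .vis (.ev (Event.beginRelease u)) ∧ k = .holding ∧ k' = .dequeue) := by
  cases h <;> simp [userLabel, implLabel, UserPC.rank, UserPC.Critical]

theorem UserStep.qpc_eq {u : NonNullPID N} {k k' : UserPC N} {a : Event N} {d d' : Data N}
    (h : UserStep u k (.vis (.ev a)) k') (hd : DataEffect d a d') :
    ∃ qk, d'.qpc = Function.update d.qpc u qk := by
  have hself : ∃ qk, d.qpc = Function.update d.qpc u qk := ⟨d.qpc u, by simp⟩
  cases h <;> simp only [DataEffect] at hd
  case enqueue | endEnqueue | peek | peekHead | peekOther | dequeue | dequeueReturn |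
      releasePeek | releasePeekReturn =>
    obtain ⟨-, rfl⟩ := hd
    exact ⟨_, rfl⟩
  case engage | storeOwner | yieldActive | activate => exact hd ▸ hself
  all_goals exact hd.2 ▸ hself

theorem DataEffect.qpc_rank_lt {a : Event N} {d d' : Data N} (hd : DataEffect d a d')
    (ha : a ∈ (queueHIDE : Set (Event N))) :
    ∃ u qk, d'.qpc = Function.update d.qpc u qk ∧ qk.rank < (d.qpc u).rank := by
  cases a <;> simp [queueHIDE] at ha <;> simp only [DataEffect] at hd
  case linEnqueue u v =>
    obtain ⟨hq, rfl⟩ := hd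
    exact ⟨u, _, rfl, by simp [hq, QueuePC.rank]⟩
  case linDequeue u v =>
    obtain ⟨hq, -, rfl⟩ := hd
    exact ⟨u, _, rfl, by simp [hq, QueuePC.rank]⟩
  case linPeek u v =>
    obtain ⟨hq, -, rfl⟩ := hd
    exact ⟨u, _, rfl, by simp [hq, QueuePC.rank]⟩

theorem implLabel_of_mem_DATA {a : Event N} (ha : a ∈ (DATA : Set (Event N))) :
    implLabel a = .tau := by
  cases a <;> simp_all [DATA, implLabel]

section Steps

variable {maxLen : ℕ} {pc pc' : NonNullPID N → UserPC N} {d d' : Data N} {l : Act (Event N)}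
  {u : NonNullPID N}

theorem ImplStep.user_or_queue (h : ImplStep maxLen pc d l pc' d') :
    (l = .tau ∧ pc' = pc ∧
      ∃ u qk, d'.qpc = Function.update d.qpc u qk ∧ qk.rank < (d.qpc u).rank) ∨
    (∃ u k l' qk, UserStep u (pc u) l' k ∧ pc' = Function.update pc u k ∧
      d'.qpc = Function.update d.qpc u qk ∧ l = userLabel l') := by
  cases h with
  | tau h => exact .inr ⟨_, _, _, _, h, rfl, (Function.update_eq_self _ _).symm, rfl⟩
  | ext h ha => exact .inr ⟨_, _, _, _, h, rfl, (Function.update_eq_self _ _).symm, rfl⟩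
  | data h =>
    obtain ⟨a, ha, hd⟩ := h.dataEffect_tau
    exact .inl ⟨rfl, rfl, hd.qpc_rank_lt ha⟩
  | sync h ha hd =>
    obtain ⟨qk, hq⟩ := h.qpc_eq hd.dataEffect_vis
    exact .inr ⟨_, _, _, _, h, rfl, hq, (implLabel_of_mem_DATA ha).symm⟩

/-- A bound on the number of invisible steps of the implementation. -/
def implRank (pc : NonNullPID N → UserPC N) (d : Data N) : ℕ :=
  ∑ u, (2 * (pc u).rank + (d.qpc u).rank)

theorem implRank_lt {k : UserPC N} {qk : QueuePC N} (hd : d'.qpc = Function.update d.qpc u qk)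
    (h : 2 * k.rank + qk.rank < 2 * (pc u).rank + (d.qpc u).rank) :
    implRank (Function.update pc u k) d' < implRank pc d := by
  have h := sum_update_lt (fun _ (x : UserPC N × QueuePC N) => 2 * x.1.rank + x.2.rank)
    (fun v => (pc v, d.qpc v)) u (k, qk) h
  refine lt_of_eq_of_lt (Finset.sum_congr rfl fun v _ => ?_) h
  rw [hd]
  obtain rfl | hv := eq_or_ne v u
  · simp
  · simp [hv]

/-- The invariant of the implementation, where `m` is the user which holds the lock visibly. -/
def ImplLockInv (m : PID N) (pc : NonNullPID N → UserPC N) (d : Data N) : Prop :=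
  ImplInv pc d ∧ ∀ u, (pc u).Critical ↔ m = some u

theorem HasPhase.owning {qk : QueuePC N} {φ : Phase (NonNullPID N)} {k : UserPC N}
    (h : HasPhase u k qk φ) (hk : k.Critical ∨ k = .endClaim) : φ = .owning := by
  cases h <;> simp_all [UserPC.Critical]

/-- Both users have the role `owning`, and `owner` records a single user. -/
theorem ImplInv.critical_unique {v : NonNullPID N} (hI : ImplInv pc d)
    (hu : (pc u).Critical ∨ pc u = .endClaim) (hv : (pc v).Critical ∨ pc v = .endClaim) :
    u = v := by
  obtain ⟨ph, hk, hI⟩ := hI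
  have h1 := (hI.owning u ((hk u).owning hu)).1
  have h2 := (hI.owning v ((hk v).owning hv)).1
  simpa using h1.symm.trans h2

theorem ImplLockInv.step {m : PID N} (hI : ImplLockInv m pc d)
    (h : ImplStep maxLen pc d l pc' d') :
    (l = .tau ∧ ImplLockInv m pc' d' ∧ implRank pc' d' < implRank pc d) ∨
    (m = none ∧ ∃ u, l = .vis (.ev (endClaim u)) ∧ ImplLockInv (some u) pc' d') ∨
    (∃ u, m = some u ∧ l = .vis (.ev (beginRelease u)) ∧ ImplLockInv none pc' d') := by
  have hI' := hI.1.step h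
  obtain ⟨hI, hm⟩ := hI
  rcases h.user_or_queue with ⟨rfl, rfl, u, qk, hq, hr⟩ | ⟨u, k, l', qk, hs, rfl, hq, rfl⟩
  · refine .inl ⟨rfl, ⟨hI', hm⟩, ?_⟩
    have h := implRank_lt (pc := pc') (u := u) (k := pc' u) hq (by omega)
    rwa [Function.update_eq_self] at h
  · rcases hs.visible_or with ⟨hl, hr, hc, _⟩ | ⟨hl, hk, rfl⟩ | ⟨hl, hk, rfl⟩
    · refine .inl ⟨hl, ⟨hI', fun v => ?_⟩, implRank_lt hq ?_⟩
      · rw [← hm v]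
        obtain rfl | hv := eq_or_ne v u
        · simpa using hc
        · simp [hv]
      · have := qk.rank_le_one
        omega
    · have hn : m = none := by
        rw [Option.eq_none_iff_forall_ne_some]
        rintro v rfl
        have hv := (hm v).2 rfl
        obtain rfl := hI.critical_unique (.inl hv) (.inr hk)
        simp [hk, UserPC.Critical] at hv
      refine .inr (.inl ⟨hn, u, hl, hI', fun v => ?_⟩)
      obtain rfl | hv := eq_or_ne v u
      · simp [UserPC.Critical]
      · simp [hv, hm, hn, hv.symm]
    · have hu : m = some u := (hm u).1 (.inr hk)
      refine .inr (.inr ⟨u, hu, hl, hI', fun v => ?_⟩)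
      obtain rfl | hv := eq_or_ne v u
      · simp [UserPC.Critical]
      · simp [hv, hm, hu, hv.symm]

/-- At these control points the only move of `u` is visible, so an internal step comes from another
user or from the queue. -/
theorem ImplStep.pc_eq (h : ImplStep maxLen pc d .tau pc' d')
    (hk : pc u = .endClaim ∨ pc u = .holding) : pc' u = pc u := by
  rcases h.user_or_queue with ⟨_, rfl, _⟩ | ⟨v, k, l', qk, hs, rfl, _, hl⟩
  · rfl
  · rcases hs.visible_or with ⟨_, _, _, h1, h2⟩ | ⟨hl', _⟩ | ⟨hl', _⟩
    · have hv : u ≠ v := by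
        rintro rfl
        simp_all
      simp [hv]
    · simp [hl'] at hl
    · simp [hl'] at hl

theorem implStep_endClaim (hk : pc u = .endClaim) :
    ImplStep maxLen pc d (.vis (.ev (endClaim u))) (Function.update pc u .claimed) d :=
  .ext (a := endClaim u) (hk ▸ .endClaim) (by simp [DATA])

theorem implStep_beginRelease (hk : pc u = .holding) :
    ImplStep maxLen pc d (.vis (.ev (beginRelease u))) (Function.update pc u .dequeue) d :=
  .ext (a := beginRelease u) (hk ▸ .beginRelease) (by simp [DATA])

theorem ImplStep.eq_of_endClaim (h : ImplStep maxLen pc d (.vis (.ev (Event.endClaim u))) pc' d') :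
    pc u = .endClaim := by
  rcases h.user_or_queue with ⟨hl, _⟩ | ⟨v, k, l', qk, hs, rfl, _, hl⟩
  · cases hl
  · rcases hs.visible_or with ⟨hl', _⟩ | ⟨hl', hk, _⟩ | ⟨hl', _⟩ <;> rw [hl'] at hl <;> cases hl
    exact hk

theorem ImplStep.eq_of_beginRelease
    (h : ImplStep maxLen pc d (.vis (.ev (beginRelease u))) pc' d') : pc u = .holding := by
  rcases h.user_or_queue with ⟨hl, _⟩ | ⟨v, k, l', qk, hs, rfl, _, hl⟩
  · cases hl
  · rcases hs.visible_or with ⟨hl', _⟩ | ⟨hl', _⟩ | ⟨hl', hk, _⟩ <;> rw [hl'] at hl <;> cases hl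
    exact hk

theorem exists_implStep_owner {a : Event N} {k : UserPC N} {v : PID N}
    (h : UserStep u (pc u) (.vis (.ev a)) k)
    (hv : VarStep getOwner setOwner casOwner d.owner a v) :
    ∃ pc' d', ImplStep maxLen pc d .tau pc' d' :=
  have hd := DataStep.owner hv
  ⟨_, _, .sync h (hd.mem_DATA rfl) hd⟩

theorem exists_implStep_state {a : Event N} {k : UserPC N} {p : NonNullPID N} {v : STATE}
    (h : UserStep u (pc u) (.vis (.ev a)) k)
    (hv : VarStep (getState p) (setState p) (casState p) (d.state p) a v) :
    ∃ pc' d', ImplStep maxLen pc d .tau pc' d' :=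
  have hd := DataStep.state hv
  ⟨_, _, .sync h (hd.mem_DATA rfl) hd⟩

/-- A compare-and-swap has exactly one possible outcome for the current value, so the user is never
blocked if it accepts both answers. -/
theorem exists_implStep_casOwner {e w : PID N} {k k' : UserPC N}
    (hf : UserStep u (pc u) (.vis (.ev (casOwner e w false))) k)
    (ht : UserStep u (pc u) (.vis (.ev (casOwner e w true))) k') :
    ∃ pc' d', ImplStep maxLen pc d .tau pc' d' := by
  have hv := VarStep.cas (get := getOwner) (set := setOwner) (cas := casOwner) d.owner e w
  cases hb : decide (e = d.owner) <;> rw [hb] at hv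
  exacts [exists_implStep_owner hf hv, exists_implStep_owner ht hv]

theorem exists_implStep_casState {p : NonNullPID N} {e w : STATE} {k k' : UserPC N}
    (hf : UserStep u (pc u) (.vis (.ev (casState p e w false))) k)
    (ht : UserStep u (pc u) (.vis (.ev (casState p e w true))) k') :
    ∃ pc' d', ImplStep maxLen pc d .tau pc' d' := by
  have hv := VarStep.cas (get := getState p) (set := setState p) (cas := casState p) (d.state p) e w
  cases hb : decide (e = d.state p) <;> rw [hb] at hv
  exacts [exists_implStep_state hf hv, exists_implStep_state ht hv]

theorem exists_implStep_queue {a : Event N} {k : UserPC N} {qk : QueuePC N}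
    {q' : List (NonNullPID N)} (hq : d.queue.length ≤ maxLen)
    (hU : QueueUserStep u (d.qpc u) a qk) (hQ : QueueSpecStep d.queue a q')
    (hl : queueLabel a = .vis (.ev a)) (hS : UserStep u (pc u) (.vis (.ev a)) k) :
    ∃ pc' d', ImplStep maxLen pc d .tau pc' d' := by
  have hd := DataStep.queue hq hU hQ
  rw [hl] at hd
  exact ⟨_, _, .sync hS (hd.mem_DATA rfl) hd⟩

/-- A user which cannot proceed invisibly has the lock or waits to be scheduled. -/
theorem HasPhase.exists_implStep {φ : Phase (NonNullPID N)} (hq : d.queue.length ≤ maxLen)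
    (h : HasPhase u (pc u) (d.qpc u) φ) (h1 : pc u ≠ .endClaim) (h2 : ¬ (pc u).Critical) :
    (φ = .parked ∧ d.state u ≠ SCHEDULED) ∨ ∃ pc' d', ImplStep maxLen pc d .tau pc' d' := by
  have tau : ∀ {k}, UserStep u (pc u) .tau k → ∃ pc' d', ImplStep maxLen pc d .tau pc' d' :=
    fun h => ⟨_, _, .tau h⟩
  have ext : ∀ {a k}, UserStep u (pc u) (.vis (.ev a)) k → a ∉ (DATA : Set (Event N)) →
      implLabel a = .tau → ∃ pc' d', ImplStep maxLen pc d .tau pc' d' :=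
    fun h ha hl => ⟨_, _, hl ▸ ImplStep.ext h ha⟩
  have lin : ∀ {a qk q'}, QueueUserStep u (d.qpc u) a qk → QueueSpecStep d.queue a q' →
      queueLabel a = .tau → ∃ pc' d', ImplStep maxLen pc d .tau pc' d' :=
    fun hU hQ hl => ⟨_, _, .data (hl ▸ DataStep.queue hq hU hQ)⟩
  have owner := fun a k v => exists_implStep_owner (maxLen := maxLen) (pc := pc) (d := d) (u := u)
    (a := a) (k := k) (v := v)
  have state := fun a k p v => exists_implStep_state (maxLen := maxLen) (pc := pc) (d := d) (u := u)
    (a := a) (k := k) (p := p) (v := v)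
  have casOwner := fun e w k k' => exists_implStep_casOwner (maxLen := maxLen) (pc := pc) (d := d)
    (u := u) (e := e) (w := w) (k := k) (k' := k')
  have casState := fun p e w k k' => exists_implStep_casState (maxLen := maxLen) (pc := pc)
    (d := d) (u := u) (p := p) (e := e) (w := w) (k := k) (k' := k')
  have queue := fun a k qk q' => exists_implStep_queue (pc := pc) (u := u) (a := a) (k := k)
    (qk := qk) (q' := q') hq
  generalize hk : pc u = k at *
  generalize hqk : d.qpc u = qk at *
  cases h
  case endClaim => exact absurd rfl h1
  case claimed | holding => simp [UserPC.Critical] at h2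
  case yieldWait =>
    by_cases hs : d.state u = SCHEDULED
    · refine .inr (state _ _ u SCHEDULED .yieldWait ?_)
      rw [hs]
      exact .get _
    · exact .inl ⟨rfl, hs⟩
  all_goals right
  case idle => exact ext .beginClaim (by simp [DATA]) rfl
  case engage => exact state _ _ _ _ .engage (.set _ _)
  case enqueue => exact queue _ _ _ _ (.enqueue _) (.enqueue _ _ _) rfl .enqueue
  case enqueuing => exact lin (.linEnqueue _) (.linEnqueue _ _ _) rfl
  case enqueued => exact queue _ _ _ _ .endEnqueue (.endEnqueue _ _) rfl .endEnqueue
  case peek => exact queue _ _ _ _ .peek (.peek _ _) rfl .peek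
  case peeking => exact lin (.linPeek _) (.linPeek _ _) rfl
  case peekedSelf => exact queue _ _ _ _ (.ret _) (.ret _ _ _) rfl .peekHead
  case peekedOther hv => exact queue _ _ _ _ (.ret _) (.ret _ _ _) rfl (.peekOther hv)
  case tryNull => exact casOwner _ _ _ _ .tryNullFail .tryNullSucc
  case load =>
    have hl : ∃ k, UserStep u .load (.vis (.ev (getOwner d.owner))) k := by
      by_cases h1 : d.owner = none
      · exact h1 ▸ ⟨_, .loadNull⟩
      by_cases h2 : d.owner = some u
      · exact h2 ▸ ⟨_, .loadSelf⟩
      exact ⟨_, .loadOther h1 h2⟩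
    obtain ⟨k, hl⟩ := hl
    exact owner _ _ _ hl (.get _)
  case storeOwner => exact owner _ _ _ .storeOwner (.set _ _)
  case steal => exact casOwner _ _ _ _ .stealFail .stealSucc
  case retryNull =>
    exact casOwner _ _ _ _ .retryNullFail .retryNullSucc
  case casWaiting =>
    exact casState _ _ _ _ _ .waitFail .waitSucc
  case yieldActive => exact state _ _ _ _ .yieldActive (.set _ _)
  case yieldEnd => exact tau .yieldEnd
  case activate => exact state _ _ _ _ .activate (.set _ _)
  case dequeue => exact queue _ _ _ _ .dequeue (.dequeue _ _) rfl .dequeue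
  case dequeuing => exact lin (.linDequeue _) (.linDequeue _ _) rfl
  case dequeued => exact queue _ _ _ _ (.ret _) (.ret _ _ _) rfl .dequeueReturn
  case releasePeek => exact queue _ _ _ _ .peek (.peek _ _) rfl .releasePeek
  case releasePeeking => exact lin (.linPeek _) (.linPeek _ _) rfl
  case releasePeeked => exact queue _ _ _ _ (.ret _) (.ret _ _ _) rfl .releasePeekReturn
  case transfer v =>
    cases v with
    | none => exact casOwner _ _ _ _ .transferNull .transferNull
    | some v =>
      exact casOwner _ _ _ _ .transferFail .transferSucc
  case schedule =>
    exact casState _ _ _ _ _ .scheduleFail .scheduleSucc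
  case reschedule => exact casState _ _ _ _ _ .reschedule .reschedule
  case scheduled => exact tau .scheduled
  case endRelease => exact ext .endRelease (by simp [DATA]) rfl
  case released => exact tau .released

end Steps

/-- Some user with a role in the queue is not blocked. -/
theorem PhaseInv.exists_not_blocked {ι : Type} [DecidableEq ι] {ph : ι → Phase ι}
    {st : ι → STATE} {q : List ι} {o : Option ι} (hI : PhaseInv ph st q o) (u : ι) :
    ∃ v, ¬ (ph v = .parked ∧ st v ≠ SCHEDULED) := by
  -- If everyone is parked and unscheduled, the head of the queue is, so `passive` provides a
  -- recorded owner. By `owner` that user is owning, leaving, scheduled, or some user is scheduling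
  -- it, and none of these agrees with all being parked and unscheduled.
  by_contra! hb
  have hu : u ∈ q := (hI.mem u).2 (.inl (by rw [(hb u).1]; rfl))
  obtain ⟨h, hh⟩ : ∃ h, q.head? = some h := by
    cases q with
    | nil => simp at hu
    | cons a q => exact ⟨a, rfl⟩
  have ho := (hI.passive h (.inr (hb h).1) hh).1
  obtain ⟨r, hr⟩ := Option.ne_none_iff_exists'.1 ho
  rcases hI.owner r hr with h1 | h1 | ⟨_, _, h1 | ⟨s, h1⟩⟩
  · simp [(hb r).1] at h1
  · simp [(hb r).1, Phase.leaving] at h1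
  · exact (hb r).2 h1
  · simp [(hb s).1, Phase.target] at h1

theorem ImplInv.init :
    ImplInv (N := N) (fun _ => .idle) ⟨fun _ => .idle, [], fun _ => ACTIVE, none⟩ := by
  refine ⟨fun _ => .out, fun _ => .idle, ?_⟩
  constructor <;> simp [Phase.claiming, Phase.atHead, Phase.target]

theorem impl_lockInvariant {maxLen : ℕ} (hN : 1 ≤ N) (hmax : N ≤ maxLen) :
    LockInvariant ((IMPL N maxLen).hide HIDE) (fun m X =>
      ∃ c : (NonNullPID N → UserPC N) × Data N, X = implConf maxLen c.1 c.2 ∧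
        ImplLockInv m c.1 c.2) where
  init := ⟨(fun _ => .idle, ⟨fun _ => .idle, [], fun _ => ACTIVE, none⟩), rfl, .init,
    by simp [UserPC.Critical]⟩
  tau := by
    rintro m _ q' ⟨⟨pc, d⟩, rfl, hI⟩ hs
    obtain ⟨pc', d', rfl, h⟩ := impl_step_cases hs
    rcases hI.step h with ⟨-, hI', -⟩ | ⟨_, _, hl, _⟩ | ⟨_, _, hl, _⟩
    · exact ⟨(pc', d'), rfl, hI'⟩
    · cases hl
    · cases hl
  vis := by
    rintro m _ o q' ⟨⟨pc, d⟩, rfl, hI⟩ hs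
    obtain ⟨pc', d', rfl, h⟩ := impl_step_cases hs
    rcases hI.step h with ⟨hl, -⟩ | ⟨rfl, u, hl, hI'⟩ | ⟨u, rfl, hl, hI'⟩ <;> cases hl
    · exact .inl ⟨rfl, u, rfl, (pc', d'), rfl, hI'⟩
    · exact .inr ⟨u, rfl, rfl, (pc', d'), rfl, hI'⟩
  claimable := by
    rintro _ ⟨⟨pc, d⟩, rfl, ⟨ph, hk, hI⟩, hm⟩ hs
    dsimp only at hk hI hm
    by_contra! hne
    -- A queue without duplicates has at most `N` entries, so the guard on its events always holds.
    have hq : d.queue.length ≤ maxLen := by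
      have := hI.nodup.length_le_card
      rw [Fintype.card_fin] at this
      omega
    obtain ⟨v, hv⟩ := hI.exists_not_blocked ⟨0, hN⟩
    rcases (hk v).exists_implStep hq (fun h => hne v ⟨_, impl_step (implStep_endClaim h)⟩)
      (by simp [hm]) with h | ⟨pc', d', h⟩
    · exact hv h
    · exact hs _ (impl_step h)
  releasable := by
    rintro _ u ⟨⟨pc, d⟩, rfl, -, hm⟩
    rcases (hm u).2 rfl with hk | hk
    -- Just after `endClaim` the `SKIP` that ends `CLAIM` is still to be resolved by one `τ`.
    · refine ⟨_, .single_tau (impl_step (.tau (u := u) (k := .holding) ?_)), _,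
        impl_step (implStep_beginRelease (u := u) ?_)⟩
      · rw [hk]; exact .claimed
      · simp
    · exact ⟨_, .nil _, _, impl_step (implStep_beginRelease hk)⟩
  not_diverges := by
    rintro m _ ⟨c, rfl, hI⟩
    refine LTS.not_diverges_of_rank (P := (IMPL N maxLen).hide HIDE)
      (fun c : (NonNullPID N → UserPC N) × Data N => implConf maxLen c.1 c.2)
      (fun c => ImplLockInv m c.1 c.2) (fun c => implRank c.1 c.2) ?_ hI
    rintro ⟨pc, d⟩ q hI hs
    obtain ⟨pc', d', rfl, h⟩ := impl_step_cases hs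
    rcases hI.step h with ⟨-, hI', hr⟩ | ⟨_, _, hl, _⟩ | ⟨_, _, hl, _⟩
    · exact ⟨(pc', d'), rfl, hI', hr⟩
    · cases hl
    · cases hl
  endClaim_stable := by
    rintro m _ q' u ⟨⟨pc, d⟩, rfl, hI⟩ ⟨r, hr⟩ hs
    obtain ⟨_, _, rfl, hv⟩ := impl_step_cases hr
    obtain ⟨pc', d', rfl, h⟩ := impl_step_cases hs
    have hk := hv.eq_of_endClaim
    exact ⟨_, impl_step (implStep_endClaim ((h.pc_eq (.inl hk)).trans hk))⟩
  beginRelease_stable := by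
    rintro m _ q' u ⟨⟨pc, d⟩, rfl, hI⟩ ⟨r, hr⟩ hs
    obtain ⟨_, _, rfl, hv⟩ := impl_step_cases hr
    obtain ⟨pc', d', rfl, h⟩ := impl_step_cases hs
    have hk := hv.eq_of_beginRelease
    exact ⟨_, impl_step (implStep_beginRelease ((h.pc_eq (.inr hk)).trans hk))⟩

end ClaimRelease

/-! ### Assembly of the refinements and of the stability of the lock -/

theorem mainTheorem4 (N : ℕ) (hN₁ : 1 ≤ N) (hN₄ : N ≤ 4) (maxLen : ℕ) (hmax : N ≤ maxLen)
    (sel : (ClaimRelease.SPEC N).State → (ClaimRelease.SPEC N).State)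
    (hsel : (ClaimRelease.SPEC N).IsTauSelection sel) :
    (((ClaimRelease.TauPriorSpec N sel).hide ClaimRelease.HIDE).RefinedByF
        ((ClaimRelease.SPEC N).hide ClaimRelease.HIDE) ∧
      ((ClaimRelease.TauPriorSpec N sel).hide ClaimRelease.HIDE).RefinedByFD
        ((ClaimRelease.SPEC N).hide ClaimRelease.HIDE)) ∧
    (((ClaimRelease.TauPriorSpec N sel).hide ClaimRelease.HIDE).RefinedByF
        ((ClaimRelease.IMPL N maxLen).hide ClaimRelease.HIDE) ∧
      ((ClaimRelease.TauPriorSpec N sel).hide ClaimRelease.HIDE).RefinedByFD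
        ((ClaimRelease.IMPL N maxLen).hide ClaimRelease.HIDE)) ∧
    ClaimRelease.HoldsLockStably ((ClaimRelease.SPEC N).hide ClaimRelease.HIDE) ∧
    ClaimRelease.HoldsLockStably ((ClaimRelease.IMPL N maxLen).hide ClaimRelease.HIDE) := by
  have hP := ClaimRelease.tauPriorSpec_allowsLock hsel
  have hS := ClaimRelease.spec_lockInvariant hN₁
  have hI := ClaimRelease.impl_lockInvariant hN₁ hmax
  exact ⟨⟨hP.refinedByF hS, hP.refinedByFD hS⟩, ⟨hP.refinedByF hI, hP.refinedByFD hI⟩,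
    hS.holdsLockStably, hI.holdsLockStably⟩
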